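/- Let $k\ge 1$ be an integer, let $C_{2k+1}$ be the cycle with vertices $1,\dots,2k+1$ in cyclic order, and let $$\alpha_k=\left(\frac{2k+1}{2}\right)^{\frac1{2k+1}}\left(\frac{2k+1}{2k}\right)^{\frac{2k}{2k+1}}.$$ (a) There is a randomized algorithm (a random-access machine program with fair coin flips and logarithmic cost) that, given a simple undirected graph $G$ on $n$ vertices by its adjacency matrix, decides whether there is a homomorphism from $G$ to $C_{2k+1}$. For all outcomes of its coin flips it halts in time $\alpha_k^{\,n}\,n^{O(1)}$ and uses space polynomial in $n$. More precisely, there is a constant $c$ such that for every $n\ge 0$ the time is at most $c\,\alpha_k^{\,n}(n+1)^{c}$ and the space is at most $c\,(n+1)^{c}$; both the program and $c$ may depend on $k$. If there is a homomorphism, the algorithm answers YES with probability at least $2/3$; if there is none, it never answers YES. Moreover, let $\mathcal S_k=\{S_k,S_k^A,S_k^B\}$, where $S_k=\{2,\dots,2k+1\}$, $S_k^A$ is the set of odd vertices, and $S_k^B$ is the set of even vertices together with the vertex $1$. For $U,W\in\mathcal S_k$ let $R_{UW}=\{(u,w)\in U\times W: uw\in E(C_{2k+1})\}$. For a graph $G$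 and lists $L:V(G)\to\mathcal S_k$ let $I_{G,L}$ be the valued constraint satisfaction instance with one variable $x_v\in\{1,\dots,2k+1\}$ for every $v\in V(G)$ and, for every edge $uv$ of $G$, one term $\phi_{uv}(x_u,x_v)$ equal to $0$ on $R_{L(u)L(v)}$ and to $\infty$ elsewhere. (b) There is a majority operation $f$ on $\{1,\dots,2k+1\}$, that is, $f(b,a,a)=f(a,b,a)=f(a,a,b)=a$ for all $a,b$, that is a polymorphism of all relations $R_{UW}$ with $U,W\in\mathcal S_k$. (c) For every finite graph $G$ and all lists $L:V(G)\to\mathcal S_k$, the optimum of the Sherali–Adams linear programming relaxation of $I_{G,L}$ at level $(2,3)$ equals the optimum of $I_{G,L}$ (both are $\infty$ if infeasible), and it is $0$ if and only if there is a homomorphism $g$ from $G$ to $C_{2k+1}$ with $g(v)\in L(v)$ for all $v\in V(G)$. Here the level-$(2,3)$ relaxation has, for every term of the instance and for every zero term added on a tuple of one, two or three variables, a probability distribution on the assignments of the variables of that term; the distribution gives weight $0$ to assignments of infinite cost, and whenever the variable set $Y$ of one term has at most two elements and is contained in that of another, the distribution of the second has the distribution of the first as its marginal on $Y$. The objective is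 to minimize the sum of the expected costs of the terms. (d) If $G$ has $n$ vertices and there is a homomorphism from $G$ to $C_{2k+1}$, and if the lists $L(v)$ are drawn independently from $\mathcal S_k$, with probability $\frac{2k-1}{2k+1}$ for $S_k$ and $\frac1{2k+1}$ for each of $S_k^A$ and $S_k^B$, then with probability at least $\alpha_k^{-n}$ the level-$(2,3)$ relaxation of $I_{G,L}$ has optimum $0$. -/

import Mathlib

open scoped ENNReal

noncomputable section

/-! ### A randomized random-access machine with logarithmic cost

Programs are structured (sequencing, branching, while loops).  The memory consists of arrays
named by natural numbers; every array is an infinite sequence of cells holding natural numbers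
of arbitrary size, and all but finitely many cells hold `0`.  A program mentions only finitely
many arrays.  Every operation is charged the bit lengths of the numbers it handles, and
randomness comes from independent fair coin flips. -/

namespace RAM

/-- The contents of the memory: the number in cell `i` of array `a` is `σ (a, i)`. -/
abbrev Store := ℕ × ℕ →₀ ℕ

/-- Number of bits in use: each nonzero cell counts for its address, its content and one. -/
def Store.space (σ : Store) : ℕ :=
  σ.sum fun c v => 1 + Nat.size c.2 + Nat.size v

/-- Arithmetic expressions; `read a i` is the content of cell `i` of array `a`,
subtraction is truncated and division is integer division. -/
inductive Expr where
  | const (c : ℕ)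
  | read (a : ℕ) (i : Expr)
  | add (e₁ e₂ : Expr)
  | sub (e₁ e₂ : Expr)
  | mul (e₁ e₂ : Expr)
  | div (e₁ e₂ : Expr)

/-- The value of an expression. -/
def Expr.eval (σ : Store) : Expr → ℕ
  | .const c => c
  | .read a i => σ (a, i.eval σ)
  | .add e₁ e₂ => e₁.eval σ + e₂.eval σ
  | .sub e₁ e₂ => e₁.eval σ - e₂.eval σ
  | .mul e₁ e₂ => e₁.eval σ * e₂.eval σ
  | .div e₁ e₂ => e₁.eval σ / e₂.eval σ

/-- The cost of evaluating an expression: one plus the bit length of the value, summed over all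
subexpressions. -/
def Expr.cost (σ : Store) : Expr → ℕ
  | .const c => 1 + Nat.size c
  | .read a i => i.cost σ + (1 + Nat.size (σ (a, i.eval σ)))
  | .add e₁ e₂ => e₁.cost σ + e₂.cost σ + (1 + Nat.size (e₁.eval σ + e₂.eval σ))
  | .sub e₁ e₂ => e₁.cost σ + e₂.cost σ + (1 + Nat.size (e₁.eval σ - e₂.eval σ))
  | .mul e₁ e₂ => e₁.cost σ + e₂.cost σ + (1 + Nat.size (e₁.eval σ * e₂.eval σ))
  | .div e₁ e₂ => e₁.cost σ + e₂.cost σ + (1 + Nat.size (e₁.eval σ / e₂.eval σ))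

/-- Programs. `write a i e` stores the value of `e` in cell `i` of array `a`; `flip a` stores the
outcome of a fair coin flip (`0` or `1`) in cell `0` of array `a`; the tests in `cond` and `loop`
(a while loop) succeed when the expression is nonzero. -/
inductive Prog where
  | skip
  | write (a : ℕ) (i e : Expr)
  | flip (a : ℕ)
  | seq (p q : Prog)
  | cond (e : Expr) (p q : Prog)
  | loop (e : Expr) (p : Prog)

/-- `Exec S p σ w t τ`: started in memory `σ`, the program `p` halts in memory `τ` after time `t`,
the outcomes of its coin flips being exactly the bits of `w` in this order, and at every step the
memory in use together with the scratch space for that step is at most `S`. -/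
inductive Exec (S : ℕ) : Prog → Store → List Bool → ℕ → Store → Prop
  | skip (σ : Store) (hS : σ.space + 1 ≤ S) : Exec S .skip σ [] 1 σ
  | write (a : ℕ) (i e : Expr) (σ : Store) (hS : σ.space + (i.cost σ + e.cost σ + 1) ≤ S) :
      Exec S (.write a i e) σ [] (i.cost σ + e.cost σ + 1)
        (σ.update (a, i.eval σ) (e.eval σ))
  | flip (a : ℕ) (b : Bool) (σ : Store) (hS : σ.space + 2 ≤ S) :
      Exec S (.flip a) σ [b] 2 (σ.update (a, 0) b.toNat)
  | seq (p q : Prog) (σ σ' τ : Store) (w w' : List Bool) (t t' : ℕ)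
      (hp : Exec S p σ w t σ') (hq : Exec S q σ' w' t' τ) :
      Exec S (.seq p q) σ (w ++ w') (t + t') τ
  | cond_true (e : Expr) (p q : Prog) (σ τ : Store) (w : List Bool) (t : ℕ)
      (he : e.eval σ ≠ 0) (hS : σ.space + (e.cost σ + 1) ≤ S) (hp : Exec S p σ w t τ) :
      Exec S (.cond e p q) σ w (e.cost σ + 1 + t) τ
  | cond_false (e : Expr) (p q : Prog) (σ τ : Store) (w : List Bool) (t : ℕ)
      (he : e.eval σ = 0) (hS : σ.space + (e.cost σ + 1) ≤ S) (hq : Exec S q σ w t τ) :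
      Exec S (.cond e p q) σ w (e.cost σ + 1 + t) τ
  | loop_done (e : Expr) (p : Prog) (σ : Store)
      (he : e.eval σ = 0) (hS : σ.space + (e.cost σ + 1) ≤ S) :
      Exec S (.loop e p) σ [] (e.cost σ + 1) σ
  | loop_step (e : Expr) (p : Prog) (σ σ' τ : Store) (w w' : List Bool) (t t' : ℕ)
      (he : e.eval σ ≠ 0) (hS : σ.space + (e.cost σ + 1) ≤ S)
      (hp : Exec S p σ w t σ') (hl : Exec S (.loop e p) σ' w' t' τ) :
      Exec S (.loop e p) σ (w ++ w') (e.cost σ + 1 + t + t') τ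

/-- On every infinite sequence of coin flips, `p` started in `σ` halts in time at most `T`,
using space at most `S`. -/
def HaltsWithin (p : Prog) (σ : Store) (T : ℝ) (S : ℕ) : Prop :=
  ∀ ω : ℕ → Bool, ∃ (m t : ℕ) (τ : Store),
    Exec S p σ ((List.range m).map ω) t τ ∧ (t : ℝ) ≤ T

/-- With coin flips `w`, the program halts and answers YES (cell `0` of array `2` holds `1`);
any other final content of this cell is the answer NO. -/
def Accepts (p : Prog) (σ : Store) (w : List Bool) : Prop :=
  ∃ (S t : ℕ) (τ : Store), Exec S p σ w t τ ∧ τ (2, 0) = 1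

/-- The probability that the program answers YES. A halting run with `m` coin flips has
probability `2 ^ (-m)`. -/
def acceptProb (p : Prog) (σ : Store) : ℝ≥0∞ :=
  ∑' w : {w : List Bool // Accepts p σ w}, (2⁻¹ : ℝ≥0∞) ^ w.1.length

open Classical in
/-- The initial memory on input graph `G`: cell `0` of array `0` holds the number `n` of vertices
and array `1` holds the adjacency matrix, row by row. -/
def graphInput {n : ℕ} (G : SimpleGraph (Fin n)) : Store :=
  Finsupp.single (0, 0) n +
    ∑ i : Fin n, ∑ j : Fin n,
      if G.Adj i j then Finsupp.single (1, (i : ℕ) * n + (j : ℕ)) 1 else 0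

end RAM

/-! ### Valued constraint satisfaction and its Sherali–Adams relaxations -/

/-- A term `φ(x₁, …, x_r)` of an objective function: a cost function with values in `ℚ ∪ {∞}`
applied to a tuple of variables. -/
structure CostTerm (X D : Type) where
  arity : ℕ
  scope : Fin arity → X
  cost : (Fin arity → D) → WithTop ℚ

/-- A VCSP instance with variable set `X` and domain `D`: a finite sum of terms. -/
structure VCSP (X D : Type) where
  ι : Type
  fintype_ι : Fintype ι
  term : ι → CostTerm X D

attribute [instance] VCSP.fintype_ι

open Classical in
/-- The inclusion of `ℚ ∪ {∞}` in the extended reals. -/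
def costToEReal (c : WithTop ℚ) : EReal :=
  if c = ⊤ then ⊤ else (((c.untopD 0 : ℚ) : ℝ) : EReal)

namespace CostTerm

variable {X D : Type}

open Classical in
/-- The set of variables that occur in the scope of a term. -/
def vars (T : CostTerm X D) : Finset X := Finset.univ.image T.scope

theorem scope_mem_vars (T : CostTerm X D) (r : Fin T.arity) : T.scope r ∈ T.vars := by
  classical
  exact Finset.mem_image_of_mem _ (Finset.mem_univ r)

/-- The cost that the term gives to an assignment `t` of its variables. -/
def costAt (T : CostTerm X D) (t : {x // x ∈ T.vars} → D) : WithTop ℚ :=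
  T.cost fun r => t ⟨T.scope r, T.scope_mem_vars r⟩

end CostTerm

namespace VCSP

variable {X D : Type}

/-- The cost of an assignment. -/
def cost (I : VCSP X D) (α : X → D) : WithTop ℚ :=
  ∑ i, (I.term i).cost fun r => α ((I.term i).scope r)

/-- The minimum cost of an assignment (`⊤` if there is no feasible one). -/
def opt (I : VCSP X D) : EReal := ⨅ α : X → D, costToEReal (I.cost α)

/-- The instance with all zero terms `φ₀(𝐱)` added, `𝐱` being a tuple of variables of length
between `1` and `l`. -/
def pad [Fintype X] (l : ℕ) (I : VCSP X D) : VCSP X D where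
  ι := I.ι ⊕ (Σ j : Fin l, (Fin ((j : ℕ) + 1) → X))
  fintype_ι := inferInstance
  term := Sum.elim I.term fun x => { arity := (x.1 : ℕ) + 1, scope := x.2, cost := fun _ => 0 }

/-- Values `λ_i(t)` for the variables of the linear program: one for every term `i` and every
assignment `t` of the variables of that term. -/
abbrev LPPoint (J : VCSP X D) : Type :=
  (i : J.ι) → ({x // x ∈ (J.term i).vars} → D) → ℝ

open Classical in
/-- The constraints of the Sherali–Adams program at level `k`, for an instance `J` to which the
zero terms have already been added. -/
structure SAFeasible [Fintype D] (k : ℕ) (J : VCSP X D) (lam : J.LPPoint) : Prop where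
  sum_eq_one : ∀ i, ∑ t, lam i t = 1
  marginal : ∀ (i j : J.ι) (h : (J.term j).vars ⊆ (J.term i).vars),
    (J.term j).vars.card ≤ k → ∀ s : {x // x ∈ (J.term j).vars} → D,
      ∑ t with (fun x : {x // x ∈ (J.term j).vars} => t ⟨x.1, h x.2⟩) = s, lam i t = lam j s
  eq_zero : ∀ i t, (J.term i).costAt t = ⊤ → lam i t = 0
  nonneg : ∀ i t, 0 ≤ lam i t

open Classical in
/-- The objective of the Sherali–Adams program; assignments of infinite cost are left out of the
sum. -/
def saObjective [Fintype D] (J : VCSP X D) (lam : J.LPPoint) : ℝ :=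
  ∑ i, ∑ t, if (J.term i).costAt t = ⊤ then 0
    else lam i t * ((((J.term i).costAt t).untopD 0 : ℚ) : ℝ)

/-- The optimum of the Sherali–Adams program at level `(k, l)` (`⊤` if it is infeasible). -/
def saOpt [Fintype X] [Fintype D] (k l : ℕ) (I : VCSP X D) : EReal :=
  ⨅ (lam : (I.pad l).LPPoint) (_ : SAFeasible k (I.pad l) lam),
    ((saObjective (I.pad l) lam : ℝ) : EReal)

end VCSP

/-- Majority operations. -/
def IsMajority {D : Type} (f : D → D → D → D) : Prop :=
  ∀ a b, f b a a = a ∧ f a b a = a ∧ f a a b = a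

/-- Ternary polymorphisms of a relation of arity `r`. -/
def IsPolymorphism {D : Type} {r : ℕ} (f : D → D → D → D) (R : Set (Fin r → D)) : Prop :=
  ∀ t₁ ∈ R, ∀ t₂ ∈ R, ∀ t₃ ∈ R, (fun i => f (t₁ i) (t₂ i) (t₃ i)) ∈ R

/-! ### Odd cycles -/

namespace OddCycle

/-- The cycle `C_{2k+1}`; the element `i` of `Fin (2 * k + 1)` is the vertex with number `i + 1`
along the cycle. -/
abbrev cycle (k : ℕ) : SimpleGraph (Fin (2 * k + 1)) := SimpleGraph.cycleGraph (2 * k + 1)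

/-- The base of the exponential running time. -/
def alpha (k : ℕ) : ℝ :=
  ((2 * k + 1 : ℝ) / 2) ^ ((1 : ℝ) / (2 * k + 1)) *
    ((2 * k + 1 : ℝ) / (2 * k)) ^ ((2 * k : ℝ) / (2 * k + 1))

/-- The three sets: all vertices other than the vertex number `1`; the vertices with odd number;
the vertices with even number together with the vertex number `1`. -/
def listSet (k : ℕ) : Fin 3 → Set (Fin (2 * k + 1)) :=
  ![{i | 1 < (i : ℕ) + 1},
    {i | Odd ((i : ℕ) + 1)},
    {i | Even ((i : ℕ) + 1) ∨ (i : ℕ) + 1 = 1}]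

/-- The probabilities with which the three sets are drawn. -/
def listProb (k : ℕ) : Fin 3 → ℝ :=
  ![(2 * k - 1 : ℝ) / (2 * k + 1), 1 / (2 * k + 1), 1 / (2 * k + 1)]

/-- The relation of all pairs `(u, v)` with `u ∈ U`, `v ∈ W` and `uv` an edge of the cycle. -/
def edgeRel (k : ℕ) (U W : Set (Fin (2 * k + 1))) : Set (Fin 2 → Fin (2 * k + 1)) :=
  {t | t 0 ∈ U ∧ t 1 ∈ W ∧ (cycle k).Adj (t 0) (t 1)}

open Classical in
/-- The list homomorphism problem with lists `L` as a VCSP instance: one variable for every vertex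
of `G` and, for every edge `uv`, a term with values `0` and `∞` that allows exactly the pairs in
`edgeRel k (L u) (L v)`. -/
def listHomVCSP (k : ℕ) {n : ℕ} (G : SimpleGraph (Fin n))
    (L : Fin n → Set (Fin (2 * k + 1))) : VCSP (Fin n) (Fin (2 * k + 1)) where
  ι := {e : Fin n × Fin n // e.1 < e.2 ∧ G.Adj e.1 e.2}
  fintype_ι := inferInstance
  term e :=
    { arity := 2
      scope := ![e.1.1, e.1.2]
      cost := fun t => if t ∈ edgeRel k (L e.1.1) (L e.1.2) then 0 else ⊤ }

open Classical in
/-- The probability that the Sherali–Adams program at level `(2, 3)` has optimum `0` when the list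
of every vertex of `G` is drawn independently from the three sets, according to `listProb`. -/
def sampleSuccess (k : ℕ) {n : ℕ} (G : SimpleGraph (Fin n)) : ℝ :=
  ∑ c : Fin n → Fin 3,
    if (listHomVCSP k G fun v => listSet k (c v)).saOpt 2 3 = 0
    then ∏ v, listProb k (c v) else 0

end OddCycle

end

open scoped ENNReal

noncomputable section

/-! ### Majority polymorphisms and path consistency -/

/-- A path-consistent system of binary relations on the variables `V`. -/
structure PathConsistent {V D : Type} (R : V → V → D → D → Prop) : Prop where
  diag : ∀ u a b, R u u a b → a = b
  extend : ∀ u v a b, R u v a b → ∀ w, ∃ c, R u w a c ∧ R v w b c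

/-- The closure of a system of binary relations under a ternary operation. -/
inductive TernaryClosure {V D : Type} (f : D → D → D → D) (R : V → V → D → D → Prop) (u v : V) :
    D → D → Prop
  | base {a b : D} (h : R u v a b) : TernaryClosure f R u v a b
  | op {a₁ a₂ a₃ b₁ b₂ b₃ : D} (h₁ : TernaryClosure f R u v a₁ b₁)
      (h₂ : TernaryClosure f R u v a₂ b₂) (h₃ : TernaryClosure f R u v a₃ b₃) :
      TernaryClosure f R u v (f a₁ a₂ a₃) (f b₁ b₂ b₃)

namespace PathConsistent

variable {V D : Type} {R : V → V → D → D → Prop}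

theorem symm (hR : PathConsistent R) {u v : V} {a b : D} (h : R u v a b) : R v u b a := by
  obtain ⟨c, h₁, h₂⟩ := hR.extend u v a b h u
  obtain rfl := hR.diag _ _ _ h₁
  exact h₂

theorem self_right (hR : PathConsistent R) {u v : V} {a b : D} (h : R u v a b) : R v v b b := by
  obtain ⟨c, -, h₂⟩ := hR.extend u v a b h v
  obtain rfl := hR.diag _ _ _ h₂
  exact h₂

theorem ternaryClosure (hR : PathConsistent R) (f : D → D → D → D) :
    PathConsistent (TernaryClosure f R) where
  diag u a b h := by
    induction h with
    | base h => exact hR.diag _ _ _ h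
    | op _ _ _ i₁ i₂ i₃ => rw [i₁, i₂, i₃]
  extend u v a b h w := by
    induction h with
    | base h =>
      obtain ⟨c, h₁, h₂⟩ := hR.extend _ _ _ _ h w
      exact ⟨c, .base h₁, .base h₂⟩
    | op _ _ _ i₁ i₂ i₃ =>
      obtain ⟨c₁, h₁, e₁⟩ := i₁
      obtain ⟨c₂, h₂, e₂⟩ := i₂
      obtain ⟨c₃, h₃, e₃⟩ := i₃
      exact ⟨f c₁ c₂ c₃, .op h₁ h₂ h₃, .op e₁ e₂ e₃⟩

/-- If the system is closed under a majority operation, a partial solution extends to any further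
variable. -/
theorem exists_extension (hR : PathConsistent R) {f : D → D → D → D} (hf : IsMajority f)
    (hcl : ∀ u v a₁ a₂ a₃ b₁ b₂ b₃, R u v a₁ b₁ → R u v a₂ b₂ → R u v a₃ b₃ →
      R u v (f a₁ a₂ a₃) (f b₁ b₂ b₃))
    (w : V) (hw : ∃ c, R w w c c) (T : Finset V) (h : V → D)
    (hT : ∀ u ∈ T, ∀ v ∈ T, R u v (h u) (h v)) :
    ∃ c, R w w c c ∧ ∀ u ∈ T, R u w (h u) c := by
  classical
  induction T using Finset.strongInduction with
  | H T ih =>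
    by_cases h2 : 2 < T.card
    · obtain ⟨x, y, z, hx, hy, hz, hxy, hxz, hyz⟩ := Finset.two_lt_card_iff.1 h2
      have key : ∀ s ∈ T, ∃ c, R w w c c ∧ (∀ u ∈ T, u ≠ s → R u w (h u) c) := by
        intro s hs
        obtain ⟨c, hc, hc'⟩ := ih (T.erase s) (Finset.erase_ssubset hs)
          (fun u hu v hv => hT u (Finset.mem_of_mem_erase hu) v (Finset.mem_of_mem_erase hv))
        exact ⟨c, hc, fun u hu hus => hc' u (Finset.mem_erase.2 ⟨hus, hu⟩)⟩
      obtain ⟨c₁, h₁, h₁'⟩ := key x hx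
      obtain ⟨c₂, h₂, h₂'⟩ := key y hy
      obtain ⟨c₃, h₃, h₃'⟩ := key z hz
      refine ⟨f c₁ c₂ c₃, hcl _ _ _ _ _ _ _ _ h₁ h₂ h₃, fun u hu => ?_⟩
      have back : ∀ c, R w w c c → ∃ e, R u w e c := fun c hc => by
        obtain ⟨e, he, -⟩ := hR.extend w w c c hc u
        exact ⟨e, hR.symm he⟩
      by_cases hux : u = x
      · obtain ⟨e, he⟩ := back c₁ h₁
        have := hcl _ _ _ _ _ _ _ _ he (h₂' u hu (hux ▸ hxy)) (h₃' u hu (hux ▸ hxz))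
        rwa [(hf (h u) e).1] at this
      by_cases huy : u = y
      · obtain ⟨e, he⟩ := back c₂ h₂
        have := hcl _ _ _ _ _ _ _ _ (h₁' u hu hux) he (h₃' u hu (huy ▸ hyz))
        rwa [(hf (h u) e).2.1] at this
      by_cases huz : u = z
      · obtain ⟨e, he⟩ := back c₃ h₃
        have := hcl _ _ _ _ _ _ _ _ (h₁' u hu hux) (h₂' u hu huy) he
        rwa [(hf (h u) e).2.2] at this
      have := hcl _ _ _ _ _ _ _ _ (h₁' u hu hux) (h₂' u hu huy) (h₃' u hu huz)
      rwa [(hf (h u) (h u)).1] at this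
    · rcases T.eq_empty_or_nonempty with rfl | ⟨u, hu⟩
      · obtain ⟨c, hc⟩ := hw
        exact ⟨c, hc, by simp⟩
      · obtain ⟨v, hv, huv⟩ : ∃ v ∈ T, ∀ x ∈ T, x = u ∨ x = v := by
          by_contra! hcon
          obtain ⟨x, hx, hxu, -⟩ := hcon u hu
          obtain ⟨y, hy, hyu, hyx⟩ := hcon x hx
          exact h2 (Finset.two_lt_card_iff.2 ⟨u, x, y, hu, hx, hy, hxu.symm, hyu.symm, hyx.symm⟩)
        obtain ⟨c, h₁, h₂⟩ := hR.extend u v _ _ (hT u hu v hv) w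
        refine ⟨c, hR.self_right h₁, fun x hx => ?_⟩
        rcases huv x hx with rfl | rfl
        · exact h₁
        · exact h₂

/-- Path consistency solves constraint networks with a majority polymorphism. -/
theorem exists_solution [Finite V] (hR : PathConsistent R) (hne : ∀ v, ∃ a, R v v a a)
    {f : D → D → D → D} (hf : IsMajority f) {C : V → V → D → D → Prop}
    (hRC : ∀ u v a b, R u v a b → C u v a b)
    (hC : ∀ u v a₁ a₂ a₃ b₁ b₂ b₃, C u v a₁ b₁ → C u v a₂ b₂ → C u v a₃ b₃ →
      C u v (f a₁ a₂ a₃) (f b₁ b₂ b₃)) :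
    ∃ g : V → D, ∀ u v, C u v (g u) (g v) := by
  classical
  have := Fintype.ofFinite V
  have hR' := hR.ternaryClosure f
  have hne' : ∀ v, ∃ a, TernaryClosure f R v v a a := fun v => (hne v).imp fun a h => .base h
  have main : ∀ T : Finset V, ∃ g : V → D, ∀ u ∈ T, ∀ v ∈ T, TernaryClosure f R u v (g u) (g v) := by
    intro T
    induction T using Finset.induction_on with
    | empty => exact ⟨fun v => (hne v).choose, by simp⟩
    | insert w T hw ih =>
      obtain ⟨g, hg⟩ := ih
      obtain ⟨c, hc, hc'⟩ := hR'.exists_extension hf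
        (fun _ _ _ _ _ _ _ _ h₁ h₂ h₃ => .op h₁ h₂ h₃) w (hne' w) T g hg
      have hgT : ∀ u ∈ T, Function.update g w c u = g u := fun u hu =>
        Function.update_of_ne (fun h : u = w => hw (h ▸ hu)) _ _
      refine ⟨Function.update g w c, fun u hu v hv => ?_⟩
      rcases Finset.mem_insert.1 hu with rfl | hu' <;> rcases Finset.mem_insert.1 hv with rfl | hv'
      · simpa using hc
      · rw [hgT v hv', Function.update_self]
        exact hR'.symm (hc' v hv')
      · rw [hgT u hu', Function.update_self]
        exact hc' u hu'
      · rw [hgT u hu', hgT v hv']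
        exact hg u hu' v hv'
  obtain ⟨g, hg⟩ := main Finset.univ
  refine ⟨g, fun u v => ?_⟩
  have h := hg u (Finset.mem_univ u) v (Finset.mem_univ v)
  generalize g u = a at h
  generalize g v = b at h
  induction h with
  | base h => exact hRC _ _ _ _ h
  | op _ _ _ i₁ i₂ i₃ => exact hC _ _ _ _ _ _ _ _ i₁ i₂ i₃

end PathConsistent

/-! ### The majority operation on the odd cycle -/

/-- The median of three natural numbers. -/
def natMedian (x y z : ℕ) : ℕ := max (min x y) (min (max x y) z)

theorem natMedian_mem (x y z : ℕ) :
    natMedian x y z = x ∨ natMedian x y z = y ∨ natMedian x y z = z := by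
  unfold natMedian; omega

theorem natMedian_le_succ {x y z x' y' z' : ℕ} (hx : x ≤ x' + 1) (hy : y ≤ y' + 1)
    (hz : z ≤ z' + 1) : natMedian x y z ≤ natMedian x' y' z' + 1 := by
  unfold natMedian; omega

namespace OddCycle

/-- The majority parity of three numbers. -/
def majParity (x y z : ℕ) : ℕ := (x % 2 + y % 2 + z % 2) / 2

/-- Reflect the numbers of the wrong parity. -/
def toParity (k p x : ℕ) : ℕ := if x % 2 = p then x else 2 * k + 1 - x

/-- The numbers of minority parity are reflected, and the median is taken. -/
def majNat (k x y z : ℕ) : ℕ :=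
  natMedian (toParity k (majParity x y z) x) (toParity k (majParity x y z) y)
    (toParity k (majParity x y z) z)

theorem majNat_lt {k x y z : ℕ} (hx : x ≤ 2 * k) (hy : y ≤ 2 * k) (hz : z ≤ 2 * k) :
    majNat k x y z < 2 * k + 1 := by
  unfold majNat natMedian toParity majParity
  split_ifs <;> omega

theorem toParity_self (k x : ℕ) : toParity k (x % 2) x = x := if_pos rfl

theorem majNat_left (k x y : ℕ) : majNat k y x x = x := by
  have : majParity y x x = x % 2 := by unfold majParity; omega
  simp only [majNat, this, toParity_self]
  unfold natMedian; omega

theorem majNat_mid (k x y : ℕ) : majNat k x y x = x := by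
  have : majParity x y x = x % 2 := by unfold majParity; omega
  simp only [majNat, this, toParity_self]
  unfold natMedian; omega

theorem majNat_right (k x y : ℕ) : majNat k x x y = x := by
  have : majParity x x y = x % 2 := by unfold majParity; omega
  simp only [majNat, this, toParity_self]
  unfold natMedian; omega

/-- Adjacency of the cycle in terms of numbers. -/
def NatAdj (k x y : ℕ) : Prop :=
  x + 1 = y ∨ y + 1 = x ∨ (x = 0 ∧ y = 2 * k) ∨ (x = 2 * k ∧ y = 0)

theorem NatAdj.symm {k x y : ℕ} (h : NatAdj k x y) : NatAdj k y x := by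
  unfold NatAdj at *; omega

theorem cycle_adj_iff {k : ℕ} (hk : 1 ≤ k) (a b : Fin (2 * k + 1)) :
    (cycle k).Adj a b ↔ NatAdj k a b := by
  have key : ∀ a b : Fin (2 * k + 1), ((a - b : Fin (2 * k + 1)) : ℕ) = 1 ↔
      ((b : ℕ) + 1 = a ∨ ((b : ℕ) = 2 * k ∧ (a : ℕ) = 0)) := by
    intro a b
    have ha := a.2
    have hb := b.2
    rw [Fin.val_sub]
    rcases le_or_gt (b : ℕ) a with h | h
    · rw [show 2 * k + 1 - (b : ℕ) + a = (a - b) + (2 * k + 1) by omega, Nat.add_mod_right,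
        Nat.mod_eq_of_lt (by omega)]
      omega
    · rw [Nat.mod_eq_of_lt (by omega)]
      omega
  rw [SimpleGraph.cycleGraph_adj', key, key]
  unfold NatAdj
  omega

/-- The lists in terms of numbers. -/
def natList (c : Fin 3) (x : ℕ) : Prop :=
  match c with
  | 0 => x ≠ 0
  | 1 => x % 2 = 0
  | 2 => x % 2 = 1 ∨ x = 0

theorem mem_listSet_iff {k : ℕ} (c : Fin 3) (a : Fin (2 * k + 1)) :
    a ∈ listSet k c ↔ natList c a := by
  fin_cases c
  · change 1 < (a : ℕ) + 1 ↔ (a : ℕ) ≠ 0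
    omega
  · change Odd ((a : ℕ) + 1) ↔ (a : ℕ) % 2 = 0
    rw [Nat.odd_iff]; omega
  · change (Even ((a : ℕ) + 1) ∨ (a : ℕ) + 1 = 1) ↔ ((a : ℕ) % 2 = 1 ∨ (a : ℕ) = 0)
    rw [Nat.even_iff]; omega

theorem toParity_mod {k p x : ℕ} (hp : p < 2) (hx : x ≤ 2 * k) : toParity k p x % 2 = p := by
  unfold toParity
  split_ifs <;> omega

/-- Two triples at coordinatewise distance one after reflection. -/
theorem majNat_adj_of_dist {k x₁ x₂ x₃ y₁ y₂ y₃ : ℕ} (p q : ℕ) (hpq : p + q = 1)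
    (hx : majParity x₁ x₂ x₃ = p) (hy : majParity y₁ y₂ y₃ = q)
    (bx₁ : x₁ ≤ 2 * k) (bx₂ : x₂ ≤ 2 * k) (bx₃ : x₃ ≤ 2 * k)
    (by₁ : y₁ ≤ 2 * k) (by₂ : y₂ ≤ 2 * k) (by₃ : y₃ ≤ 2 * k)
    (h₁ : toParity k p x₁ ≤ toParity k q y₁ + 1 ∧ toParity k q y₁ ≤ toParity k p x₁ + 1)
    (h₂ : toParity k p x₂ ≤ toParity k q y₂ + 1 ∧ toParity k q y₂ ≤ toParity k p x₂ + 1)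
    (h₃ : toParity k p x₃ ≤ toParity k q y₃ + 1 ∧ toParity k q y₃ ≤ toParity k p x₃ + 1) :
    NatAdj k (majNat k x₁ x₂ x₃) (majNat k y₁ y₂ y₃) := by
  unfold majNat
  rw [hx, hy]
  have e₁ := natMedian_le_succ h₁.1 h₂.1 h₃.1
  have e₂ := natMedian_le_succ h₁.2 h₂.2 h₃.2
  have px : natMedian (toParity k p x₁) (toParity k p x₂) (toParity k p x₃) % 2 = p := by
    rcases natMedian_mem (toParity k p x₁) (toParity k p x₂) (toParity k p x₃) with h | h | h <;>
      rw [h] <;> exact toParity_mod (by omega) ‹_›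
  have py : natMedian (toParity k q y₁) (toParity k q y₂) (toParity k q y₃) % 2 = q := by
    rcases natMedian_mem (toParity k q y₁) (toParity k q y₂) (toParity k q y₃) with h | h | h <;>
      rw [h] <;> exact toParity_mod (by omega) ‹_›
  unfold NatAdj
  omega

/-- Edges between two lists. -/
def NatEdge (k : ℕ) (c c' : Fin 3) (x y : ℕ) : Prop :=
  x ≤ 2 * k ∧ y ≤ 2 * k ∧ natList c x ∧ natList c' y ∧ NatAdj k x y

theorem NatEdge.symm {k : ℕ} {c c' : Fin 3} {x y : ℕ} (h : NatEdge k c c' x y) :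
    NatEdge k c' c y x :=
  ⟨h.2.1, h.1, h.2.2.2.1, h.2.2.1, h.2.2.2.2.symm⟩

theorem majNat_eq_of_two {k x y z a : ℕ}
    (h : (x = a ∧ y = a) ∨ (x = a ∧ z = a) ∨ (y = a ∧ z = a)) : majNat k x y z = a := by
  rcases h with ⟨rfl, rfl⟩ | ⟨rfl, rfl⟩ | ⟨rfl, rfl⟩
  · exact majNat_right ..
  · exact majNat_mid ..
  · exact majNat_left ..

section lists

variable {k x₁ x₂ x₃ y₁ y₂ y₃ : ℕ}

theorem toParity_dist {p q x y : ℕ} (hpq : p + q = 1) (hx : x ≤ 2 * k) (hy : y ≤ 2 * k)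
    (h : x + 1 = y ∨ y + 1 = x) :
    toParity k p x ≤ toParity k q y + 1 ∧ toParity k q y ≤ toParity k p x + 1 := by
  unfold toParity; split_ifs <;> omega

theorem majNat_adj_SS (h₁ : NatEdge k 0 0 x₁ y₁) (h₂ : NatEdge k 0 0 x₂ y₂)
    (h₃ : NatEdge k 0 0 x₃ y₃) : NatAdj k (majNat k x₁ x₂ x₃) (majNat k y₁ y₂ y₃) := by
  have key : ∀ {x y}, NatEdge k 0 0 x y → (x + 1 = y ∨ y + 1 = x) ∧ x % 2 + y % 2 = 1 := by
    intro x y h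
    simp only [NatEdge, natList, NatAdj] at h
    omega
  have hpq : majParity x₁ x₂ x₃ + majParity y₁ y₂ y₃ = 1 := by
    have e₁ := (key h₁).2
    have e₂ := (key h₂).2
    have e₃ := (key h₃).2
    unfold majParity; omega
  exact majNat_adj_of_dist _ _ hpq rfl rfl h₁.1 h₂.1 h₃.1 h₁.2.1 h₂.2.1 h₃.2.1
    (toParity_dist hpq h₁.1 h₁.2.1 (key h₁).1) (toParity_dist hpq h₂.1 h₂.2.1 (key h₂).1)
    (toParity_dist hpq h₃.1 h₃.2.1 (key h₃).1)

theorem majNat_adj_AA (hk : 1 ≤ k) (h₁ : NatEdge k 1 1 x₁ y₁) (h₂ : NatEdge k 1 1 x₂ y₂)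
    (h₃ : NatEdge k 1 1 x₃ y₃) : NatAdj k (majNat k x₁ x₂ x₃) (majNat k y₁ y₂ y₃) := by
  have key : ∀ {x y}, NatEdge k 1 1 x y → (x = 0 ∧ y = 2 * k) ∨ (x = 2 * k ∧ y = 0) := by
    intro x y h
    simp only [NatEdge, natList, NatAdj] at h
    omega
  by_cases h : (x₁ = 0 ∧ x₂ = 0) ∨ (x₁ = 0 ∧ x₃ = 0) ∨ (x₂ = 0 ∧ x₃ = 0)
  · rw [majNat_eq_of_two h, majNat_eq_of_two (a := 2 * k)
      (by have := key h₁; have := key h₂; have := key h₃; omega)]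
    unfold NatAdj; omega
  · rw [majNat_eq_of_two (x := x₁) (a := 2 * k)
      (by have := key h₁; have := key h₂; have := key h₃; omega), majNat_eq_of_two (a := 0)
      (by have := key h₁; have := key h₂; have := key h₃; omega)]
    unfold NatAdj; omega

theorem majNat_adj_BB (hk : 1 ≤ k) (h₁ : NatEdge k 2 2 x₁ y₁) (h₂ : NatEdge k 2 2 x₂ y₂)
    (h₃ : NatEdge k 2 2 x₃ y₃) : NatAdj k (majNat k x₁ x₂ x₃) (majNat k y₁ y₂ y₃) := by
  have key : ∀ {x y}, NatEdge k 2 2 x y → (x = 0 ∧ y = 1) ∨ (x = 1 ∧ y = 0) := by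
    intro x y h
    simp only [NatEdge, natList, NatAdj] at h
    omega
  by_cases h : (x₁ = 0 ∧ x₂ = 0) ∨ (x₁ = 0 ∧ x₃ = 0) ∨ (x₂ = 0 ∧ x₃ = 0)
  · rw [majNat_eq_of_two h, majNat_eq_of_two (a := 1)
      (by have := key h₁; have := key h₂; have := key h₃; omega)]
    unfold NatAdj; omega
  · rw [majNat_eq_of_two (x := x₁) (a := 1)
      (by have := key h₁; have := key h₂; have := key h₃; omega), majNat_eq_of_two (a := 0)
      (by have := key h₁; have := key h₂; have := key h₃; omega)]
    unfold NatAdj; omega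

theorem majNat_adj_AB (hk : 1 ≤ k) (h₁ : NatEdge k 1 2 x₁ y₁) (h₂ : NatEdge k 1 2 x₂ y₂)
    (h₃ : NatEdge k 1 2 x₃ y₃) : NatAdj k (majNat k x₁ x₂ x₃) (majNat k y₁ y₂ y₃) := by
  have key : ∀ {x y}, NatEdge k 1 2 x y → x % 2 = 0 ∧ x ≤ 2 * k ∧ y ≤ 2 * k ∧
      ((x = 2 * k ∧ y = 0) ∨ (y % 2 = 1 ∧ (x + 1 = y ∨ y + 1 = x))) := by
    intro x y h
    simp only [NatEdge, natList, NatAdj] at h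
    omega
  have dist : ∀ {x y}, NatEdge k 1 2 x y →
      toParity k 0 x ≤ toParity k 1 y + 1 ∧ toParity k 1 y ≤ toParity k 0 x + 1 := by
    intro x y h
    have := key h
    unfold toParity; split_ifs <;> omega
  have d₁ := dist h₁
  have d₂ := dist h₂
  have d₃ := dist h₃
  replace h₁ := key h₁
  replace h₂ := key h₂
  replace h₃ := key h₃
  by_cases h : (y₁ = 0 ∧ y₂ = 0) ∨ (y₁ = 0 ∧ y₃ = 0) ∨ (y₂ = 0 ∧ y₃ = 0)
  · rw [majNat_eq_of_two h, majNat_eq_of_two (a := 2 * k) (by omega)]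
    unfold NatAdj; omega
  · refine majNat_adj_of_dist 0 1 rfl (by unfold majParity; omega) (by unfold majParity; omega)
      h₁.2.1 h₂.2.1 h₃.2.1 h₁.2.2.1 h₂.2.2.1 h₃.2.2.1 d₁ d₂ d₃

theorem majNat_adj_AS (hk : 1 ≤ k) (h₁ : NatEdge k 1 0 x₁ y₁) (h₂ : NatEdge k 1 0 x₂ y₂)
    (h₃ : NatEdge k 1 0 x₃ y₃) : NatAdj k (majNat k x₁ x₂ x₃) (majNat k y₁ y₂ y₃) := by
  have key : ∀ {x y}, NatEdge k 1 0 x y → x % 2 = 0 ∧ x ≤ 2 * k ∧ y ≤ 2 * k ∧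
      ((x = 0 ∧ y = 2 * k) ∨ (y % 2 = 1 ∧ (x + 1 = y ∨ y + 1 = x))) := by
    intro x y h
    simp only [NatEdge, natList, NatAdj] at h
    omega
  have dist : ∀ {x y}, NatEdge k 1 0 x y →
      toParity k 0 x ≤ toParity k 1 y + 1 ∧ toParity k 1 y ≤ toParity k 0 x + 1 := by
    intro x y h
    have := key h
    unfold toParity; split_ifs <;> omega
  have d₁ := dist h₁
  have d₂ := dist h₂
  have d₃ := dist h₃
  replace h₁ := key h₁
  replace h₂ := key h₂
  replace h₃ := key h₃
  by_cases h : (y₁ = 2 * k ∧ y₂ = 2 * k) ∨ (y₁ = 2 * k ∧ y₃ = 2 * k) ∨ (y₂ = 2 * k ∧ y₃ = 2 * k)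
  · rw [majNat_eq_of_two h, majNat_eq_of_two (a := 0) (by omega)]
    unfold NatAdj; omega
  · refine majNat_adj_of_dist 0 1 rfl (by unfold majParity; omega) (by unfold majParity; omega)
      h₁.2.1 h₂.2.1 h₃.2.1 h₁.2.2.1 h₂.2.2.1 h₃.2.2.1 d₁ d₂ d₃

theorem majNat_adj_BS (hk : 1 ≤ k) (h₁ : NatEdge k 2 0 x₁ y₁) (h₂ : NatEdge k 2 0 x₂ y₂)
    (h₃ : NatEdge k 2 0 x₃ y₃) : NatAdj k (majNat k x₁ x₂ x₃) (majNat k y₁ y₂ y₃) := by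
  have key : ∀ {x y}, NatEdge k 2 0 x y → x ≤ 2 * k ∧ y ≤ 2 * k ∧
      ((x = 0 ∧ (y = 1 ∨ y = 2 * k)) ∨
        (y % 2 = 0 ∧ x % 2 = 1 ∧ (x + 1 = y ∨ y + 1 = x))) := by
    intro x y h
    simp only [NatEdge, natList, NatAdj] at h
    omega
  have dist : ∀ {x y}, NatEdge k 2 0 x y →
      toParity k 1 x ≤ toParity k 0 y + 1 ∧ toParity k 0 y ≤ toParity k 1 x + 1 := by
    intro x y h
    have := key h
    unfold toParity; split_ifs <;> omega
  have d₁ := dist h₁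
  have d₂ := dist h₂
  have d₃ := dist h₃
  replace h₁ := key h₁
  replace h₂ := key h₂
  replace h₃ := key h₃
  by_cases h : (x₁ = 0 ∧ x₂ = 0) ∨ (x₁ = 0 ∧ x₃ = 0) ∨ (x₂ = 0 ∧ x₃ = 0)
  · rw [majNat_eq_of_two h]
    have : majNat k y₁ y₂ y₃ = 1 ∨ majNat k y₁ y₂ y₃ = 2 * k := by
      by_cases e : (y₁ = 1 ∧ y₂ = 1) ∨ (y₁ = 1 ∧ y₃ = 1) ∨ (y₂ = 1 ∧ y₃ = 1)
      · exact .inl (majNat_eq_of_two e)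
      · right
        have hp : majParity y₁ y₂ y₃ = 0 := by unfold majParity; omega
        have t : ∀ y, y = 1 ∨ y = 2 * k → toParity k 0 y = 2 * k := by
          intro y hy
          unfold toParity; split_ifs <;> omega
        unfold majNat
        rw [hp]
        have r : ∀ y, (y ≤ 2 * k ∧ (y % 2 = 0 ∨ y = 1)) → toParity k 0 y ≤ 2 * k := by
          intro y hy
          unfold toParity; split_ifs <;> omega
        have := r y₁ (by omega)
        have := r y₂ (by omega)
        have := r y₃ (by omega)
        rcases h with h | h | h
        · rw [t y₁ (by omega), t y₂ (by omega)]; unfold natMedian; omega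
        · rw [t y₁ (by omega), t y₃ (by omega)]; unfold natMedian; omega
        · rw [t y₂ (by omega), t y₃ (by omega)]; unfold natMedian; omega
    unfold NatAdj; omega
  · refine majNat_adj_of_dist 1 0 rfl (by unfold majParity; omega) (by unfold majParity; omega)
      h₁.1 h₂.1 h₃.1 h₁.2.1 h₂.2.1 h₃.2.1 d₁ d₂ d₃

theorem majNat_adj (hk : 1 ≤ k) {c c' : Fin 3} (h₁ : NatEdge k c c' x₁ y₁)
    (h₂ : NatEdge k c c' x₂ y₂) (h₃ : NatEdge k c c' x₃ y₃) :
    NatAdj k (majNat k x₁ x₂ x₃) (majNat k y₁ y₂ y₃) := by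
  fin_cases c <;> fin_cases c'
  · exact majNat_adj_SS h₁ h₂ h₃
  · exact (majNat_adj_AS hk h₁.symm h₂.symm h₃.symm).symm
  · exact (majNat_adj_BS hk h₁.symm h₂.symm h₃.symm).symm
  · exact majNat_adj_AS hk h₁ h₂ h₃
  · exact majNat_adj_AA hk h₁ h₂ h₃
  · exact majNat_adj_AB hk h₁ h₂ h₃
  · exact majNat_adj_BS hk h₁ h₂ h₃
  · exact (majNat_adj_AB hk h₁.symm h₂.symm h₃.symm).symm
  · exact majNat_adj_BB hk h₁ h₂ h₃

end lists

theorem natList_majNat {k x y z : ℕ} {c : Fin 3} (hx : x ≤ 2 * k) (hy : y ≤ 2 * k)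
    (hz : z ≤ 2 * k) (h₁ : natList c x) (h₂ : natList c y) (h₃ : natList c z) :
    natList c (majNat k x y z) := by
  fin_cases c <;> simp only [natList] at *
  · have r : ∀ p x, x ≠ 0 → x ≤ 2 * k → toParity k p x ≠ 0 := by
      intro p x hx hk
      unfold toParity; split_ifs <;> omega
    unfold majNat
    rcases natMedian_mem (toParity k (majParity x y z) x) (toParity k (majParity x y z) y)
      (toParity k (majParity x y z) z) with h | h | h <;> rw [h]
    · exact r _ _ h₁ hx
    · exact r _ _ h₂ hy
    · exact r _ _ h₃ hz
  · have hp : majParity x y z = 0 := by unfold majParity; omega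
    unfold majNat
    rw [hp]
    rcases natMedian_mem (toParity k 0 x) (toParity k 0 y) (toParity k 0 z) with h | h | h <;>
      rw [h] <;> exact toParity_mod (by omega) ‹_›
  · by_cases h : (x = 0 ∧ y = 0) ∨ (x = 0 ∧ z = 0) ∨ (y = 0 ∧ z = 0)
    · exact .inr (majNat_eq_of_two h)
    · left
      have hp : majParity x y z = 1 := by unfold majParity; omega
      unfold majNat
      rw [hp]
      rcases natMedian_mem (toParity k 1 x) (toParity k 1 y) (toParity k 1 z) with h | h | h <;>
        rw [h] <;> exact toParity_mod (by omega) ‹_›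

/-- The majority operation on the vertices of the cycle. -/
def majority (k : ℕ) (x y z : Fin (2 * k + 1)) : Fin (2 * k + 1) :=
  ⟨majNat k x y z, majNat_lt (Nat.le_of_lt_succ x.2) (Nat.le_of_lt_succ y.2)
    (Nat.le_of_lt_succ z.2)⟩

theorem isMajority_majority (k : ℕ) : IsMajority (majority k) := fun a b =>
  ⟨Fin.ext (majNat_left k a b), Fin.ext (majNat_mid k a b), Fin.ext (majNat_right k a b)⟩

theorem majority_mem_listSet {k : ℕ} {c : Fin 3} {x y z : Fin (2 * k + 1)}
    (hx : x ∈ listSet k c) (hy : y ∈ listSet k c) (hz : z ∈ listSet k c) :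
    majority k x y z ∈ listSet k c := by
  rw [mem_listSet_iff] at *
  exact natList_majNat (Nat.le_of_lt_succ x.2) (Nat.le_of_lt_succ y.2)
    (Nat.le_of_lt_succ z.2) hx hy hz

theorem isPolymorphism_majority {k : ℕ} (hk : 1 ≤ k) (a b : Fin 3) :
    IsPolymorphism (majority k) (edgeRel k (listSet k a) (listSet k b)) := by
  have key : ∀ t ∈ edgeRel k (listSet k a) (listSet k b), NatEdge k a b (t 0) (t 1) :=
    fun t ht => ⟨Nat.le_of_lt_succ (t 0).2, Nat.le_of_lt_succ (t 1).2,
      (mem_listSet_iff _ _).1 ht.1, (mem_listSet_iff _ _).1 ht.2.1,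
      (cycle_adj_iff hk _ _).1 ht.2.2⟩
  intro t₁ h₁ t₂ h₂ t₃ h₃
  exact ⟨majority_mem_listSet h₁.1 h₂.1 h₃.1, majority_mem_listSet h₁.2.1 h₂.2.1 h₃.2.1,
    (cycle_adj_iff hk _ _).2 (majNat_adj hk (key _ h₁) (key _ h₂) (key _ h₃))⟩

end OddCycle

/-! ### The linear program for list homomorphisms -/

namespace VCSP

variable {X D : Type}

open Classical in
/-- The linear programming point of an assignment. -/
def pointOf (J : VCSP X D) (α : X → D) : J.LPPoint :=
  fun _ t => if t = (fun x => α x.1) then 1 else 0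

theorem safeasible_pointOf [Fintype D] (k : ℕ) (J : VCSP X D) (α : X → D)
    (hα : ∀ i, (J.term i).costAt (fun x => α x.1) ≠ ⊤) : SAFeasible k J (J.pointOf α) where
  sum_eq_one i := by simp [pointOf]
  marginal i j h _ s := by
    classical
    simp only [pointOf, Finset.sum_ite_eq', Finset.mem_filter, Finset.mem_univ, true_and]
    exact if_congr eq_comm rfl rfl
  eq_zero i t ht := by
    have : t ≠ fun x => α x.1 := by
      rintro rfl
      exact hα i ht
    simp [pointOf, this]
  nonneg i t := by
    unfold pointOf
    split_ifs <;> norm_num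

theorem mem_vars_iff {T : CostTerm X D} {x : X} : x ∈ T.vars ↔ ∃ r, T.scope r = x := by
  classical
  simp [CostTerm.vars]

theorem card_vars_le (T : CostTerm X D) : T.vars.card ≤ T.arity := by
  classical
  exact Finset.card_image_le.trans (by simp)

theorem SAFeasible.restrict_ne_zero [Fintype D] {k : ℕ} {J : VCSP X D} {lam : J.LPPoint}
    (h : SAFeasible k J lam) {i j : J.ι} (hij : (J.term j).vars ⊆ (J.term i).vars)
    (hk : (J.term j).vars.card ≤ k) {t : {x // x ∈ (J.term i).vars} → D} (ht : lam i t ≠ 0) :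
    lam j (fun x => t ⟨x.1, hij x.2⟩) ≠ 0 := by
  classical
  rw [← h.marginal i j hij hk]
  refine ne_of_gt (Finset.sum_pos' (fun t _ => h.nonneg i t) ⟨t, ?_, ?_⟩)
  · simp
  · exact lt_of_le_of_ne (h.nonneg i t) ht.symm

theorem SAFeasible.exists_extension [Fintype D] {k : ℕ} {J : VCSP X D} {lam : J.LPPoint}
    (h : SAFeasible k J lam) {i j : J.ι} (hij : (J.term j).vars ⊆ (J.term i).vars)
    (hk : (J.term j).vars.card ≤ k) {s : {x // x ∈ (J.term j).vars} → D} (hs : lam j s ≠ 0) :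
    ∃ t, lam i t ≠ 0 ∧ (fun x : {x // x ∈ (J.term j).vars} => t ⟨x.1, hij x.2⟩) = s := by
  classical
  rw [← h.marginal i j hij hk] at hs
  obtain ⟨t, ht, ht'⟩ := Finset.exists_ne_zero_of_sum_ne_zero hs
  exact ⟨t, ht', (Finset.mem_filter.1 ht).2⟩

section support

variable [Fintype X] [Fintype D] {I : VCSP X D}

/-- The pairs of values of positive weight in a solution of the relaxation. -/
def supportRel (lam : (I.pad 3).LPPoint) (u v : X) (a b : D) : Prop :=
  ∃ t, lam (.inr ⟨1, ![u, v]⟩) t ≠ 0 ∧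
    t ⟨u, CostTerm.scope_mem_vars ((I.pad 3).term (.inr ⟨1, ![u, v]⟩)) (0 : Fin 2)⟩ = a ∧
    t ⟨v, CostTerm.scope_mem_vars ((I.pad 3).term (.inr ⟨1, ![u, v]⟩)) (1 : Fin 2)⟩ = b

theorem SAFeasible.pathConsistent {lam : (I.pad 3).LPPoint} (h : SAFeasible 2 (I.pad 3) lam) :
    PathConsistent (supportRel lam) where
  diag u a b := by
    rintro ⟨t, -, rfl, rfl⟩
    rfl
  extend u v a b := by
    rintro ⟨s, hs, rfl, rfl⟩ w
    have vars_triple : ∀ x, x ∈ ((I.pad 3).term (.inr ⟨2, ![u, v, w]⟩)).vars ↔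
        x = u ∨ x = v ∨ x = w := by
      intro x
      rw [mem_vars_iff]
      change (∃ r : Fin 3, ![u, v, w] r = x) ↔ _
      simp [Fin.exists_fin_succ, eq_comm]
    have vars_pair : ∀ y z x, x ∈ ((I.pad 3).term (.inr ⟨1, ![y, z]⟩)).vars ↔ x = y ∨ x = z := by
      intro y z x
      rw [mem_vars_iff]
      change (∃ r : Fin 2, ![y, z] r = x) ↔ _
      simp [Fin.exists_fin_succ, eq_comm]
    have sub : ∀ y z, (y = u ∨ y = v ∨ y = w) → (z = u ∨ z = v ∨ z = w) →
        ((I.pad 3).term (.inr ⟨1, ![y, z]⟩)).vars ⊆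
          ((I.pad 3).term (.inr ⟨2, ![u, v, w]⟩)).vars := by
      intro y z hy hz x hx
      rw [vars_pair] at hx
      rw [vars_triple]
      rcases hx with rfl | rfl <;> assumption
    obtain ⟨t, ht, rfl⟩ := h.exists_extension (sub u v (by simp) (by simp))
      (card_vars_le _) hs
    refine ⟨t ⟨w, (vars_triple w).2 (by simp)⟩, ?_, ?_⟩
    · exact ⟨_, h.restrict_ne_zero (sub u w (by simp) (by simp)) (card_vars_le _) ht, rfl, rfl⟩
    · exact ⟨_, h.restrict_ne_zero (sub v w (by simp) (by simp)) (card_vars_le _) ht, rfl, rfl⟩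

theorem SAFeasible.exists_supportRel {lam : (I.pad 3).LPPoint} (h : SAFeasible 2 (I.pad 3) lam)
    (v : X) : ∃ a, supportRel lam v v a a := by
  have := h.sum_eq_one (.inr ⟨1, ![v, v]⟩)
  obtain ⟨t, -, ht⟩ := Finset.exists_ne_zero_of_sum_ne_zero (this.trans_ne one_ne_zero)
  exact ⟨_, t, ht, rfl, rfl⟩

end support

end VCSP

namespace OddCycle

open VCSP

section exactness

variable {k n : ℕ} (G : SimpleGraph (Fin n)) (c : Fin n → Fin 3)

/-- The list homomorphism instance with lists from the three sets. -/
abbrev instOf (k : ℕ) {n : ℕ} (G : SimpleGraph (Fin n)) (c : Fin n → Fin 3) :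
    VCSP (Fin n) (Fin (2 * k + 1)) := listHomVCSP k G fun v => listSet k (c v)

/-- Existence of a list homomorphism. -/
def HasListHom (k : ℕ) {n : ℕ} (G : SimpleGraph (Fin n)) (c : Fin n → Fin 3) : Prop :=
  ∃ g : G →g cycle k, ∀ v, g v ∈ listSet k (c v)

theorem exists_mem_listSet (hk : 1 ≤ k) (c : Fin 3) : ∃ a, a ∈ listSet k c := by
  fin_cases c
  · exact ⟨⟨1, by omega⟩, by simp [mem_listSet_iff, natList]⟩
  · exact ⟨⟨0, by omega⟩, by simp [mem_listSet_iff, natList]⟩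
  · exact ⟨⟨0, by omega⟩, by simp [mem_listSet_iff, natList]⟩

/-- The binary constraints of the list homomorphism problem. -/
def Allowed (k : ℕ) {n : ℕ} (G : SimpleGraph (Fin n)) (c : Fin n → Fin 3) (u v : Fin n)
    (a b : Fin (2 * k + 1)) : Prop :=
  a ∈ listSet k (c u) ∧ b ∈ listSet k (c v) ∧ (G.Adj u v → (cycle k).Adj a b)

theorem Allowed.majority (hk : 1 ≤ k) {u v : Fin n} {a₁ a₂ a₃ b₁ b₂ b₃ : Fin (2 * k + 1)}
    (h₁ : Allowed k G c u v a₁ b₁) (h₂ : Allowed k G c u v a₂ b₂)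
    (h₃ : Allowed k G c u v a₃ b₃) :
    Allowed k G c u v (majority k a₁ a₂ a₃) (majority k b₁ b₂ b₃) := by
  refine ⟨majority_mem_listSet h₁.1 h₂.1 h₃.1, majority_mem_listSet h₁.2.1 h₂.2.1 h₃.2.1,
    fun huv => ?_⟩
  exact (isPolymorphism_majority hk (c u) (c v) ![a₁, b₁] ⟨h₁.1, h₁.2.1, h₁.2.2 huv⟩
    ![a₂, b₂] ⟨h₂.1, h₂.2.1, h₂.2.2 huv⟩ ![a₃, b₃] ⟨h₃.1, h₃.2.1, h₃.2.2 huv⟩).2.2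

theorem hasListHom_of_pathConsistent (hk : 1 ≤ k)
    {R : Fin n → Fin n → Fin (2 * k + 1) → Fin (2 * k + 1) → Prop} (hR : PathConsistent R)
    (hne : ∀ v, ∃ a, R v v a a) (hRC : ∀ u v a b, R u v a b → Allowed k G c u v a b) :
    HasListHom k G c := by
  obtain ⟨g, hg⟩ := hR.exists_solution hne (isMajority_majority k) hRC
    (fun u v _ _ _ _ _ _ => Allowed.majority G c hk)
  exact ⟨⟨g, fun {u v} huv => (hg u v).2.2 huv⟩, fun v => (hg v v).1⟩

theorem hasListHom_of_edges (hk : 1 ≤ k)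
    {R : Fin n → Fin n → Fin (2 * k + 1) → Fin (2 * k + 1) → Prop} (hR : PathConsistent R)
    (hne : ∀ v, ∃ a, R v v a a)
    (hRC : ∀ u v a b, u < v → G.Adj u v → R u v a b →
      ![a, b] ∈ edgeRel k (listSet k (c u)) (listSet k (c v))) :
    HasListHom k G c := by
  classical
  have hadj : ∀ u v a b, G.Adj u v → R u v a b → Allowed k G c u v a b := by
    intro u v a b huv h
    rcases lt_or_gt_of_ne huv.ne with h' | h'
    · have := hRC u v a b h' huv h
      exact ⟨this.1, this.2.1, fun _ => this.2.2⟩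
    · have := hRC v u b a h' huv.symm (hR.symm h)
      exact ⟨this.2.1, this.1, fun _ => this.2.2.symm⟩
  obtain ⟨g, hg⟩ := hR.exists_solution (C := fun u v a b => G.Adj u v → Allowed k G c u v a b) hne
    (isMajority_majority k) (fun u v a b h huv => hadj u v a b huv h)
    (fun u v _ _ _ _ _ _ h₁ h₂ h₃ huv => Allowed.majority G c hk (h₁ huv) (h₂ huv) (h₃ huv))
  have hmem : ∀ v, ∃ a, a ∈ listSet k (c v) := fun v => exists_mem_listSet hk _
  choose e he using hmem
  have hg' : ∀ u v, G.Adj u v → (if g u ∈ listSet k (c u) then g u else e u) = g u :=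
    fun u v h => if_pos (hg u v h).1
  refine ⟨⟨fun v => if g v ∈ listSet k (c v) then g v else e v, fun {u v} huv => ?_⟩,
    fun v => ?_⟩
  · rw [hg' u v huv, hg' v u huv.symm]
    exact (hg u v huv).2.2 huv
  · change (if g v ∈ listSet k (c v) then g v else e v) ∈ _
    split_ifs with h
    · exact h
    · exact he v

theorem costAt_eq (i : ((instOf k G c).pad 3).ι) (t) :
    (((instOf k G c).pad 3).term i).costAt t = 0 ∨ (((instOf k G c).pad 3).term i).costAt t = ⊤ := by
  classical
  rcases i with e | x
  · by_cases h : (fun r => t ⟨_, CostTerm.scope_mem_vars _ r⟩) ∈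
        edgeRel k (listSet k (c e.1.1)) (listSet k (c e.1.2))
    · exact .inl (if_pos h)
    · exact .inr (if_neg h)
  · exact .inl rfl

theorem saObjective_eq_zero (lam : ((instOf k G c).pad 3).LPPoint) :
    saObjective ((instOf k G c).pad 3) lam = 0 := by
  unfold saObjective
  refine Finset.sum_eq_zero fun i _ => Finset.sum_eq_zero fun t _ => ?_
  rcases costAt_eq G c i t with h | h
  · simp [h]
  · simp [h]

theorem hasListHom_of_feasible (hk : 1 ≤ k) {lam : ((instOf k G c).pad 3).LPPoint}
    (h : SAFeasible 2 ((instOf k G c).pad 3) lam) : HasListHom k G c := by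
  classical
  refine hasListHom_of_edges G c hk h.pathConsistent h.exists_supportRel ?_
  rintro u v a b huv hadj ⟨s, hs, rfl, rfl⟩
  have sub : (((instOf k G c).pad 3).term (.inr ⟨1, ![u, v]⟩)).vars ⊆
      (((instOf k G c).pad 3).term (.inl ⟨(u, v), huv, hadj⟩)).vars := subset_rfl
  obtain ⟨t, ht, rfl⟩ := h.exists_extension sub (card_vars_le _) hs
  have hcost : (((instOf k G c).pad 3).term (.inl ⟨(u, v), huv, hadj⟩)).costAt t ≠ ⊤ :=
    fun hc => ht (h.eq_zero _ _ hc)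
  by_contra hcon
  refine hcost (if_neg fun hmem => hcon ?_)
  exact ⟨hmem.1, hmem.2.1, hmem.2.2⟩

theorem feasible_of_hasListHom (h : HasListHom k G c) :
    ∃ lam, SAFeasible 2 ((instOf k G c).pad 3) lam := by
  classical
  obtain ⟨g, hg⟩ := h
  refine ⟨_, safeasible_pointOf 2 _ g ?_⟩
  rintro (e | x)
  · have : (((instOf k G c).pad 3).term (.inl e)).costAt (fun x => g x.1) = 0 :=
      if_pos ⟨hg _, hg _, g.map_adj e.2.2⟩
    rw [this]
    exact WithTop.zero_ne_top
  · exact WithTop.zero_ne_top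

theorem costToEReal_top : costToEReal ⊤ = ⊤ := if_pos rfl

theorem costToEReal_zero : costToEReal 0 = 0 := by
  simp [costToEReal]

open Classical in
theorem saOpt_eq (hk : 1 ≤ k) :
    (instOf k G c).saOpt 2 3 = if HasListHom k G c then 0 else ⊤ := by
  unfold saOpt
  simp only [saObjective_eq_zero]
  split_ifs with h
  · obtain ⟨lam, hlam⟩ := feasible_of_hasListHom G c h
    refine le_antisymm (iInf₂_le lam hlam) (le_iInf₂ fun _ _ => le_rfl)
  · refine le_antisymm le_top (le_iInf₂ fun lam hlam => ?_)
    exact absurd (hasListHom_of_feasible G c hk hlam) h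

open Classical in
theorem opt_eq (hk : 1 ≤ k) :
    (instOf k G c).opt = if HasListHom k G c then 0 else ⊤ := by
  have hterm : ∀ (α : Fin n → Fin (2 * k + 1)) (e : (instOf k G c).ι),
      (((instOf k G c).term e).cost fun r => α (((instOf k G c).term e).scope r)) =
        if ![α e.1.1, α e.1.2] ∈ edgeRel k (listSet k (c e.1.1)) (listSet k (c e.1.2))
          then 0 else ⊤ := by
    intro α e
    refine if_congr ?_ rfl rfl
    rw [show (fun r => α (((instOf k G c).term e).scope r)) = ![α e.1.1, α e.1.2] from
      funext fun r => by fin_cases r <;> rfl]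
  have hcost : ∀ α, (instOf k G c).cost α = 0 ∨ (instOf k G c).cost α = ⊤ := by
    intro α
    by_cases h : ∃ e : (instOf k G c).ι,
        ![α e.1.1, α e.1.2] ∉ edgeRel k (listSet k (c e.1.1)) (listSet k (c e.1.2))
    · obtain ⟨e, he⟩ := h
      right
      unfold VCSP.cost
      refine WithTop.sum_eq_top.2 ⟨e, Finset.mem_univ _, ?_⟩
      rw [hterm, if_neg he]
    · push Not at h
      left
      refine Finset.sum_eq_zero fun e _ => ?_
      rw [hterm, if_pos (h e)]
  unfold opt
  split_ifs with h
  · refine le_antisymm ?_ (le_iInf fun α => ?_)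
    · obtain ⟨g, hg⟩ := h
      refine iInf_le_of_le g ?_
      have : (instOf k G c).cost g = 0 := Finset.sum_eq_zero fun e _ => by
        rw [hterm, if_pos ⟨hg _, hg _, g.map_adj e.2.2⟩]
      rw [this, costToEReal_zero]
    · rcases hcost α with h | h <;> simp [h, costToEReal_zero, costToEReal_top]
  · refine le_antisymm le_top (le_iInf fun α => ?_)
    rcases hcost α with h0 | h0
    · exfalso
      apply h
      have hall : ∀ i : ((instOf k G c).pad 3).ι,
          (((instOf k G c).pad 3).term i).costAt (fun x => α x.1) ≠ ⊤ := by
        rintro (e | x)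
        · intro htop
          have : (instOf k G c).cost α = ⊤ := WithTop.sum_eq_top.2 ⟨e, Finset.mem_univ _, htop⟩
          rw [h0] at this
          exact WithTop.zero_ne_top this
        · exact WithTop.zero_ne_top
      exact hasListHom_of_feasible G c hk (safeasible_pointOf 2 _ α hall)
    · rw [h0, costToEReal_top]

theorem saOpt_eq_zero_iff (hk : 1 ≤ k) :
    (instOf k G c).saOpt 2 3 = 0 ↔ HasListHom k G c := by
  classical
  rw [saOpt_eq G c hk]
  split_ifs with h <;> simp [h]

end exactness
end OddCycle

/-! ### The success probability of a sample -/

namespace OddCycle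

theorem alpha_pow_eq {k : ℕ} (hk : 1 ≤ k) :
    alpha k ^ (2 * k + 1) = ((2 * k + 1 : ℝ) / 2) * ((2 * k + 1 : ℝ) / (2 * k)) ^ (2 * k) := by
  have hk' : (0 : ℝ) < k := by exact_mod_cast hk
  have hd : (2 * k + 1 : ℝ) ≠ 0 := by positivity
  unfold alpha
  rw [mul_pow, ← Real.rpow_natCast, ← Real.rpow_mul (by positivity), ← Real.rpow_natCast,
    ← Real.rpow_mul (by positivity)]
  push_cast
  rw [div_mul_cancel₀ _ hd, div_mul_cancel₀ _ hd, Real.rpow_one]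
  congr 1
  rw [← Real.rpow_natCast]
  push_cast
  rfl

theorem alpha_pos {k : ℕ} (hk : 1 ≤ k) : 0 < alpha k := by
  have hk' : (0 : ℝ) < k := by exact_mod_cast hk
  unfold alpha
  positivity

theorem one_le_alpha {k : ℕ} (hk : 1 ≤ k) : 1 ≤ alpha k := by
  have hk' : (1 : ℝ) ≤ k := by exact_mod_cast hk
  unfold alpha
  refine one_le_mul_of_one_le_of_one_le (Real.one_le_rpow ?_ (by positivity))
    (Real.one_le_rpow ?_ (by positivity))
  · rw [one_le_div (by norm_num)]; linarith
  · rw [one_le_div (by linarith)]; linarith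

/-- The probability that the value `a` belongs to a random list. -/
def valueProb (k : ℕ) (a : Fin (2 * k + 1)) : ℝ :=
  if a = 0 then 2 / (2 * k + 1) else 2 * k / (2 * k + 1)

theorem valueProb_nonneg (k : ℕ) (a : Fin (2 * k + 1)) : 0 ≤ valueProb k a := by
  unfold valueProb
  split_ifs <;> positivity

/-- Rotation of a homomorphism. -/
def rotate {k n : ℕ} {G : SimpleGraph (Fin n)} (h : G →g cycle k) (j : Fin (2 * k + 1)) :
    G →g cycle k where
  toFun v := h v - j
  map_rel' {u v} huv := by
    have := h.map_adj huv
    rw [SimpleGraph.cycleGraph_adj'] at this ⊢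
    rwa [sub_sub_sub_cancel_right, sub_sub_sub_cancel_right]

theorem exists_rare_value {d n : ℕ} [NeZero d] (h : Fin n → Fin d) :
    ∃ j, d * (Finset.univ.filter fun v => h v = j).card ≤ n := by
  by_contra! hcon
  have h1 : ∑ j, (Finset.univ.filter fun v => h v = j).card = n := by
    rw [← Finset.card_eq_sum_card_fiberwise (fun _ _ => Finset.mem_univ _)]
    simp
  have h2 : ∑ _j : Fin d, n < ∑ j, d * (Finset.univ.filter fun v => h v = j).card :=
    Finset.sum_lt_sum_of_nonempty Finset.univ_nonempty fun j _ => hcon j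
  rw [← Finset.mul_sum, h1] at h2
  simp at h2

theorem exists_hom_valueProb {k n : ℕ} (hk : 1 ≤ k) {G : SimpleGraph (Fin n)}
    (hG : Nonempty (G →g cycle k)) :
    ∃ h : G →g cycle k, (alpha k ^ n)⁻¹ ≤ ∏ v, valueProb k (h v) := by
  obtain ⟨h₀⟩ := hG
  obtain ⟨j, hj⟩ := exists_rare_value h₀
  refine ⟨rotate h₀ j, ?_⟩
  set m := (Finset.univ.filter fun v => h₀ v = j).card with hm
  have hk' : (1 : ℝ) ≤ k := by exact_mod_cast hk
  have hk0 : (0 : ℝ) < k := by linarith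
  have hmn : m ≤ n := by
    have := Finset.card_filter_le (Finset.univ : Finset (Fin n)) (fun v => h₀ v = j)
    simpa using this
  have hcompl : (Finset.univ.filter fun v => ¬ h₀ v = j).card = n - m := by
    have := Finset.card_filter_add_card_filter_not (s := Finset.univ) (fun v => h₀ v = j)
    simp only [Finset.card_univ, Fintype.card_fin] at this
    omega
  have hprod : ∏ v, valueProb k (rotate h₀ j v) =
      (2 / (2 * k + 1) : ℝ) ^ m * (2 * k / (2 * k + 1) : ℝ) ^ (n - m) := by
    have : ∀ v, valueProb k (rotate h₀ j v) =
        if h₀ v = j then (2 / (2 * k + 1) : ℝ) else 2 * k / (2 * k + 1) := by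
      intro v
      unfold valueProb
      exact if_congr sub_eq_zero rfl rfl
    simp only [this]
    rw [Finset.prod_ite, Finset.prod_const, Finset.prod_const, hcompl]
  rw [hprod, show (2 / (2 * k + 1) : ℝ) ^ m * (2 * k / (2 * k + 1) : ℝ) ^ (n - m) =
    (((2 * k + 1 : ℝ) / 2) ^ m * ((2 * k + 1 : ℝ) / (2 * k)) ^ (n - m))⁻¹ by
      rw [mul_inv, ← inv_pow, ← inv_pow, inv_div, inv_div]]
  refine inv_anti₀ (by positivity) ?_
  refine le_of_pow_le_pow_left₀ (n := 2 * k + 1) (by omega) (pow_nonneg (alpha_pos hk).le _) ?_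
  set B : ℝ := (2 * k + 1 : ℝ) / (2 * k) with hB
  have hA : (2 * k + 1 : ℝ) / 2 = k * B := by
    rw [hB]; field_simp
  have hB0 : 0 < B := by positivity
  rw [pow_right_comm, alpha_pow_eq hk, ← hB, hA, mul_pow (k : ℝ) B m, mul_assoc ((k : ℝ) ^ m),
    ← pow_add, show m + (n - m) = n by omega, mul_pow, ← pow_mul, ← pow_mul, mul_assoc,
    ← pow_succ', mul_pow, ← pow_mul, mul_comm (2 * k + 1) n]
  refine mul_le_mul_of_nonneg_right (pow_le_pow_right₀ hk' ?_) (by positivity)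
  rw [mul_comm]
  exact hj

theorem sum_listProb_mem {k : ℕ} (a : Fin (2 * k + 1)) [∀ i, Decidable (a ∈ listSet k i)] :
    ∑ i : Fin 3, (if a ∈ listSet k i then listProb k i else 0) = valueProb k a := by
  have hd : (2 * k + 1 : ℝ) ≠ 0 := by positivity
  rw [Fin.sum_univ_three]
  simp only [mem_listSet_iff, natList, listProb, valueProb, ← Fin.val_eq_zero_iff]
  rcases Nat.eq_zero_or_pos (a : ℕ) with h | h
  · simp [h]
    ring
  · rcases Nat.mod_two_eq_zero_or_one (a : ℕ) with h' | h'
    · simp [h.ne', h']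
      field_simp
      ring
    · simp [h.ne', h']
      field_simp
      ring

theorem listProb_nonneg {k : ℕ} (hk : 1 ≤ k) (i : Fin 3) : 0 ≤ listProb k i := by
  have hk' : (1 : ℝ) ≤ k := by exact_mod_cast hk
  have : (0 : ℝ) ≤ 2 * k - 1 := by linarith
  fin_cases i <;> simp [listProb] <;> positivity

theorem inv_alpha_pow_le_sampleSuccess {k n : ℕ} (hk : 1 ≤ k) {G : SimpleGraph (Fin n)}
    (hG : Nonempty (G →g cycle k)) : (alpha k ^ n)⁻¹ ≤ sampleSuccess k G := by
  classical
  obtain ⟨h, hh⟩ := exists_hom_valueProb hk hG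
  refine hh.trans ?_
  have : ∏ v, valueProb k (h v) =
      ∑ c : Fin n → Fin 3, ∏ v, if h v ∈ listSet k (c v) then listProb k (c v) else 0 := by
    rw [← Fintype.piFinset_univ, ← Finset.prod_univ_sum
      (f := fun v i => if h v ∈ listSet k i then listProb k i else 0)]
    exact Finset.prod_congr rfl fun v _ => (sum_listProb_mem _).symm
  rw [this]
  unfold sampleSuccess
  refine Finset.sum_le_sum fun c _ => ?_
  by_cases hc : ∀ v, h v ∈ listSet k (c v)
  · rw [if_pos ((saOpt_eq_zero_iff G c hk).2 ⟨h, hc⟩)]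
    exact (Finset.prod_congr rfl fun v _ => if_pos (hc v)).le
  · push Not at hc
    obtain ⟨v, hv⟩ := hc
    rw [Finset.prod_eq_zero (Finset.mem_univ v) (if_neg hv)]
    split_ifs
    · exact Finset.prod_nonneg fun v _ => listProb_nonneg hk _
    · exact le_rfl

end OddCycle

/-! ### Executions of random-access machine programs -/

namespace RAM

/-- Two runs of a program from the same memory whose coin flips agree coincide. -/
theorem Exec.deterministic {S : ℕ} {p : Prog} {σ τ : Store} {w : List Bool} {t : ℕ}
    (h : Exec S p σ w t τ) : ∀ {S' t' : ℕ} {τ' : Store} {w' u u' : List Bool},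
    Exec S' p σ w' t' τ' → w ++ u = w' ++ u' → w = w' ∧ τ = τ' := by
  induction h with
  | skip σ hS =>
    intro S' t' τ' w' u u' h' hw
    cases h'
    exact ⟨rfl, rfl⟩
  | write a i e σ hS =>
    intro S' t' τ' w' u u' h' hw
    cases h'
    exact ⟨rfl, rfl⟩
  | flip a b σ hS =>
    intro S' t' τ' w' u u' h' hw
    cases h'
    simp only [List.cons_append, List.nil_append, List.cons.injEq] at hw
    obtain ⟨rfl, -⟩ := hw
    exact ⟨rfl, rfl⟩
  | seq p q σ σ' τ w w' t t' hp hq ihp ihq =>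
    intro S' t' τ' w' u u' h' hw
    cases h' with
    | seq _ _ _ _ _ v v' _ _ hp' hq' =>
      simp only [List.append_assoc] at hw
      obtain ⟨rfl, rfl⟩ := ihp hp' hw
      obtain ⟨rfl, rfl⟩ := ihq hq' (List.append_cancel_left hw)
      exact ⟨rfl, rfl⟩
  | cond_true e p q σ τ w t he hS hp ih =>
    intro S' t' τ' w' u u' h' hw
    cases h' with
    | cond_true _ _ _ _ _ _ _ _ _ hp' => exact ih hp' hw
    | cond_false _ _ _ _ _ _ _ he' => exact absurd he' he
  | cond_false e p q σ τ w t he hS hp ih =>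
    intro S' t' τ' w' u u' h' hw
    cases h' with
    | cond_true _ _ _ _ _ _ _ he' => exact absurd he he'
    | cond_false _ _ _ _ _ _ _ _ _ hp' => exact ih hp' hw
  | loop_done e p σ he hS =>
    intro S' t' τ' w' u u' h' hw
    cases h' with
    | loop_done => exact ⟨rfl, rfl⟩
    | loop_step _ _ _ _ _ _ _ _ _ he' => exact absurd he he'
  | loop_step e p σ σ' τ w w' t t' he hS hp hl ihp ihl =>
    intro S' t' τ' w' u u' h' hw
    cases h' with
    | loop_done _ _ _ he' => exact absurd he' he
    | loop_step _ _ _ _ _ v v' _ _ _ _ hp' hl' =>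
      simp only [List.append_assoc] at hw
      obtain ⟨rfl, rfl⟩ := ihp hp' hw
      obtain ⟨rfl, rfl⟩ := ihl hl' (List.append_cancel_left hw)
      exact ⟨rfl, rfl⟩

/-! #### Bounds for time and space -/

theorem size_add_le (a b : ℕ) : Nat.size (a + b) ≤ Nat.size a + Nat.size b + 1 := by
  rw [Nat.size_le]
  have ha := Nat.lt_size_self a
  have hb := Nat.lt_size_self b
  have h1 : 2 ^ a.size ≤ 2 ^ (a.size + b.size) := Nat.pow_le_pow_right (by norm_num) (by omega)
  have h2 : 2 ^ b.size ≤ 2 ^ (a.size + b.size) := Nat.pow_le_pow_right (by norm_num) (by omega)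
  rw [pow_succ]
  omega

theorem size_mul_le (a b : ℕ) : Nat.size (a * b) ≤ Nat.size a + Nat.size b := by
  rw [Nat.size_le, pow_add]
  exact Nat.mul_lt_mul'' (Nat.lt_size_self a) (Nat.lt_size_self b)

theorem size_le_self (a : ℕ) : Nat.size a ≤ a := Nat.size_le.2 Nat.lt_two_pow_self

namespace Expr

/-- The cost of an expression when all numbers have bit length at most `1`, roughly. -/
def weight : Expr → ℕ
  | .const c => 1 + Nat.size c
  | .read _ i => i.weight + 2
  | .add e₁ e₂ | .sub e₁ e₂ | .mul e₁ e₂ | .div e₁ e₂ => 2 * (e₁.weight + e₂.weight) + 2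

theorem size_eval_le_cost (σ : Store) (e : Expr) : Nat.size (e.eval σ) ≤ e.cost σ := by
  cases e <;> simp only [eval, cost] <;> omega

theorem cost_le {σ : Store} {B : ℕ} (hB : 1 ≤ B) (h : ∀ c, Nat.size (σ c) ≤ B) (e : Expr) :
    e.cost σ ≤ e.weight * B := by
  have two : ∀ (e₁ e₂ : Expr) (x : ℕ), e₁.cost σ ≤ e₁.weight * B → e₂.cost σ ≤ e₂.weight * B →
      Nat.size x ≤ Nat.size (e₁.eval σ) + Nat.size (e₂.eval σ) + 1 →
      e₁.cost σ + e₂.cost σ + (1 + Nat.size x) ≤ (2 * (e₁.weight + e₂.weight) + 2) * B := by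
    intro e₁ e₂ x h₁ h₂ hx
    have s₁ := size_eval_le_cost σ e₁
    have s₂ := size_eval_le_cost σ e₂
    calc e₁.cost σ + e₂.cost σ + (1 + Nat.size x)
        ≤ 2 * (e₁.weight * B + e₂.weight * B) + 2 * 1 := by omega
      _ ≤ 2 * (e₁.weight * B + e₂.weight * B) + 2 * B := by omega
      _ = _ := by ring
  induction e with
  | const c => exact Nat.le_mul_of_pos_right _ hB
  | read a i ih =>
    have := h (a, i.eval σ)
    simp only [cost, weight]
    rw [add_mul]
    omega
  | add e₁ e₂ h₁ h₂ => exact two _ _ _ h₁ h₂ (size_add_le _ _)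
  | sub e₁ e₂ h₁ h₂ =>
    exact two _ _ _ h₁ h₂ ((Nat.size_le_size (Nat.sub_le _ _)).trans (by omega))
  | mul e₁ e₂ h₁ h₂ => exact two _ _ _ h₁ h₂ ((size_mul_le _ _).trans (by omega))
  | div e₁ e₂ h₁ h₂ =>
    exact two _ _ _ h₁ h₂ ((Nat.size_le_size (Nat.div_le_self _ _)).trans (by omega))

end Expr

/-- A bound for the cost of a step of the program, relative to the bit length of the numbers. -/
def Prog.weight : Prog → ℕ
  | .skip => 1
  | .write _ i e => i.weight + e.weight + 1
  | .flip _ => 2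
  | .seq p q => p.weight + q.weight
  | .cond e p q => e.weight + 1 + p.weight + q.weight
  | .loop e p => e.weight + 1 + p.weight

/-- The memory uses only the arrays `0, …, 9` and addresses below `A`, and all numbers have bit
length at most `B`. -/
structure Bounded (A B : ℕ) (σ : Store) : Prop where
  address : ∀ a i, σ (a, i) ≠ 0 → a < 10 ∧ i < A
  size : ∀ c, Nat.size (σ c) ≤ B

theorem Bounded.update {A B : ℕ} {σ : Store} (h : Bounded A B σ) {a i v : ℕ} (ha : a < 10)
    (hi : i < A) (hv : Nat.size v ≤ B) : Bounded A B (σ.update (a, i) v) where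
  address a' i' h' := by
    by_cases e : (a', i') = (a, i)
    · cases e
      exact ⟨ha, hi⟩
    · rw [Finsupp.coe_update, Function.update_of_ne e] at h'
      exact h.address _ _ h'
  size c := by
    by_cases e : c = (a, i)
    · rw [Finsupp.coe_update, e, Function.update_self]
      exact hv
    · rw [Finsupp.coe_update, Function.update_of_ne e]
      exact h.size _

/-- A bound for the space used by a bounded memory. -/
def spaceBound (A B : ℕ) : ℕ := 10 * A * (1 + A + B)

theorem Bounded.space_le {A B : ℕ} {σ : Store} (h : Bounded A B σ) : σ.space ≤ spaceBound A B := by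
  unfold Store.space Finsupp.sum
  have hsub : σ.support ⊆ Finset.range 10 ×ˢ Finset.range A := by
    intro c hc
    have := h.address c.1 c.2 (Finsupp.mem_support_iff.1 hc)
    simpa using this
  calc ∑ c ∈ σ.support, (1 + Nat.size c.2 + Nat.size (σ c))
      ≤ ∑ c ∈ σ.support, (1 + A + B) := by
        refine Finset.sum_le_sum fun c hc => ?_
        have h1 := h.address c.1 c.2 (Finsupp.mem_support_iff.1 hc)
        have h2 := h.size c
        have h3 := size_le_self c.2
        omega
    _ = σ.support.card * (1 + A + B) := by rw [Finset.sum_const, smul_eq_mul]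
    _ ≤ _ := by
        refine Nat.mul_le_mul_right _ ((Finset.card_le_card hsub).trans ?_)
        simp

/-- `Runs A B W p σ w s τ`: the program runs from `σ` to `τ` with coin flips `w` in `s` steps of
cost at most `W * B` each, within the space allowed by the bounds. -/
def Runs (A B W : ℕ) (p : Prog) (σ : Store) (w : List Bool) (s : ℕ) (τ : Store) : Prop :=
  ∃ t ≤ s * (W * B), Exec (spaceBound A B + W * B) p σ w t τ

namespace Runs

variable {A B W : ℕ}

theorem write {a : ℕ} {i e : Expr} {σ : Store} (hB : 1 ≤ B) (h : Bounded A B σ)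
    (hW : (Prog.write a i e).weight ≤ W) :
    Runs A B W (.write a i e) σ [] 1 (σ.update (a, i.eval σ) (e.eval σ)) := by
  have hc : i.cost σ + e.cost σ + 1 ≤ W * B := by
    calc i.cost σ + e.cost σ + 1 ≤ i.weight * B + e.weight * B + 1 * B := by
          have := i.cost_le hB h.size
          have := e.cost_le hB h.size
          omega
      _ = (Prog.write a i e).weight * B := by unfold Prog.weight; ring
      _ ≤ W * B := Nat.mul_le_mul_right _ hW
  have := h.space_le
  exact ⟨_, by omega, Exec.write a i e σ (by omega)⟩

theorem flip {a : ℕ} {σ : Store} (b : Bool) (hB : 1 ≤ B) (h : Bounded A B σ)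
    (hW : (Prog.flip a).weight ≤ W) :
    Runs A B W (.flip a) σ [b] 1 (σ.update (a, 0) b.toNat) := by
  have hc : 2 ≤ W * B := by
    calc 2 ≤ 2 * B := by omega
      _ ≤ W * B := Nat.mul_le_mul_right _ hW
  have := h.space_le
  exact ⟨_, by omega, Exec.flip a b σ (by omega)⟩

theorem seq {p q : Prog} {σ σ' τ : Store} {w w' : List Bool} {s s' : ℕ}
    (hp : Runs A B W p σ w s σ') (hq : Runs A B W q σ' w' s' τ) :
    Runs A B W (.seq p q) σ (w ++ w') (s + s') τ := by
  obtain ⟨t, ht, h⟩ := hp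
  obtain ⟨t', ht', h'⟩ := hq
  exact ⟨t + t', by rw [add_mul]; omega, Exec.seq _ _ _ _ _ _ _ _ _ h h'⟩

theorem mono {p : Prog} {σ τ : Store} {w : List Bool} {s s' : ℕ} (h : Runs A B W p σ w s τ)
    (hs : s ≤ s') : Runs A B W p σ w s' τ := by
  obtain ⟨t, ht, h⟩ := h
  exact ⟨t, ht.trans (Nat.mul_le_mul_right _ hs), h⟩

theorem cost_test {e : Expr} {p : Prog} {σ : Store} (hB : 1 ≤ B) (h : Bounded A B σ)
    (hW : (Prog.loop e p).weight ≤ W) : e.cost σ + 1 ≤ W * B := by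
  calc e.cost σ + 1 ≤ e.weight * B + 1 * B := by
        have := e.cost_le hB h.size
        omega
    _ = (e.weight + 1) * B := by ring
    _ ≤ W * B := Nat.mul_le_mul_right _ (by unfold Prog.weight at hW; omega)

theorem loop_done {e : Expr} {p : Prog} {σ : Store} (hB : 1 ≤ B) (h : Bounded A B σ)
    (hW : (Prog.loop e p).weight ≤ W) (he : e.eval σ = 0) :
    Runs A B W (.loop e p) σ [] 1 σ := by
  have hc := cost_test hB h hW
  have := h.space_le
  exact ⟨_, by omega, Exec.loop_done e p σ he (by omega)⟩

theorem loop_step {e : Expr} {p : Prog} {σ σ' τ : Store} {w w' : List Bool} {s s' : ℕ}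
    (hB : 1 ≤ B) (h : Bounded A B σ) (hW : (Prog.loop e p).weight ≤ W) (he : e.eval σ ≠ 0)
    (hp : Runs A B W p σ w s σ') (hl : Runs A B W (.loop e p) σ' w' s' τ) :
    Runs A B W (.loop e p) σ (w ++ w') (1 + s + s') τ := by
  have hc := cost_test hB h hW
  have := h.space_le
  obtain ⟨t, ht, h⟩ := hp
  obtain ⟨t', ht', hloop⟩ := hl
  exact ⟨_, by rw [add_mul, add_mul]; omega,
    Exec.loop_step e p _ _ _ _ _ _ _ he (by omega) h hloop⟩

/-- A loop with an invariant that passes through `T` rounds. -/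
theorem loop {e : Expr} {p : Prog} (hB : 1 ≤ B) (hW : (Prog.loop e p).weight ≤ W)
    (Inv : ℕ → Store → Prop) (T s : ℕ) (w : ℕ → List Bool)
    (hbdd : ∀ j σ, Inv j σ → Bounded A B σ)
    (htest : ∀ j σ, Inv j σ → j < T → e.eval σ ≠ 0)
    (hend : ∀ σ, Inv T σ → e.eval σ = 0)
    (hbody : ∀ j σ, Inv j σ → j < T → ∃ τ, Runs A B W p σ (w j) s τ ∧ Inv (j + 1) τ)
    {σ : Store} (h0 : Inv 0 σ) :
    ∃ τ, Runs A B W (.loop e p) σ ((List.range T).flatMap w) (T * (s + 1) + 1) τ ∧ Inv T τ := by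
  have main : ∀ m j σ, j + m = T → Inv j σ →
      ∃ τ, Runs A B W (.loop e p) σ ((List.range' j m).flatMap w) (m * (s + 1) + 1) τ ∧
        Inv T τ := by
    intro m
    induction m with
    | zero =>
      intro j σ hj hσ
      obtain rfl : j = T := by omega
      exact ⟨σ, by simpa using loop_done hB (hbdd _ _ hσ) hW (hend _ hσ), hσ⟩
    | succ m ih =>
      intro j σ hj hσ
      obtain ⟨σ', hrun, hσ'⟩ := hbody j σ hσ (by omega)
      obtain ⟨τ, hrun', hτ⟩ := ih (j + 1) σ' (by omega) hσ'
      refine ⟨τ, ?_, hτ⟩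
      rw [List.range'_succ, List.flatMap_cons]
      refine (loop_step hB (hbdd _ _ hσ) hW (htest _ _ hσ (by omega)) hrun hrun').mono ?_
      rw [add_mul]
      omega
  have := main T 0 σ (by omega) h0
  rwa [← List.range_eq_range'] at this

end Runs

/-! #### Derived expressions -/

namespace Expr

/-- The number in cell `0` of an array. -/
def var (a : ℕ) : Expr := .read a (.const 0)

/-- The remainder. -/
def mod (e₁ e₂ : Expr) : Expr := .sub e₁ (.mul (.div e₁ e₂) e₂)

/-- The sign: `0` for zero and `1` for other numbers. -/
def sign (e : Expr) : Expr := .sub (.const 1) (.sub (.const 1) e)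

/-- The equality test. -/
def eq (e₁ e₂ : Expr) : Expr := .sub (.const 1) (.add (.sub e₁ e₂) (.sub e₂ e₁))

/-- A finite sum. -/
def sum (d : ℕ) (f : ℕ → Expr) : Expr :=
  match d with
  | 0 => .const 0
  | d + 1 => .add (sum d f) (f d)

/-- The value of a finite table. -/
def table (d : ℕ) (φ : ℕ → ℕ → ℕ) (e₁ e₂ : Expr) : Expr :=
  sum d fun x => sum d fun y => .mul (.mul (eq e₁ (.const x)) (eq e₂ (.const y))) (.const (φ x y))

variable (σ : Store)

@[simp] theorem eval_var (a : ℕ) : (var a).eval σ = σ (a, 0) := rfl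

@[simp] theorem eval_mod (e₁ e₂ : Expr) : (mod e₁ e₂).eval σ = e₁.eval σ % e₂.eval σ := by
  change e₁.eval σ - e₁.eval σ / e₂.eval σ * e₂.eval σ = _
  have := Nat.mod_add_div' (e₁.eval σ) (e₂.eval σ)
  omega

@[simp] theorem eval_sign (e : Expr) :
    (sign e).eval σ = if e.eval σ = 0 then 0 else 1 := by
  change 1 - (1 - e.eval σ) = _
  split_ifs <;> omega

@[simp] theorem eval_eq (e₁ e₂ : Expr) :
    (eq e₁ e₂).eval σ = if e₁.eval σ = e₂.eval σ then 1 else 0 := by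
  change 1 - (e₁.eval σ - e₂.eval σ + (e₂.eval σ - e₁.eval σ)) = _
  split_ifs <;> omega

@[simp] theorem eval_sum (d : ℕ) (f : ℕ → Expr) :
    (sum d f).eval σ = ∑ x ∈ Finset.range d, (f x).eval σ := by
  induction d with
  | zero => rfl
  | succ d ih => rw [Finset.sum_range_succ, ← ih]; rfl

theorem eval_table {d : ℕ} (φ : ℕ → ℕ → ℕ) {e₁ e₂ : Expr} (h₁ : e₁.eval σ < d)
    (h₂ : e₂.eval σ < d) : (table d φ e₁ e₂).eval σ = φ (e₁.eval σ) (e₂.eval σ) := by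
  simp only [table, eval_sum, eval, eval_eq]
  rw [Finset.sum_eq_single (e₁.eval σ)]
  · rw [Finset.sum_eq_single (e₂.eval σ)]
    · simp
    · intro y _ hy
      simp [hy.symm]
    · intro h
      exact absurd (Finset.mem_range.2 h₂) h
  · intro x _ hx
    simp [hx.symm]
  · intro h
    exact absurd (Finset.mem_range.2 h₁) h

end Expr

end RAM

/-! ### Path consistency by repeated sweeps -/

/-- A decreasing process that sweeps periodically over `ρ` rules has reached a common fixed point
of the rules after sufficiently many sweeps. -/
theorem fixed_of_sweeps (X : ℕ → Finset ℕ) (F : ℕ → Finset ℕ → Finset ℕ) (ρ : ℕ)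
    (hX : ∀ j, X (j + 1) = F (j % ρ) (X j)) (hF : ∀ i s, F i s ⊆ s) {T : ℕ}
    (hT : ((X 0).card + 1) * ρ ≤ T) {r : ℕ} (hr : r < ρ) : F r (X T) = X T := by
  have anti : Antitone X := antitone_nat_of_succ_le fun j => by rw [hX]; exact hF _ _
  obtain ⟨i, hi, hrepeat⟩ : ∃ i ≤ (X 0).card, X ((i + 1) * ρ) = X (i * ρ) := by
    by_contra! hcon
    have : ∀ i ≤ (X 0).card + 1, (X (i * ρ)).card + i ≤ (X 0).card := by
      intro i
      induction i with
      | zero => simp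
      | succ i ih =>
        intro hi
        have h1 := ih (by omega)
        have hle : X ((i + 1) * ρ) ⊆ X (i * ρ) := anti (Nat.mul_le_mul_right _ (by omega))
        have := Finset.card_lt_card (hle.ssubset_of_ne (hcon i (by omega)))
        omega
    have := this _ le_rfl
    omega
  have hconst : ∀ r ≤ ρ, X (i * ρ + r) = X (i * ρ) := by
    intro r hr
    refine le_antisymm (anti (by omega)) ?_
    rw [← hrepeat]
    exact anti (by rw [add_mul]; omega)
  have hfix : ∀ r < ρ, F r (X (i * ρ)) = X (i * ρ) := by
    intro r hr
    have := hX (i * ρ + r)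
    rw [add_assoc, hconst (r + 1) hr, hconst r hr.le, Nat.mul_add_mod', Nat.mod_eq_of_lt hr] at this
    exact this.symm
  have hall : ∀ j, X (i * ρ + j) = X (i * ρ) := by
    intro j
    induction j with
    | zero => rfl
    | succ j ih =>
      rw [← add_assoc, hX, ih]
      exact hfix _ (Nat.mod_lt _ (by omega))
  have hle : i * ρ ≤ T := (Nat.mul_le_mul_right _ (by omega)).trans hT
  rw [show T = i * ρ + (T - i * ρ) by omega, hall]
  exact hfix r hr

namespace OddCycle

/-- The number of quadruples `(u, v, a, b)` with `u, v < n` and `a, b < d`. -/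
def pairCount (n d : ℕ) : ℕ := d * (d * (n * n))

/-- The code of a quadruple. -/
def pairIdx (n d u v a b : ℕ) : ℕ := a + d * (b + d * (u + n * v))

section code

variable {n d u v a b : ℕ}

theorem add_mul_lt {x m y l : ℕ} (hx : x < m) (hy : y < l) : x + m * y < m * l := by
  calc x + m * y < m * (y + 1) := by rw [mul_add]; omega
    _ ≤ m * l := Nat.mul_le_mul_left _ hy

theorem pairIdx_lt (hu : u < n) (hv : v < n) (ha : a < d) (hb : b < d) :
    pairIdx n d u v a b < pairCount n d :=
  add_mul_lt ha (add_mul_lt hb (add_mul_lt hu hv))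

theorem pairIdx_mod (ha : a < d) : pairIdx n d u v a b % d = a := by
  rw [pairIdx, Nat.add_mul_mod_self_left, Nat.mod_eq_of_lt ha]

theorem pairIdx_div (ha : a < d) : pairIdx n d u v a b / d = b + d * (u + n * v) := by
  rw [pairIdx, Nat.add_mul_div_left _ _ (by omega), Nat.div_eq_of_lt ha, zero_add]

theorem pairIdx_div_mod (ha : a < d) (hb : b < d) : pairIdx n d u v a b / d % d = b := by
  rw [pairIdx_div ha, Nat.add_mul_mod_self_left, Nat.mod_eq_of_lt hb]

theorem pairIdx_div_div (ha : a < d) (hb : b < d) : pairIdx n d u v a b / d / d = u + n * v := by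
  rw [pairIdx_div ha, Nat.add_mul_div_left _ _ (by omega), Nat.div_eq_of_lt hb, zero_add]

theorem pairIdx_fst (hu : u < n) (ha : a < d) (hb : b < d) :
    pairIdx n d u v a b / d / d % n = u := by
  rw [pairIdx_div_div ha hb, Nat.add_mul_mod_self_left, Nat.mod_eq_of_lt hu]

theorem pairIdx_snd (hu : u < n) (ha : a < d) (hb : b < d) :
    pairIdx n d u v a b / d / d / n = v := by
  rw [pairIdx_div_div ha hb, Nat.add_mul_div_left _ _ (by omega), Nat.div_eq_of_lt hu, zero_add]

theorem snd_lt {q : ℕ} (hq : q < pairCount n d) : q / d / d / n < n := by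
  rw [Nat.div_div_eq_div_mul, Nat.div_div_eq_div_mul]
  refine Nat.div_lt_of_lt_mul ?_
  unfold pairCount at hq
  calc q < _ := hq
    _ = _ := by ring

end code

/-- The pair of values coded by `q` extends to the variable `w`. -/
def Supported (n d : ℕ) (X : Finset ℕ) (q w : ℕ) : Prop :=
  ∃ c < d, pairIdx n d (q / d / d % n) w (q % d) c ∈ X ∧
    pairIdx n d (q / d / d / n) w (q / d % d) c ∈ X

open Classical in
/-- One step of the path consistency procedure. -/
def pcStep (n d j : ℕ) (X : Finset ℕ) : Finset ℕ :=
  X.filter fun q => q = j % pairCount n d → Supported n d X q (j / pairCount n d % n)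

/-- The path consistency procedure after `j` steps. -/
def pcSeq (n d : ℕ) (X : Finset ℕ) : ℕ → Finset ℕ
  | 0 => X
  | j + 1 => pcStep n d j (pcSeq n d X j)

/-- A sufficient number of steps. -/
def pcTime (n d : ℕ) : ℕ := (pairCount n d + 1) * (pairCount n d * n)

theorem pcStep_subset (n d j : ℕ) (X : Finset ℕ) : pcStep n d j X ⊆ X := by
  classical
  exact Finset.filter_subset _ _

theorem mem_pcStep_iff {n d j : ℕ} {X : Finset ℕ} {q : ℕ} : q ∈ pcStep n d j X ↔
    q ∈ X ∧ (q = j % pairCount n d → Supported n d X q (j / pairCount n d % n)) := by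
  classical
  exact Finset.mem_filter

theorem pcStep_mod (n d j : ℕ) (X : Finset ℕ) :
    pcStep n d (j % (pairCount n d * n)) X = pcStep n d j X := by
  unfold pcStep
  rw [Nat.mod_mul_right_mod, Nat.mod_mul_right_div_self, Nat.mod_mod]

theorem pcSeq_subset (n d : ℕ) (X : Finset ℕ) (j : ℕ) : pcSeq n d X j ⊆ X := by
  induction j with
  | zero => exact subset_rfl
  | succ j ih => exact (pcStep_subset _ _ _ _).trans ih

theorem supported_pcSeq {n d : ℕ} {X : Finset ℕ} (hX : X ⊆ Finset.range (pairCount n d)) {q w : ℕ}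
    (hq : q ∈ pcSeq n d X (pcTime n d)) (hw : w < n) :
    Supported n d (pcSeq n d X (pcTime n d)) q w := by
  classical
  have hqX := Finset.mem_range.1 (hX (pcSeq_subset _ _ _ _ hq))
  have hr : q + pairCount n d * w < pairCount n d * n := add_mul_lt hqX hw
  have hcard : X.card ≤ pairCount n d := (Finset.card_le_card hX).trans (by simp)
  have := fixed_of_sweeps (pcSeq n d X) (pcStep n d) (pairCount n d * n)
    (fun j => (pcStep_mod n d j _).symm) (pcStep_subset n d)
    (T := pcTime n d) (Nat.mul_le_mul_right _ (by simpa [pcSeq] using hcard)) hr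
  rw [← this] at hq
  have h := (mem_pcStep_iff.1 hq).2
  rw [Nat.add_mul_mod_self_left, Nat.mod_eq_of_lt hqX,
    Nat.add_mul_div_left _ _ (by omega), Nat.div_eq_of_lt hqX, zero_add, Nat.mod_eq_of_lt hw] at h
  exact h rfl

/-- The list chosen by a random residue. -/
def listOfResidue (x : ℕ) : Fin 3 := if x = 0 then 1 else if x = 1 then 2 else 0

/-- The condition for a pair of values to be allowed initially. -/
def InitAllowed (k n : ℕ) (adj res : ℕ → ℕ) (q : ℕ) : Prop :=
  natList (listOfResidue (res (q / (2 * k + 1) / (2 * k + 1) % n))) (q % (2 * k + 1)) ∧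
  natList (listOfResidue (res (q / (2 * k + 1) / (2 * k + 1) / n))) (q / (2 * k + 1) % (2 * k + 1)) ∧
  (q / (2 * k + 1) / (2 * k + 1) % n = q / (2 * k + 1) / (2 * k + 1) / n →
    q % (2 * k + 1) = q / (2 * k + 1) % (2 * k + 1)) ∧
  (adj (q / (2 * k + 1) / (2 * k + 1) % n * n + q / (2 * k + 1) / (2 * k + 1) / n) ≠ 0 →
    NatAdj k (q % (2 * k + 1)) (q / (2 * k + 1) % (2 * k + 1)))

open Classical in
/-- The pairs of values allowed initially. -/
def initPairs (k n : ℕ) (adj res : ℕ → ℕ) : Finset ℕ :=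
  (Finset.range (pairCount n (2 * k + 1))).filter (InitAllowed k n adj res)

theorem mem_initPairs {k n : ℕ} {adj res : ℕ → ℕ} {q : ℕ} : q ∈ initPairs k n adj res ↔
    q < pairCount n (2 * k + 1) ∧ InitAllowed k n adj res q := by
  classical
  simp [initPairs]

theorem initPairs_subset (k n : ℕ) (adj res : ℕ → ℕ) :
    initPairs k n adj res ⊆ Finset.range (pairCount n (2 * k + 1)) :=
  fun _ hq => Finset.mem_range.2 (mem_initPairs.1 hq).1

section correctness

variable {k n : ℕ} {G : SimpleGraph (Fin n)} {adj res : ℕ → ℕ}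

theorem mem_initPairs_iff (hk : 1 ≤ k)
    (hadj : ∀ u v : Fin n, adj (u * n + v) ≠ 0 ↔ G.Adj u v)
    (u v : Fin n) (a b : Fin (2 * k + 1)) :
    pairIdx n (2 * k + 1) u v a b ∈ initPairs k n adj res ↔
      Allowed k G (fun v => listOfResidue (res v)) u v a b ∧ (u = v → a = b) := by
  classical
  unfold Allowed
  rw [mem_initPairs, InitAllowed, pairIdx_mod a.2, pairIdx_div_mod a.2 b.2,
    pairIdx_fst u.2 a.2 b.2, pairIdx_snd u.2 a.2 b.2, hadj, mem_listSet_iff, mem_listSet_iff,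
    cycle_adj_iff hk, Fin.val_inj, Fin.val_inj]
  have := pairIdx_lt u.2 v.2 a.2 b.2
  tauto

theorem pathConsistent_pcSeq (hk : 1 ≤ k)
    (hadj : ∀ u v : Fin n, adj (u * n + v) ≠ 0 ↔ G.Adj u v) :
    PathConsistent fun (u v : Fin n) (a b : Fin (2 * k + 1)) =>
      pairIdx n (2 * k + 1) u v a b ∈
        pcSeq n (2 * k + 1) (initPairs k n adj res) (pcTime n (2 * k + 1)) where
  diag u a b h := ((mem_initPairs_iff hk hadj u u a b).1 (pcSeq_subset _ _ _ _ h)).2 rfl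
  extend u v a b h w := by
    obtain ⟨c, hc, h₁, h₂⟩ := supported_pcSeq (initPairs_subset _ _ _ _) h w.2
    rw [pairIdx_mod a.2, pairIdx_fst u.2 a.2 b.2] at h₁
    rw [pairIdx_div_mod a.2 b.2, pairIdx_snd u.2 a.2 b.2] at h₂
    exact ⟨⟨c, hc⟩, h₁, h₂⟩

theorem mem_pcSeq_of_hom (hk : 1 ≤ k)
    (hadj : ∀ u v : Fin n, adj (u * n + v) ≠ 0 ↔ G.Adj u v) (g : G →g cycle k)
    (hg : ∀ v : Fin n, g v ∈ listSet k (listOfResidue (res v))) (j : ℕ) (u v : Fin n) :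
    pairIdx n (2 * k + 1) u v (g u) (g v) ∈ pcSeq n (2 * k + 1) (initPairs k n adj res) j := by
  classical
  induction j generalizing u v with
  | zero =>
    exact (mem_initPairs_iff hk hadj u v (g u) (g v)).2
      ⟨⟨hg u, hg v, fun h => g.map_adj h⟩, fun h => h ▸ rfl⟩
  | succ j ih =>
    refine mem_pcStep_iff.2 ⟨ih u v, fun _ => ?_⟩
    have hw : j / pairCount n (2 * k + 1) % n < n := Nat.mod_lt _ (by have := u.2; omega)
    refine ⟨g ⟨_, hw⟩, (g ⟨_, hw⟩).2, ?_, ?_⟩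
    · rw [pairIdx_mod (g u).2, pairIdx_fst u.2 (g u).2 (g v).2]
      exact ih u ⟨_, hw⟩
    · rw [pairIdx_div_mod (g u).2 (g v).2, pairIdx_snd u.2 (g u).2 (g v).2]
      exact ih v ⟨_, hw⟩

/-- The path consistency procedure decides the list homomorphism problem. -/
theorem pcSeq_correct (hk : 1 ≤ k)
    (hadj : ∀ u v : Fin n, adj (u * n + v) ≠ 0 ↔ G.Adj u v) :
    (n = 0 ∨ ∃ a < 2 * k + 1, pairIdx n (2 * k + 1) 0 0 a a ∈
      pcSeq n (2 * k + 1) (initPairs k n adj res) (pcTime n (2 * k + 1))) ↔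
    HasListHom k G (fun v => listOfResidue (res v)) := by
  rcases Nat.eq_zero_or_pos n with rfl | hn
  · simp only [true_or, true_iff]
    exact ⟨⟨fun v => v.elim0, fun {u} => u.elim0⟩, fun v => v.elim0⟩
  · simp only [hn.ne', false_or]
    constructor
    · rintro ⟨a, ha, h⟩
      have hP := pathConsistent_pcSeq (res := res) hk hadj
      refine hasListHom_of_pathConsistent G _ hk hP (fun v => ?_)
        (fun u v a b h => ((mem_initPairs_iff hk hadj u v a b).1 (pcSeq_subset _ _ _ _ h)).1)
      obtain ⟨c, h₁, -⟩ := hP.extend ⟨0, hn⟩ ⟨0, hn⟩ ⟨a, ha⟩ ⟨a, ha⟩ h v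
      exact ⟨c, hP.self_right h₁⟩
    · rintro ⟨g, hg⟩
      exact ⟨g ⟨0, hn⟩, (g ⟨0, hn⟩).2, mem_pcSeq_of_hom hk hadj g hg _ ⟨0, hn⟩ ⟨0, hn⟩⟩

end correctness

end OddCycle

/-! ### The program -/

namespace RAM

theorem Store.update_apply (σ : Store) (a i v a' i' : ℕ) :
    (σ.update (a, i) v) (a', i') = if a' = a ∧ i' = i then v else σ (a', i') := by
  classical
  rw [Finsupp.coe_update, Function.update_apply]
  exact if_congr Prod.mk_inj rfl rfl

/-- The two memories agree outside the given arrays. -/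
def AgreeOff (mods : List ℕ) (σ τ : Store) : Prop := ∀ a i, a ∉ mods → τ (a, i) = σ (a, i)

theorem AgreeOff.refl (mods : List ℕ) (σ : Store) : AgreeOff mods σ σ := fun _ _ _ => rfl

theorem AgreeOff.trans {mods : List ℕ} {σ τ υ : Store} (h : AgreeOff mods σ τ)
    (h' : AgreeOff mods τ υ) : AgreeOff mods σ υ :=
  fun a i ha => (h' a i ha).trans (h a i ha)

theorem AgreeOff.mono {mods mods' : List ℕ} {σ τ : Store} (h : AgreeOff mods σ τ)
    (hm : mods ⊆ mods') : AgreeOff mods' σ τ :=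
  fun a i ha => h a i fun h' => ha (hm h')

theorem AgreeOff.update {mods : List ℕ} {σ τ : Store} (h : AgreeOff mods σ τ) {a : ℕ}
    (ha : a ∈ mods) (i v : ℕ) : AgreeOff mods σ (τ.update (a, i) v) := by
  intro b j hb
  rw [Store.update_apply, if_neg (fun e : b = a ∧ j = i => hb (e.1 ▸ ha)), h b j hb]

/-- A loop with counter in array `3`. -/
def Prog.forLoop (bound : Expr) (body : Prog) : Prog :=
  .seq (.write 3 (.const 0) (.const 0))
    (.loop (.sub bound (.var 3)) (.seq body (.write 3 (.const 0) (.add (.var 3) (.const 1)))))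

theorem Runs.forLoop {A B W : ℕ} {bound : Expr} {body : Prog} (hA : 0 < A) (hB : 1 ≤ B)
    (hW : (Prog.forLoop bound body).weight ≤ W) {mods : List ℕ} (h3 : 3 ∈ mods) {σ : Store}
    (hσ : Bounded A B σ) (Inv : ℕ → Store → Prop) (T s : ℕ) (w : ℕ → List Bool) (hT : T ≤ B)
    (hbound : ∀ τ, AgreeOff mods σ τ → bound.eval τ = T)
    (hInv : ∀ j τ v, Inv j τ → Inv j (τ.update (3, 0) v))
    (hbody : ∀ j τ, j < T → Bounded A B τ → τ (3, 0) = j → AgreeOff mods σ τ → Inv j τ →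
      ∃ τ', Runs A B W body τ (w j) s τ' ∧ Bounded A B τ' ∧ τ' (3, 0) = j ∧
        AgreeOff mods σ τ' ∧ Inv (j + 1) τ')
    (h0 : Inv 0 σ) :
    ∃ τ, Runs A B W (.forLoop bound body) σ ((List.range T).flatMap w) (T * (s + 2) + 2) τ ∧
      Bounded A B τ ∧ AgreeOff mods σ τ ∧ Inv T τ := by
  simp only [Prog.forLoop, Prog.weight] at hW
  have hstart : Runs A B W (.write 3 (.const 0) (.const 0)) σ [] 1 (σ.update (3, 0) 0) :=
    Runs.write hB hσ (by simp only [Prog.weight]; omega)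
  obtain ⟨τ, hrun, ⟨hb, hj, ha, hi⟩⟩ := Runs.loop (A := A) (B := B) (W := W)
    (e := .sub bound (.var 3))
    (p := .seq body (.write 3 (.const 0) (.add (.var 3) (.const 1)))) hB
    (by simp only [Prog.weight]; omega)
    (fun j τ => Bounded A B τ ∧ τ (3, 0) = j ∧ AgreeOff mods σ τ ∧ Inv j τ) T (s + 1) w
    (fun j τ h => h.1)
    (fun j τ h hj => by
      simp only [Expr.eval, Expr.eval_var, hbound τ h.2.2.1, h.2.1]
      omega)
    (fun τ h => by
      simp only [Expr.eval, Expr.eval_var, hbound τ h.2.2.1, h.2.1]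
      omega)
    (fun j τ h hj => by
      obtain ⟨τ', hr, hb', hj', ha', hi'⟩ := hbody j τ hj h.1 h.2.1 h.2.2.1 h.2.2.2
      have hw : Runs A B W (.write 3 (.const 0) (.add (.var 3) (.const 1))) τ' [] 1
          (τ'.update (3, 0) (τ' (3, 0) + 1)) :=
        Runs.write hB hb' (by simp only [Prog.weight]; omega)
      rw [hj'] at hw
      refine ⟨_, by simpa using hr.seq hw, ?_, ?_, ?_, ?_⟩
      · exact hb'.update (by omega) hA ((size_le_self _).trans (by omega))
      · rw [Store.update_apply, if_pos ⟨rfl, rfl⟩]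
      · exact ha'.update h3 _ _
      · exact hInv _ _ _ hi')
    (σ := σ.update (3, 0) 0)
    ⟨hσ.update (by omega) hA (by simp), by rw [Store.update_apply, if_pos ⟨rfl, rfl⟩],
      (AgreeOff.refl _ _).update h3 _ _, hInv _ _ _ h0⟩
  refine ⟨τ, ?_, hb, ha, hi⟩
  have := hstart.seq hrun
  rw [List.nil_append] at this
  exact this.mono (by rw [show s + 1 + 1 = s + 2 by ring]; omega)

end RAM

namespace OddCycle

open RAM

/-- The number of coin flips for the list of one vertex. -/
def flipCount (k n : ℕ) : ℕ := n + (2 * k + 2)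

/-- The residue modulo `d` of the binary number formed by the first `b` bits. -/
def residue (d : ℕ) (bits : ℕ → Bool) : ℕ → ℕ
  | 0 => 0
  | b + 1 => (2 * residue d bits b + (bits b).toNat) % d

theorem residue_lt {d : ℕ} (hd : 0 < d) (bits : ℕ → Bool) (b : ℕ) : residue d bits b < d := by
  cases b with
  | zero => exact hd
  | succ b => exact Nat.mod_lt _ hd

/-- Conditions on the bounds for addresses and bit lengths. -/
structure Fits (k n A B : ℕ) : Prop where
  pos : 0 < A
  vertex : n ≤ A
  pair : pairCount n (2 * k + 1) ≤ A
  one_le : 1 ≤ B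
  base : 2 * k + 1 ≤ B
  flips : n * flipCount k n ≤ B
  pair' : pairCount n (2 * k + 1) ≤ B
  time : pcTime n (2 * k + 1) ≤ B

section pieces

/-- The number of coin flips for the list of one vertex, as an expression. -/
def flipE (k : ℕ) : Expr := .add (.var 0) (.const (2 * k + 2))

/-- The random choice of the lists. -/
def sampleProg (k : ℕ) : Prog :=
  .forLoop (.mul (.var 0) (flipE k))
    (.seq (.flip 7)
      (.write 8 (.div (.var 3) (flipE k))
        (.mod (.add (.mul (.mul (.const 2) (.read 8 (.div (.var 3) (flipE k))))
          (.sign (.mod (.var 3) (flipE k)))) (.var 7)) (.const (2 * k + 1)))))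

variable {k n A B W : ℕ}

theorem runs_sampleProg (hf : Fits k n A B) (hW : (sampleProg k).weight ≤ W) {σ : Store}
    (hσ : Bounded A B σ) (hn : σ (0, 0) = n) (bits : ℕ → Bool) :
    ∃ τ, Runs A B W (sampleProg k) σ ((List.range (n * flipCount k n)).map bits)
        (n * flipCount k n * 4 + 2) τ ∧ Bounded A B τ ∧ AgreeOff [3, 7, 8] σ τ ∧
      ∀ v < n, τ (8, v) = residue (2 * k + 1) (fun b => bits (v * flipCount k n + b))
        (flipCount k n) := by
  set r := flipCount k n with hr
  have hr0 : 0 < r := by unfold flipCount at hr; omega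
  have hevr : ∀ τ : Store, τ (0, 0) = n → (flipE k).eval τ = r := fun τ h => by
    simp only [flipE, Expr.eval, Expr.eval_var, h, hr, flipCount]
  have hW' := hW
  simp only [sampleProg, Prog.forLoop, Prog.weight] at hW'
  obtain ⟨τ, hrun, hb, ha, hi⟩ := Runs.forLoop (A := A) (B := B) (W := W) hf.pos hf.one_le hW
    (mods := [3, 7, 8]) (by simp) hσ
    (fun j τ => ∀ v b, 0 < b → b ≤ r → v * r + b ≤ j → (b = r ∨ v * r + b = j) →
      τ (8, v) = residue (2 * k + 1) (fun b => bits (v * r + b)) b)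
    (n * r) 2 (fun j => [bits j]) hf.flips
    (fun τ hτ => by
      have h0 : τ (0, 0) = n := (hτ 0 0 (by simp)).trans hn
      simp only [Expr.eval, Expr.eval_var, hevr τ h0, h0])
    (fun j τ v h u b => by
      rw [Store.update_apply, if_neg (by omega)]
      exact h u b)
    (fun j τ hj hbd h3 hag hinv => by
      have h0 : τ (0, 0) = n := (hag 0 0 (by simp)).trans hn
      have hjr : j / r < n := Nat.div_lt_of_lt_mul (by rwa [mul_comm])
      have hb1 : Bounded A B (τ.update (7, 0) (bits j).toNat) :=
        hbd.update (by omega) hf.pos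
          ((size_le_self _).trans ((Bool.toNat_le _).trans hf.one_le))
      have h01 : (τ.update (7, 0) (bits j).toNat) (0, 0) = n := by
        rw [Store.update_apply, if_neg (by omega), h0]
      have h31 : (τ.update (7, 0) (bits j).toNat) (3, 0) = j := by
        rw [Store.update_apply, if_neg (by omega), h3]
      have h7 : (τ.update (7, 0) (bits j).toNat) (7, 0) = (bits j).toNat := by
        rw [Store.update_apply, if_pos ⟨rfl, rfl⟩]
      have h8 : (τ.update (7, 0) (bits j).toNat) (8, j / r) = τ (8, j / r) := by
        rw [Store.update_apply, if_neg (by omega)]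
      have hr1 := Runs.flip (A := A) (W := W) (a := 7) (bits j) hf.one_le hbd
        (by simp only [Prog.weight]; omega)
      have hr2 := Runs.write (A := A) (W := W) (a := 8) (i := .div (.var 3) (flipE k))
        (e := .mod (.add (.mul (.mul (.const 2) (.read 8 (.div (.var 3) (flipE k))))
          (.sign (.mod (.var 3) (flipE k)))) (.var 7)) (.const (2 * k + 1))) hf.one_le hb1
        (by simp only [Prog.weight]; omega)
      have hval : (Expr.mod (.add (.mul (.mul (.const 2) (.read 8 (.div (.var 3) (flipE k))))
          (.sign (.mod (.var 3) (flipE k)))) (.var 7)) (.const (2 * k + 1))).eval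
            (τ.update (7, 0) (bits j).toNat) =
          residue (2 * k + 1) (fun b => bits (j / r * r + b)) (j % r + 1) := by
        simp only [Expr.eval_mod, Expr.eval, Expr.eval_var, Expr.eval_sign, hevr _ h01, h31,
          residue]
        rw [h7, h8, Nat.div_add_mod']
        rcases Nat.eq_zero_or_pos (j % r) with h | h
        · simp [h, residue]
        · rw [if_neg h.ne', mul_one, hinv (j / r) (j % r) h (Nat.mod_lt _ hr0).le
            (Nat.div_add_mod' j r).le (.inr (Nat.div_add_mod' j r))]
      have haddr : (Expr.div (.var 3) (flipE k)).eval (τ.update (7, 0) (bits j).toNat) = j / r := by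
        simp only [Expr.eval, Expr.eval_var, hevr _ h01, h31]
      rw [haddr, hval] at hr2
      refine ⟨_, hr1.seq hr2, ?_, ?_, ?_, ?_⟩
      · exact hb1.update (by omega) (by have := hf.vertex; omega)
          ((size_le_self _).trans ((residue_lt (by omega) _ _).le.trans hf.base))
      · rw [Store.update_apply, if_neg (by omega), h31]
      · exact (hag.update (by simp) _ _).update (by simp) _ _
      · intro v b hb0 hbr hvb hor
        have hdm := Nat.div_add_mod' j r
        have hmr := Nat.mod_lt j hr0
        by_cases hv : v = j / r
        · subst hv
          rw [Store.update_apply, if_pos ⟨rfl, rfl⟩]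
          have : b = j % r + 1 := by omega
          rw [this]
        · rw [Store.update_apply, if_neg (by tauto), Store.update_apply, if_neg (by omega)]
          have hlt : v < j / r := by
            refine lt_of_le_of_ne ?_ hv
            by_contra hcon
            have : (j / r + 1) * r ≤ v * r := Nat.mul_le_mul_right _ (by omega)
            rw [add_mul] at this
            omega
          have : (v + 1) * r ≤ j / r * r := Nat.mul_le_mul_right _ hlt
          rw [add_mul] at this
          exact hinv v b hb0 hbr (by omega) (by omega))
    (fun v b hb0 hbr hvb => by omega)
  refine ⟨τ, ?_, hb, ha, fun v hv => ?_⟩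
  · rw [List.map_eq_flatMap]
    exact hrun
  · refine hi v r hr0 le_rfl ?_ (.inl rfl)
    have : (v + 1) * r ≤ n * r := Nat.mul_le_mul_right _ hv
    rwa [add_mul, one_mul] at this

/-- The first value of the pair of values coded by `x`. -/
def fstValE (k : ℕ) (x : Expr) : Expr := .mod x (.const (2 * k + 1))

/-- The second value of the pair of values coded by `x`. -/
def sndValE (k : ℕ) (x : Expr) : Expr := .mod (.div x (.const (2 * k + 1))) (.const (2 * k + 1))

/-- The first variable of the pair of values coded by `x`. -/
def fstVarE (k : ℕ) (x : Expr) : Expr :=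
  .mod (.div (.div x (.const (2 * k + 1))) (.const (2 * k + 1))) (.var 0)

/-- The second variable of the pair of values coded by `x`. -/
def sndVarE (k : ℕ) (x : Expr) : Expr :=
  .div (.div (.div x (.const (2 * k + 1))) (.const (2 * k + 1))) (.var 0)

/-- The number of codes of pairs. -/
def countE (k : ℕ) : Expr :=
  .mul (.const (2 * k + 1)) (.mul (.const (2 * k + 1)) (.mul (.var 0) (.var 0)))

/-- The code of a pair of values. -/
def idxE (k : ℕ) (u v a b : Expr) : Expr :=
  .add a (.mul (.const (2 * k + 1)) (.add b (.mul (.const (2 * k + 1)) (.add u (.mul (.var 0) v)))))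

open Classical in
/-- Membership in the list of a residue as a table. -/
def memTable (x a : ℕ) : ℕ := if natList (listOfResidue x) a then 1 else 0

open Classical in
/-- Adjacency as a table. -/
def adjTable (k a b : ℕ) : ℕ := if NatAdj k a b then 1 else 0

/-- The initial value of the entry for the pair with number `J`. -/
def initE (k : ℕ) : Expr :=
  .mul (.mul (.mul
    (.table (2 * k + 1) memTable (.read 8 (fstVarE k (.var 3))) (fstValE k (.var 3)))
    (.table (2 * k + 1) memTable (.read 8 (sndVarE k (.var 3))) (sndValE k (.var 3))))
    (.sign (.add (.sub (.const 1) (.eq (fstVarE k (.var 3)) (sndVarE k (.var 3))))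
      (.eq (fstValE k (.var 3)) (sndValE k (.var 3))))))
    (.sign (.add (.sub (.const 1) (.read 1 (.add (.mul (fstVarE k (.var 3)) (.var 0))
      (sndVarE k (.var 3)))))
      (.table (2 * k + 1) (adjTable k) (fstValE k (.var 3)) (sndValE k (.var 3)))))

/-- The initialization of the pairs of values. -/
def initProg (k : ℕ) : Prog := .forLoop (countE k) (.write 9 (.var 3) (initE k))

theorem eval_countE {σ : Store} (hn : σ (0, 0) = n) :
    (countE k).eval σ = pairCount n (2 * k + 1) := by
  simp only [countE, Expr.eval, Expr.eval_var, hn, pairCount]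

theorem initAllowed_arith {P Q R : Prop} {u v a b x : ℕ} [Decidable P] [Decidable Q] [Decidable R]
    [Decidable (u = v)] [Decidable (a = b)]
    [Decidable ((1 - if u = v then 1 else 0) + (if a = b then 1 else 0) = 0)]
    [Decidable (1 - x + (if R then 1 else 0) = 0)]
    [Decidable (P ∧ Q ∧ (u = v → a = b) ∧ (x ≠ 0 → R))] :
    (if P then 1 else 0) * (if Q then 1 else 0) *
        (if (1 - if u = v then 1 else 0) + (if a = b then 1 else 0) = 0 then 0 else 1) *
        (if 1 - x + (if R then 1 else 0) = 0 then 0 else 1) =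
      if P ∧ Q ∧ (u = v → a = b) ∧ (x ≠ 0 → R) then 1 else 0 := by
  by_cases h1 : P <;> by_cases h2 : Q <;> by_cases h3 : u = v <;> by_cases h4 : a = b <;>
    by_cases h5 : x = 0 <;> by_cases h6 : R <;> simp [h1, h2, h3, h4, h5, h6] <;> omega

open Classical in
theorem eval_initE {σ : Store} (hn : σ (0, 0) = n) {q : ℕ} (h3 : σ (3, 0) = q)
    (hq : q < pairCount n (2 * k + 1)) (hres : ∀ v < n, σ (8, v) < 2 * k + 1) :
    (initE k).eval σ =
      if InitAllowed k n (fun x => σ (1, x)) (fun v => σ (8, v)) q then 1 else 0 := by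
  have hn0 : 0 < n := by
    rcases Nat.eq_zero_or_pos n with rfl | h
    · simp [pairCount] at hq
    · exact h
  have hd : 0 < 2 * k + 1 := by omega
  have ea : (fstValE k (.var 3)).eval σ = q % (2 * k + 1) := by
    simp [fstValE, Expr.eval, h3]
  have eb : (sndValE k (.var 3)).eval σ = q / (2 * k + 1) % (2 * k + 1) := by
    simp [sndValE, Expr.eval, h3]
  have eu : (fstVarE k (.var 3)).eval σ = q / (2 * k + 1) / (2 * k + 1) % n := by
    simp [fstVarE, Expr.eval, h3, hn]
  have ev : (sndVarE k (.var 3)).eval σ = q / (2 * k + 1) / (2 * k + 1) / n := by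
    simp [sndVarE, Expr.eval, h3, hn]
  have t1 : (Expr.table (2 * k + 1) memTable (.read 8 (fstVarE k (.var 3)))
      (fstValE k (.var 3))).eval σ = memTable (σ (8, q / (2 * k + 1) / (2 * k + 1) % n))
        (q % (2 * k + 1)) := by
    rw [Expr.eval_table]
    · rw [ea, Expr.eval, eu]
    · rw [Expr.eval, eu]
      exact hres _ (Nat.mod_lt _ hn0)
    · rw [ea]
      exact Nat.mod_lt _ hd
  have t2 : (Expr.table (2 * k + 1) memTable (.read 8 (sndVarE k (.var 3)))
      (sndValE k (.var 3))).eval σ = memTable (σ (8, q / (2 * k + 1) / (2 * k + 1) / n))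
        (q / (2 * k + 1) % (2 * k + 1)) := by
    rw [Expr.eval_table]
    · rw [eb, Expr.eval, ev]
    · rw [Expr.eval, ev]
      exact hres _ (snd_lt hq)
    · rw [eb]
      exact Nat.mod_lt _ hd
  have t3 : (Expr.table (2 * k + 1) (adjTable k) (fstValE k (.var 3))
      (sndValE k (.var 3))).eval σ = adjTable k (q % (2 * k + 1))
        (q / (2 * k + 1) % (2 * k + 1)) := by
    rw [Expr.eval_table]
    · rw [ea, eb]
    · rw [ea]
      exact Nat.mod_lt _ hd
    · rw [eb]
      exact Nat.mod_lt _ hd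
  simp only [initE, Expr.eval, Expr.eval_sign, Expr.eval_eq, Expr.eval_var, t1, t2, t3, ea, eb, eu,
    ev, hn, memTable, adjTable]
  exact Eq.trans initAllowed_arith (if_congr Iff.rfl rfl rfl)

open Classical in
theorem runs_initProg (hf : Fits k n A B) (hW : (initProg k).weight ≤ W) {σ : Store}
    (hσ : Bounded A B σ) (hn : σ (0, 0) = n) (hres : ∀ v < n, σ (8, v) < 2 * k + 1) :
    ∃ τ, Runs A B W (initProg k) σ [] (pairCount n (2 * k + 1) * 3 + 2) τ ∧ Bounded A B τ ∧
      AgreeOff [3, 9] σ τ ∧ ∀ q < pairCount n (2 * k + 1), τ (9, q) =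
        if q ∈ initPairs k n (fun x => σ (1, x)) (fun v => σ (8, v)) then 1 else 0 := by
  have hW' := hW
  simp only [initProg, Prog.forLoop, Prog.weight] at hW'
  obtain ⟨τ, hrun, hb, ha, hi⟩ := Runs.forLoop (A := A) (B := B) (W := W) hf.pos hf.one_le hW
    (mods := [3, 9]) (by simp) hσ
    (fun j τ => ∀ q < j, τ (9, q) =
      if InitAllowed k n (fun x => σ (1, x)) (fun v => σ (8, v)) q then 1 else 0)
    (pairCount n (2 * k + 1)) 1 (fun _ => []) hf.pair'
    (fun τ hτ => eval_countE ((hτ 0 0 (by simp)).trans hn))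
    (fun j τ v h q => by
      rw [Store.update_apply, if_neg (by omega)]
      exact h q)
    (fun j τ hj hbd h3 hag hinv => by
      have h0 : τ (0, 0) = n := (hag 0 0 (by simp)).trans hn
      have h1 : (fun x => τ (1, x)) = fun x => σ (1, x) := funext fun x => hag 1 x (by simp)
      have h8 : (fun x => τ (8, x)) = fun x => σ (8, x) := funext fun x => hag 8 x (by simp)
      have hr := Runs.write (A := A) (W := W) (a := 9) (i := .var 3) (e := initE k) hf.one_le hbd
        (by simp only [Prog.weight]; omega)
      rw [eval_initE h0 h3 hj (fun v hv => (congrFun h8 v).trans_lt (hres v hv)), Expr.eval_var,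
        h3, h1, h8] at hr
      refine ⟨_, hr, ?_, ?_, ?_, ?_⟩
      · refine hbd.update (by omega) (hj.trans_le hf.pair) ((size_le_self _).trans ?_)
        have := hf.one_le
        split_ifs <;> omega
      · rw [Store.update_apply, if_neg (by omega), h3]
      · exact hag.update (by simp) _ _
      · intro q hq
        rw [Store.update_apply]
        by_cases hqj : q = j
        · subst hqj
          rw [if_pos ⟨rfl, rfl⟩]
        · rw [if_neg (by tauto)]
          exact hinv q (by omega))
    (fun q hq => by omega)
  rw [List.flatMap_eq_nil_iff.2 (fun _ _ => rfl)] at hrun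
  refine ⟨τ, hrun, hb, ha, fun q hq => ?_⟩
  rw [hi q hq]
  exact if_congr (by rw [mem_initPairs]; tauto) rfl rfl

/-- The code of the pair treated in step `J` of the path consistency procedure. -/
def curE (k : ℕ) : Expr := .mod (.var 3) (countE k)

/-- The third variable in step `J` of the path consistency procedure. -/
def thirdE (k : ℕ) : Expr := .mod (.div (.var 3) (countE k)) (.var 0)

/-- The new value of the current entry. -/
def pcE (k : ℕ) : Expr :=
  .mul (.read 9 (curE k)) (.sign (.sum (2 * k + 1) fun c =>
    .mul (.read 9 (idxE k (fstVarE k (curE k)) (thirdE k) (fstValE k (curE k)) (.const c)))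
      (.read 9 (idxE k (sndVarE k (curE k)) (thirdE k) (sndValE k (curE k)) (.const c)))))

/-- The path consistency procedure. -/
def pcProg (k : ℕ) : Prog :=
  .forLoop (.mul (.add (countE k) (.const 1)) (.mul (countE k) (.var 0)))
    (.write 9 (curE k) (pcE k))

theorem eval_curE {σ : Store} (hn : σ (0, 0) = n) {j : ℕ} (h3 : σ (3, 0) = j) :
    (curE k).eval σ = j % pairCount n (2 * k + 1) := by
  rw [curE, Expr.eval_mod, eval_countE hn, Expr.eval_var, h3]

open Classical in
theorem eval_pcE {σ : Store} (hn : σ (0, 0) = n) {j : ℕ} (h3 : σ (3, 0) = j)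
    {X : Finset ℕ} (hX : ∀ q < pairCount n (2 * k + 1), σ (9, q) = if q ∈ X then 1 else 0)
    (hQ : 0 < pairCount n (2 * k + 1)) :
    (pcE k).eval σ =
      if j % pairCount n (2 * k + 1) ∈ pcStep n (2 * k + 1) j X then 1 else 0 := by
  have hn0 : 0 < n := by
    rcases Nat.eq_zero_or_pos n with rfl | h
    · simp [pairCount] at hQ
    · exact h
  have hd : 0 < 2 * k + 1 := by omega
  have hcur := eval_curE (k := k) hn h3
  have hthird : (thirdE k).eval σ = j / pairCount n (2 * k + 1) % n := by
    simp only [thirdE, Expr.eval_mod, Expr.eval, eval_countE hn, Expr.eval_var, h3, hn]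
  have hqlt : j % pairCount n (2 * k + 1) < pairCount n (2 * k + 1) := Nat.mod_lt _ hQ
  have hwlt : j / pairCount n (2 * k + 1) % n < n := Nat.mod_lt _ hn0
  simp only [pcE, Expr.eval, Expr.eval_sign, Expr.eval_sum, idxE, fstVarE, sndVarE, fstValE,
    sndValE, Expr.eval_mod, Expr.eval_var, hcur, hthird, hn]
  rw [hX _ hqlt]
  refine Eq.trans ?_ (if_congr mem_pcStep_iff.symm rfl rfl)
  have hsum : ∀ q w, q < pairCount n (2 * k + 1) → w < n → ((∑ c ∈ Finset.range (2 * k + 1),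
      σ (9, q % (2 * k + 1) + (2 * k + 1) * (c + (2 * k + 1) *
        (q / (2 * k + 1) / (2 * k + 1) % n + n * w))) *
      σ (9, q / (2 * k + 1) % (2 * k + 1) + (2 * k + 1) * (c + (2 * k + 1) *
        (q / (2 * k + 1) / (2 * k + 1) / n + n * w))) = 0) ↔ ¬ Supported n (2 * k + 1) X q w) := by
    intro q w hqlt hwlt
    rw [Finset.sum_eq_zero_iff]
    unfold Supported
    push Not
    refine forall_congr' fun c => ?_
    rw [Finset.mem_range]
    refine imp_congr_right fun hc => ?_
    have l1 := pairIdx_lt (Nat.mod_lt (q / (2 * k + 1) / (2 * k + 1)) hn0) hwlt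
      (Nat.mod_lt q hd) hc
    have l2 := pairIdx_lt (snd_lt hqlt) hwlt (Nat.mod_lt (q / (2 * k + 1)) hd) hc
    have e1 := hX _ l1
    have e2 := hX _ l2
    unfold pairIdx at e1 e2 ⊢
    rw [e1, e2]
    split_ifs <;> simp_all
  replace hsum := hsum _ _ hqlt hwlt
  by_cases h1 : j % pairCount n (2 * k + 1) ∈ X
  · by_cases h2 : Supported n (2 * k + 1) X (j % pairCount n (2 * k + 1))
        (j / pairCount n (2 * k + 1) % n)
    · rw [if_pos h1, if_neg (fun h => hsum.1 h h2), if_pos ⟨h1, fun _ => h2⟩]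
    · rw [if_pos h1, if_pos (hsum.2 h2), if_neg (fun h => h2 (h.2 rfl))]
  · rw [if_neg h1, zero_mul, if_neg (fun h => h1 h.1)]

open Classical in
theorem runs_pcProg (hf : Fits k n A B) (hW : (pcProg k).weight ≤ W) {σ : Store}
    (hσ : Bounded A B σ) (hn : σ (0, 0) = n) {X : Finset ℕ}
    (hX : ∀ q < pairCount n (2 * k + 1), σ (9, q) = if q ∈ X then 1 else 0) :
    ∃ τ, Runs A B W (pcProg k) σ [] (pcTime n (2 * k + 1) * 3 + 2) τ ∧ Bounded A B τ ∧
      AgreeOff [3, 9] σ τ ∧ ∀ q < pairCount n (2 * k + 1), τ (9, q) =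
        if q ∈ pcSeq n (2 * k + 1) X (pcTime n (2 * k + 1)) then 1 else 0 := by
  have hW' := hW
  simp only [pcProg, Prog.forLoop, Prog.weight] at hW'
  obtain ⟨τ, hrun, hb, ha, hi⟩ := Runs.forLoop (A := A) (B := B) (W := W) hf.pos hf.one_le hW
    (mods := [3, 9]) (by simp) hσ
    (fun j τ => ∀ q < pairCount n (2 * k + 1), τ (9, q) =
      if q ∈ pcSeq n (2 * k + 1) X j then 1 else 0)
    (pcTime n (2 * k + 1)) 1 (fun _ => []) hf.time
    (fun τ hτ => by
      have h0 := (hτ 0 0 (by simp)).trans hn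
      simp only [Expr.eval, eval_countE h0, Expr.eval_var, h0, pcTime])
    (fun j τ v h q => by
      rw [Store.update_apply, if_neg (by omega)]
      exact h q)
    (fun j τ hj hbd h3 hag hinv => by
      have h0 : τ (0, 0) = n := (hag 0 0 (by simp)).trans hn
      have hQ : 0 < pairCount n (2 * k + 1) := by
        by_contra h
        have : pairCount n (2 * k + 1) = 0 := by omega
        simp [pcTime, this] at hj
      have hr := Runs.write (A := A) (W := W) (a := 9) (i := curE k) (e := pcE k) hf.one_le hbd
        (by simp only [Prog.weight]; omega)
      rw [eval_pcE h0 h3 hinv hQ, eval_curE h0 h3] at hr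
      refine ⟨_, hr, ?_, ?_, ?_, ?_⟩
      · refine hbd.update (by omega) ((Nat.mod_lt _ hQ).trans_le hf.pair)
          ((size_le_self _).trans ?_)
        have := hf.one_le
        split_ifs <;> omega
      · rw [Store.update_apply, if_neg (by omega), h3]
      · exact hag.update (by simp) _ _
      · intro q hq
        rw [Store.update_apply]
        by_cases hqj : q = j % pairCount n (2 * k + 1)
        · rw [if_pos ⟨rfl, hqj⟩, hqj]
          rfl
        · rw [if_neg (by tauto), hinv q hq]
          refine if_congr ?_ rfl rfl
          rw [pcSeq, mem_pcStep_iff]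
          tauto)
    hX
  rw [List.flatMap_eq_nil_iff.2 (fun _ _ => rfl)] at hrun
  exact ⟨τ, hrun, hb, ha, hi⟩

/-- The answer is updated. -/
def answerE (k : ℕ) : Expr :=
  .sign (.add (.add (.var 2) (.sub (.const 1) (.var 0)))
    (.sum (2 * k + 1) fun a => .read 9 (.const (a + (2 * k + 1) * a))))

open Classical in
theorem eval_answerE {σ : Store} (hn : σ (0, 0) = n) {X : Finset ℕ}
    (hX : ∀ q < pairCount n (2 * k + 1), σ (9, q) = if q ∈ X then 1 else 0)  :
    (answerE k).eval σ = if σ (2, 0) ≠ 0 ∨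
      (n = 0 ∨ ∃ a < 2 * k + 1, pairIdx n (2 * k + 1) 0 0 a a ∈ X) then 1 else 0 := by
  simp only [answerE, Expr.eval_sign, Expr.eval, Expr.eval_sum, Expr.eval_var, hn]
  rcases Nat.eq_zero_or_pos n with rfl | hn0
  · simp
  · have hsum : (∑ a ∈ Finset.range (2 * k + 1), σ (9, a + (2 * k + 1) * a)) = 0 ↔
        ¬ ∃ a < 2 * k + 1, pairIdx n (2 * k + 1) 0 0 a a ∈ X := by
      rw [Finset.sum_eq_zero_iff]
      push Not
      refine forall_congr' fun a => ?_
      rw [Finset.mem_range]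
      refine imp_congr_right fun ha => ?_
      have := hX _ (pairIdx_lt hn0 hn0 ha ha)
      simp only [pairIdx, mul_zero, add_zero] at this ⊢
      rw [this]
      split_ifs <;> simp_all
    rw [show 1 - n = 0 by omega]
    by_cases h1 : σ (2, 0) = 0 <;>
    by_cases h2 : ∃ a < 2 * k + 1, pairIdx n (2 * k + 1) 0 0 a a ∈ X
    · rw [if_neg, if_pos (.inr (.inr h2))]
      have := hsum.not.2 (not_not.2 h2)
      omega
    · rw [if_pos, if_neg]
      · rintro (h | h | h)
        · exact h h1
        · omega
        · exact h2 h
      · have := hsum.2 h2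
        omega
    · rw [if_neg (by omega), if_pos (.inl h1)]
    · rw [if_neg (by omega), if_pos (.inl h1)]

end pieces

section program

variable {k n A B W : ℕ}

/-- One trial: lists are drawn, and the list homomorphism problem is solved. -/
def trialProg (k : ℕ) : Prog :=
  .seq (.write 4 (.const 0) (.sub (.var 4) (.const 1)))
    (.seq (sampleProg k) (.seq (initProg k) (.seq (pcProg k) (.write 2 (.const 0) (answerE k)))))

/-- The number of steps of a trial. -/
def trialSteps (k n : ℕ) : ℕ :=
  n * flipCount k n * 4 + pairCount n (2 * k + 1) * 3 + pcTime n (2 * k + 1) * 3 + 8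

/-- The lists drawn in a trial. -/
def drawnList (k n : ℕ) (bits : ℕ → Bool) (v : ℕ) : Fin 3 :=
  listOfResidue (residue (2 * k + 1) (fun b => bits (v * flipCount k n + b)) (flipCount k n))

open Classical in
theorem runs_trialProg (hk : 1 ≤ k) (hf : Fits k n A B) (hW : (trialProg k).weight ≤ W)
    {G : SimpleGraph (Fin n)} {σ : Store} (hσ : Bounded A B σ) (hn : σ (0, 0) = n)
    (hadj : ∀ u v : Fin n, σ (1, u * n + v) ≠ 0 ↔ G.Adj u v) (bits : ℕ → Bool) :
    ∃ τ, Runs A B W (trialProg k) σ ((List.range (n * flipCount k n)).map bits)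
        (trialSteps k n) τ ∧ Bounded A B τ ∧ AgreeOff [2, 3, 4, 7, 8, 9] σ τ ∧
      τ (4, 0) = σ (4, 0) - 1 ∧
      τ (2, 0) = if σ (2, 0) ≠ 0 ∨ HasListHom k G (fun v => drawnList k n bits v) then 1 else 0 := by
  have hW' := hW
  simp only [trialProg, Prog.weight] at hW'
  have hr0 := Runs.write (A := A) (W := W) (a := 4) (i := .const 0) (e := .sub (.var 4) (.const 1))
    hf.one_le hσ (by simp only [Prog.weight]; omega)
  simp only [Expr.eval, Expr.eval_var] at hr0
  set σ₀ := σ.update (4, 0) (σ (4, 0) - 1) with hσ₀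
  have hb₀ : Bounded A B σ₀ :=
    hσ.update (by omega) hf.pos ((Nat.size_le_size (Nat.sub_le _ _)).trans (hσ.size _))
  have ha₀ : AgreeOff [4] σ σ₀ := (AgreeOff.refl _ _).update (by simp) _ _
  have h4 : σ₀ (4, 0) = σ (4, 0) - 1 := by rw [hσ₀, Store.update_apply, if_pos ⟨rfl, rfl⟩]
  obtain ⟨σ₁, hr1, hb₁, ha₁, hL⟩ := runs_sampleProg hf (W := W) (by omega) hb₀
    ((ha₀ 0 0 (by simp)).trans hn) bits
  have hn₁ : σ₁ (0, 0) = n := (ha₁ 0 0 (by simp)).trans ((ha₀ 0 0 (by simp)).trans hn)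
  obtain ⟨σ₂, hr2, hb₂, ha₂, hM₂⟩ := runs_initProg hf (W := W) (by omega) hb₁ hn₁
    (fun v hv => (hL v hv).trans_lt (residue_lt (by omega) _ _))
  have hn₂ : σ₂ (0, 0) = n := (ha₂ 0 0 (by simp)).trans hn₁
  obtain ⟨σ₃, hr3, hb₃, ha₃, hM₃⟩ := runs_pcProg hf (W := W) (by omega) hb₂ hn₂ hM₂
  have hn₃ : σ₃ (0, 0) = n := (ha₃ 0 0 (by simp)).trans hn₂
  have hr4 := Runs.write (A := A) (W := W) (a := 2) (i := .const 0) (e := answerE k)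
    hf.one_le hb₃ (by simp only [Prog.weight]; omega)
  have hadj₁ : ∀ u v : Fin n, (fun x => σ₁ (1, x)) (u * n + v) ≠ 0 ↔ G.Adj u v := by
    intro u v
    rw [← hadj u v, ← ha₀ 1 _ (by simp), ← ha₁ 1 _ (by simp)]
  have h2 : σ₃ (2, 0) = σ (2, 0) := (ha₃ 2 0 (by simp)).trans ((ha₂ 2 0 (by simp)).trans
    ((ha₁ 2 0 (by simp)).trans (ha₀ 2 0 (by simp))))
  have hlists : (fun v : Fin n => listOfResidue (σ₁ (8, v))) =
      fun v : Fin n => drawnList k n bits v := by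
    funext v
    rw [hL v v.2, drawnList]
  have hans : (answerE k).eval σ₃ =
      if σ (2, 0) ≠ 0 ∨ HasListHom k G (fun v => drawnList k n bits v) then 1 else 0 := by
    rw [eval_answerE hn₃ hM₃]
    refine if_congr ?_ rfl rfl
    rw [pcSeq_correct (res := fun v => σ₁ (8, v)) hk hadj₁, hlists, h2]
  rw [hans, Expr.eval] at hr4
  refine ⟨σ₃.update (2, 0)
    (if σ (2, 0) ≠ 0 ∨ HasListHom k G (fun v => drawnList k n bits v) then 1 else 0),
    ?_, ?_, ?_, ?_, ?_⟩
  · refine Runs.mono (s := 1 + (n * flipCount k n * 4 + 2 + (pairCount n (2 * k + 1) * 3 + 2 +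
      (pcTime n (2 * k + 1) * 3 + 2 + 1)))) ?_ (by unfold trialSteps; omega)
    have hrun := hr0.seq (hr1.seq (hr2.seq (hr3.seq hr4)))
    simp only [List.nil_append, List.append_nil] at hrun
    exact hrun
  · refine hb₃.update (by omega) hf.pos ((size_le_self _).trans ?_)
    have := hf.one_le
    split_ifs <;> omega
  · refine AgreeOff.update ?_ (by simp) _ _
    exact (ha₀.mono (by simp)).trans ((ha₁.mono (by simp)).trans
      ((ha₂.mono (by simp)).trans (ha₃.mono (by simp))))
  · rw [Store.update_apply, if_neg (by omega), ha₃ 4 0 (by simp), ha₂ 4 0 (by simp),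
      ha₁ 4 0 (by simp), h4]
  · rw [Store.update_apply, if_pos ⟨rfl, rfl⟩]

theorem range_flatMap_map (N m : ℕ) (ω : ℕ → Bool) :
    ((List.range N).flatMap fun i => (List.range m).map fun j => ω (i * m + j)) =
      (List.range (N * m)).map ω := by
  induction N with
  | zero => simp
  | succ N ih =>
    rw [List.range_succ, List.flatMap_append, ih, add_mul, one_mul, List.range_add, List.map_append]
    simp [Function.comp_def]

/-- All trials. -/
def trialsProg (k : ℕ) : Prog := .loop (.var 4) (trialProg k)

open Classical in
theorem runs_trialsProg (hk : 1 ≤ k) (hf : Fits k n A B) (hW : (trialsProg k).weight ≤ W)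
    {G : SimpleGraph (Fin n)} {σ : Store} (hσ : Bounded A B σ) (hn : σ (0, 0) = n)
    (hadj : ∀ u v : Fin n, σ (1, u * n + v) ≠ 0 ↔ G.Adj u v) (h2 : σ (2, 0) = 0) {N : ℕ}
    (h4 : σ (4, 0) = N) (ω : ℕ → Bool) :
    ∃ τ, Runs A B W (trialsProg k) σ ((List.range (N * (n * flipCount k n))).map ω)
        (N * (trialSteps k n + 1) + 1) τ ∧
      τ (2, 0) = if ∃ i < N, HasListHom k G
        (fun v => drawnList k n (fun j => ω (i * (n * flipCount k n) + j)) v) then 1 else 0 := by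
  have hW' := hW
  simp only [trialsProg, Prog.weight] at hW'
  obtain ⟨τ, hrun, h⟩ := Runs.loop (A := A) (B := B) (W := W) (e := .var 4) (p := trialProg k)
    hf.one_le hW
    (fun i τ => Bounded A B τ ∧ AgreeOff [2, 3, 4, 7, 8, 9] σ τ ∧ τ (4, 0) = N - i ∧
      τ (2, 0) = if ∃ i' < i, HasListHom k G
        (fun v => drawnList k n (fun j => ω (i' * (n * flipCount k n) + j)) v) then 1 else 0)
    N (trialSteps k n)
    (fun i => (List.range (n * flipCount k n)).map fun j => ω (i * (n * flipCount k n) + j))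
    (fun i τ h => h.1)
    (fun i τ h hi => by
      rw [Expr.eval_var, h.2.2.1]
      omega)
    (fun τ h => by
      rw [Expr.eval_var, h.2.2.1]
      omega)
    (fun i τ h hi => by
      obtain ⟨τ', hr, hb', ha', h4', h2'⟩ := runs_trialProg (W := W) hk hf (by omega) (G := G) h.1
        ((h.2.1 0 0 (by simp)).trans hn)
        (fun u v => by rw [h.2.1 1 _ (by simp)]; exact hadj u v)
        (fun j => ω (i * (n * flipCount k n) + j))
      refine ⟨τ', hr, hb', h.2.1.trans ha', by rw [h4', h.2.2.1]; omega, ?_⟩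
      rw [h2', h.2.2.2]
      refine if_congr ?_ rfl rfl
      constructor
      · rintro (h | h)
        · split_ifs at h with h'
          · obtain ⟨i', hi', hh⟩ := h'
            exact ⟨i', by omega, hh⟩
          · exact absurd rfl h
        · exact ⟨i, by omega, h⟩
      · rintro ⟨i', hi', hh⟩
        rcases Nat.lt_succ_iff_lt_or_eq.1 hi' with h' | rfl
        · left
          rw [if_pos ⟨i', h', hh⟩]
          exact one_ne_zero
        · exact .inr hh)
    (σ := σ) ⟨hσ, AgreeOff.refl _ _, by rw [h4]; rfl, by simp [h2]⟩
  rw [range_flatMap_map] at hrun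
  exact ⟨τ, hrun, h.2.2.2⟩

/-- The numerator of the rate of the number of trials. -/
def rateNum (k : ℕ) : ℕ := (2 * k + 1) ^ (2 * k + 1)

/-- The denominator of the rate of the number of trials. -/
def rateDen (k : ℕ) : ℕ := 2 * (2 * k) ^ (2 * k)

/-- The number of trials. -/
def trialCount (k n : ℕ) : ℕ :=
  4 * (rateNum k ^ (n / (2 * k + 1) + 1) / rateDen k ^ (n / (2 * k + 1) + 1) + 1)

/-- The computation of the number of trials. -/
def setupProg (k : ℕ) : Prog :=
  .seq (.write 5 (.const 0) (.const 1)) (.seq (.write 6 (.const 0) (.const 1))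
    (.seq (.forLoop (.add (.div (.var 0) (.const (2 * k + 1))) (.const 1))
      (.seq (.write 5 (.const 0) (.mul (.var 5) (.const (rateNum k))))
        (.write 6 (.const 0) (.mul (.var 6) (.const (rateDen k))))))
      (.write 4 (.const 0) (.mul (.const 4) (.add (.div (.var 5) (.var 6)) (.const 1))))))

theorem runs_setupProg (hf : Fits k n A B) (hW : (setupProg k).weight ≤ W) {σ : Store}
    (hσ : Bounded A B σ) (hn : σ (0, 0) = n) (hnB : n / (2 * k + 1) + 1 ≤ B)
    (hnum : ∀ j ≤ n / (2 * k + 1) + 1, Nat.size (rateNum k ^ j) ≤ B)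
    (hden : ∀ j ≤ n / (2 * k + 1) + 1, Nat.size (rateDen k ^ j) ≤ B)
    (hcount : Nat.size (trialCount k n) ≤ B) :
    ∃ τ, Runs A B W (setupProg k) σ [] ((n / (2 * k + 1) + 1) * 4 + 5) τ ∧ Bounded A B τ ∧
      AgreeOff [3, 4, 5, 6] σ τ ∧ τ (4, 0) = trialCount k n := by
  have hW' := hW
  simp only [setupProg, Prog.forLoop, Prog.weight] at hW'
  have hs1 : Nat.size 1 ≤ B := (size_le_self 1).trans hf.one_le
  have hr1 := Runs.write (A := A) (W := W) (a := 5) (i := .const 0) (e := .const 1)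
    hf.one_le hσ (by simp only [Prog.weight]; omega)
  simp only [Expr.eval] at hr1
  set σ₁ := σ.update (5, 0) 1 with hσ₁
  have hb₁ : Bounded A B σ₁ := hσ.update (by omega) hf.pos hs1
  have hr2 := Runs.write (A := A) (W := W) (a := 6) (i := .const 0) (e := .const 1)
    hf.one_le hb₁ (by simp only [Prog.weight]; omega)
  simp only [Expr.eval] at hr2
  set σ₂ := σ₁.update (6, 0) 1 with hσ₂
  have hb₂ : Bounded A B σ₂ := hb₁.update (by omega) hf.pos hs1
  have ha₂ : AgreeOff [3, 4, 5, 6] σ σ₂ :=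
    ((AgreeOff.refl _ _).update (by simp) _ _).update (by simp) _ _
  obtain ⟨σ₃, hr3, hb₃, ha₃, h5, h6⟩ := Runs.forLoop (A := A) (B := B) (W := W)
    (bound := .add (.div (.var 0) (.const (2 * k + 1))) (.const 1))
    (body := .seq (.write 5 (.const 0) (.mul (.var 5) (.const (rateNum k))))
        (.write 6 (.const 0) (.mul (.var 6) (.const (rateDen k))))) hf.pos hf.one_le
    (by simp only [Prog.forLoop, Prog.weight]; omega)
    (mods := [3, 4, 5, 6]) (by simp) hb₂
    (fun j τ => τ (5, 0) = rateNum k ^ j ∧ τ (6, 0) = rateDen k ^ j)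
    (n / (2 * k + 1) + 1) 2 (fun _ => []) hnB
    (fun τ hτ => by
      simp only [Expr.eval, Expr.eval_var]
      rw [hτ 0 0 (by simp), ha₂ 0 0 (by simp), hn])
    (fun j τ v h => by
      simp only [Store.update_apply]
      simpa using h)
    (fun j τ hj hbd h3 hag hinv => by
      have hw1 := Runs.write (A := A) (W := W) (a := 5) (i := .const 0)
        (e := .mul (.var 5) (.const (rateNum k))) hf.one_le hbd (by simp only [Prog.weight]; omega)
      simp only [Expr.eval, Expr.eval_var, hinv.1, ← pow_succ] at hw1
      have hb1 : Bounded A B (τ.update (5, 0) (rateNum k ^ (j + 1))) :=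
        hbd.update (by omega) hf.pos (hnum _ hj)
      have hw2 := Runs.write (A := A) (W := W) (a := 6) (i := .const 0)
        (e := .mul (.var 6) (.const (rateDen k))) hf.one_le hb1 (by simp only [Prog.weight]; omega)
      have e6 : (τ.update (5, 0) (rateNum k ^ (j + 1))) (6, 0) = rateDen k ^ j := by
        rw [Store.update_apply, if_neg (by omega), hinv.2]
      simp only [Expr.eval, Expr.eval_var, e6, ← pow_succ] at hw2
      refine ⟨_, hw1.seq hw2, ?_, ?_, ?_, ?_, ?_⟩
      · exact hb1.update (by omega) hf.pos (hden _ hj)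
      · rw [Store.update_apply, if_neg (by omega), Store.update_apply, if_neg (by omega), h3]
      · exact (hag.update (by simp) _ _).update (by simp) _ _
      · rw [Store.update_apply, if_neg (by omega), Store.update_apply, if_pos ⟨rfl, rfl⟩]
      · rw [Store.update_apply, if_pos ⟨rfl, rfl⟩])
    (by
      constructor
      · rw [hσ₂, Store.update_apply, if_neg (by omega), hσ₁, Store.update_apply,
          if_pos ⟨rfl, rfl⟩, pow_zero]
      · rw [hσ₂, Store.update_apply, if_pos ⟨rfl, rfl⟩, pow_zero])
  rw [List.flatMap_eq_nil_iff.2 (fun _ _ => rfl)] at hr3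
  have hr4 := Runs.write (A := A) (W := W) (a := 4) (i := .const 0)
    (e := .mul (.const 4) (.add (.div (.var 5) (.var 6)) (.const 1)))
    hf.one_le hb₃ (by simp only [Prog.weight]; omega)
  simp only [Expr.eval, Expr.eval_var, h5, h6] at hr4
  refine ⟨σ₃.update (4, 0) (trialCount k n), ?_, ?_, ?_, ?_⟩
  · exact (hr1.seq (hr2.seq (hr3.seq hr4))).mono (by omega)
  · exact hb₃.update (by omega) hf.pos hcount
  · exact (ha₂.trans ha₃).update (by simp) _ _
  · rw [Store.update_apply, if_pos ⟨rfl, rfl⟩]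

end program
end OddCycle

/-! ### The success probability of the program -/

namespace OddCycle

theorem residue_congr {d : ℕ} {β γ : ℕ → Bool} {r : ℕ} (h : ∀ b < r, β b = γ b) :
    residue d β r = residue d γ r := by
  induction r with
  | zero => rfl
  | succ r ih =>
    rw [residue, residue, ih (fun b hb => h b (by omega)), h r (by omega)]

/-- The bits of `y`, the most significant one of `r` bits first. -/
def bitsOf (r y b : ℕ) : Bool := y.testBit (r - 1 - b)

theorem residue_bitsOf {d r y : ℕ} (hy : y < 2 ^ r) : residue d (bitsOf r y) r = y % d := by
  have key : ∀ b ≤ r, residue d (bitsOf r y) b = y / 2 ^ (r - b) % d := by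
    intro b
    induction b with
    | zero =>
      intro _
      rw [Nat.sub_zero, Nat.div_eq_of_lt hy]
      simp [residue]
    | succ b ih =>
      intro hb
      rw [residue, ih (by omega), bitsOf, Nat.toNat_testBit,
        show r - b = (r - 1 - b) + 1 by omega, show r - (b + 1) = r - 1 - b by omega, pow_succ,
        ← Nat.div_div_eq_div_mul, Nat.add_mod, Nat.mul_mod, Nat.mod_mod, ← Nat.mul_mod,
        ← Nat.add_mod, Nat.div_add_mod]
  simpa using key r le_rfl

/-- A finite sequence of bits continued by zeros. -/
def extendBits {r : ℕ} (β : Fin r → Bool) (b : ℕ) : Bool := if h : b < r then β ⟨b, h⟩ else false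

theorem residue_extendBits (d : ℕ) {r : ℕ} (β : ℕ → Bool) :
    residue d (extendBits fun b : Fin r => β b) r = residue d β r :=
  residue_congr fun b hb => by simp [extendBits, hb]

theorem bitsOf_injective {r y y' : ℕ} (hy : y < 2 ^ r) (hy' : y' < 2 ^ r)
    (h : ∀ b < r, bitsOf r y b = bitsOf r y' b) : y = y' := by
  refine Nat.eq_of_testBit_eq fun i => ?_
  rcases lt_or_ge i r with hi | hi
  · have := h (r - 1 - i) (by omega)
    simpa [bitsOf, show r - 1 - (r - 1 - i) = i by omega] using this
  · have : 2 ^ r ≤ 2 ^ i := Nat.pow_le_pow_right (by norm_num) hi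
    rw [Nat.testBit_lt_two_pow (by omega), Nat.testBit_lt_two_pow (by omega)]

open Classical in
/-- The bit sequences whose list contains `a`. -/
def goodBits (k r : ℕ) (a : Fin (2 * k + 1)) : Finset (Fin r → Bool) :=
  Finset.univ.filter fun β =>
    a ∈ listSet k (listOfResidue (residue (2 * k + 1) (extendBits β) r))

open Classical in
/-- The residues whose list contains `a`. -/
def goodResidues (k : ℕ) (a : Fin (2 * k + 1)) : Finset ℕ :=
  (Finset.range (2 * k + 1)).filter fun x => a ∈ listSet k (listOfResidue x)

theorem card_goodResidues {k : ℕ} (hk : 1 ≤ k) (a : Fin (2 * k + 1)) :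
    (if a = 0 then 2 else 2 * k) ≤ (goodResidues k a).card := by
  classical
  have l0 : listOfResidue 0 = 1 := rfl
  have l1 : listOfResidue 1 = 2 := rfl
  have l2 : ∀ x, 2 ≤ x → listOfResidue x = 0 := fun x hx => by
    rw [listOfResidue, if_neg (by omega), if_neg (by omega)]
  have mem : ∀ x, x ∈ goodResidues k a ↔ x < 2 * k + 1 ∧ natList (listOfResidue x) a := fun x => by
    rw [goodResidues, Finset.mem_filter, Finset.mem_range, mem_listSet_iff]
  split_ifs with h
  · have ha : (a : ℕ) = 0 := by rw [h]; rfl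
    have : ({0, 1} : Finset ℕ) ⊆ goodResidues k a := by
      intro x hx
      rw [mem]
      simp only [Finset.mem_insert, Finset.mem_singleton] at hx
      rcases hx with rfl | rfl
      · exact ⟨by omega, by rw [l0, ha]; rfl⟩
      · exact ⟨by omega, by rw [l1, ha]; exact .inr rfl⟩
    exact (Finset.card_le_card this).trans' (by simp)
  · have ha : (a : ℕ) ≠ 0 := fun h' => h (Fin.ext h')
    obtain ⟨e, he, hel⟩ : ∃ e < 2, natList (listOfResidue e) a := by
      rcases Nat.mod_two_eq_zero_or_one (a : ℕ) with h' | h'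
      · exact ⟨0, by omega, h'⟩
      · exact ⟨1, by omega, .inl h'⟩
    have : insert e (Finset.Ico 2 (2 * k + 1)) ⊆ goodResidues k a := by
      intro x hx
      rw [mem]
      rcases Finset.mem_insert.1 hx with rfl | hx
      · exact ⟨by omega, hel⟩
      · rw [Finset.mem_Ico] at hx
        exact ⟨hx.2, by rw [l2 x hx.1]; exact ha⟩
    refine (Finset.card_le_card this).trans' ?_
    rw [Finset.card_insert_of_notMem (by simp; omega), Nat.card_Ico]
    omega

theorem card_goodBits_ge (k r : ℕ) (a : Fin (2 * k + 1)) :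
    (goodResidues k a).card * (2 ^ r / (2 * k + 1)) ≤ (goodBits k r a).card := by
  classical
  have hlt : ∀ x ∈ goodResidues k a, ∀ i < 2 ^ r / (2 * k + 1), x + (2 * k + 1) * i < 2 ^ r := by
    intro x hx i hi
    have := Finset.mem_range.1 (Finset.mem_filter.1 hx).1
    calc x + (2 * k + 1) * i < (2 * k + 1) * (2 ^ r / (2 * k + 1)) := add_mul_lt this hi
      _ ≤ 2 ^ r := Nat.mul_div_le _ _
  calc (goodResidues k a).card * (2 ^ r / (2 * k + 1))
      = (goodResidues k a ×ˢ Finset.range (2 ^ r / (2 * k + 1))).card := by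
        rw [Finset.card_product, Finset.card_range]
    _ ≤ (goodBits k r a).card := by
        refine Finset.card_le_card_of_injOn
          (fun p => fun b : Fin r => bitsOf r (p.1 + (2 * k + 1) * p.2) b) ?_ ?_
        · rintro ⟨x, i⟩ hp
          obtain ⟨hx, hi⟩ := Finset.mem_product.1 hp
          have hxd := Finset.mem_range.1 (Finset.mem_filter.1 hx).1
          refine Finset.mem_filter.2 ⟨Finset.mem_univ _, ?_⟩
          rw [residue_extendBits, residue_bitsOf (hlt x hx i (Finset.mem_range.1 hi)),
            Nat.add_mul_mod_self_left, Nat.mod_eq_of_lt hxd]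
          exact (Finset.mem_filter.1 hx).2
        · rintro ⟨x, i⟩ hp ⟨x', i'⟩ hp' heq
          obtain ⟨hx, hi⟩ := Finset.mem_product.1 hp
          obtain ⟨hx', hi'⟩ := Finset.mem_product.1 hp'
          have hxd := Finset.mem_range.1 (Finset.mem_filter.1 hx).1
          have hxd' := Finset.mem_range.1 (Finset.mem_filter.1 hx').1
          have := bitsOf_injective (hlt x hx i (Finset.mem_range.1 hi))
            (hlt x' hx' i' (Finset.mem_range.1 hi')) (fun b hb => congrFun heq ⟨b, hb⟩)
          have hxx : x = x' := by
            have h := congrArg (· % (2 * k + 1)) this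
            simpa [Nat.add_mul_mod_self_left, Nat.mod_eq_of_lt, hxd, hxd'] using h
          subst hxx
          have : i = i' := Nat.eq_of_mul_eq_mul_left (by omega) (Nat.add_left_cancel this)
          rw [this]

/-- The probability that the list of a vertex contains a given value, up to rounding. -/
theorem card_goodBits_real {k : ℕ} (hk : 1 ≤ k) (r : ℕ) (a : Fin (2 * k + 1)) :
    2 ^ r * valueProb k a * (1 - (2 * k + 1) / 2 ^ r) ≤ ((goodBits k r a).card : ℝ) := by
  have hd : (0 : ℝ) < 2 * k + 1 := by positivity
  have h1 : ((2 : ℝ) ^ r / (2 * k + 1) - 1) ≤ ((2 ^ r / (2 * k + 1) : ℕ) : ℝ) := by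
    have : (2 : ℝ) ^ r < (2 * k + 1) * (((2 ^ r / (2 * k + 1) : ℕ) : ℝ) + 1) := by
      exact_mod_cast Nat.lt_mul_div_succ (2 ^ r) (show 0 < 2 * k + 1 by omega)
    rw [tsub_le_iff_right, div_le_iff₀ hd]
    linarith
  have h2 : ((2 * k + 1 : ℝ) * valueProb k a) ≤ (goodResidues k a).card := by
    have := card_goodResidues hk a
    have h3 : (((if a = 0 then 2 else 2 * k : ℕ)) : ℝ) ≤ (goodResidues k a).card := by
      exact_mod_cast this
    refine le_trans (le_of_eq ?_) h3
    unfold valueProb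
    split_ifs <;> push_cast <;> field_simp
  have h4 : (((goodResidues k a).card * (2 ^ r / (2 * k + 1)) : ℕ) : ℝ) ≤
      (goodBits k r a).card := by exact_mod_cast card_goodBits_ge k r a
  refine le_trans ?_ h4
  push_cast
  calc (2 : ℝ) ^ r * valueProb k a * (1 - (2 * k + 1) / 2 ^ r)
      = ((2 * k + 1 : ℝ) * valueProb k a) * ((2 : ℝ) ^ r / (2 * k + 1) - 1) := by
        field_simp
    _ ≤ ((2 * k + 1 : ℝ) * valueProb k a) * ((2 ^ r / (2 * k + 1) : ℕ) : ℝ) :=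
        mul_le_mul_of_nonneg_left h1 (mul_nonneg hd.le (valueProb_nonneg k a))
    _ ≤ _ := mul_le_mul_of_nonneg_right h2 (Nat.cast_nonneg _)

/-- The coin flips of one trial. -/
abbrev Block (k n : ℕ) : Type := Fin n → Fin (flipCount k n) → Bool

/-- The lists determined by the coin flips of one trial. -/
def blockLists {k n : ℕ} (Φ : Block k n) (v : Fin n) : Fin 3 :=
  listOfResidue (residue (2 * k + 1) (extendBits (Φ v)) (flipCount k n))

open Classical in
/-- The outcomes of the coin flips of one trial for which there is no list homomorphism. -/
def badBlocks (k : ℕ) {n : ℕ} (G : SimpleGraph (Fin n)) : Finset (Block k n) :=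
  Finset.univ.filter fun Φ => ¬ HasListHom k G (blockLists Φ)

theorem flip_error {k n : ℕ} : (n : ℝ) * ((2 * k + 1) / 2 ^ flipCount k n) ≤ 1 / 2 := by
  have h1 : n ≤ 2 ^ n := Nat.lt_two_pow_self.le
  have h2 : 2 * k + 1 ≤ 2 ^ (2 * k + 1) := Nat.lt_two_pow_self.le
  have h3 : 2 * (n * (2 * k + 1)) ≤ 2 ^ flipCount k n := by
    calc 2 * (n * (2 * k + 1)) ≤ 2 * (2 ^ n * 2 ^ (2 * k + 1)) := by gcongr
      _ = 2 ^ flipCount k n := by unfold flipCount; ring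
  have h4 : (2 : ℝ) * (n * (2 * k + 1)) ≤ 2 ^ flipCount k n := by exact_mod_cast h3
  rw [← mul_div_assoc, div_le_iff₀ (by positivity)]
  linarith

theorem card_badBlocks_le {k n : ℕ} (hk : 1 ≤ k) {G : SimpleGraph (Fin n)}
    (hG : Nonempty (G →g cycle k)) :
    ((badBlocks k G).card : ℝ) ≤ (Fintype.card (Block k n) : ℝ) * (1 - (alpha k ^ n)⁻¹ / 2) := by
  classical
  obtain ⟨h, hh⟩ := exists_hom_valueProb hk hG
  set r := flipCount k n with hr
  have hcard : (Fintype.card (Block k n) : ℝ) = (2 ^ r) ^ n := by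
    simp [Block, hr]
  have hsub : Fintype.piFinset (fun v => goodBits k r (h v)) ⊆
      Finset.univ.filter fun Φ : Block k n => HasListHom k G (blockLists Φ) := by
    intro Φ hΦ
    refine Finset.mem_filter.2 ⟨Finset.mem_univ _, h, fun v => ?_⟩
    exact (Finset.mem_filter.1 (Fintype.mem_piFinset.1 hΦ v)).2
  have hsum : (badBlocks k G).card +
      (Finset.univ.filter fun Φ : Block k n => HasListHom k G (blockLists Φ)).card =
        Fintype.card (Block k n) := by
    rw [add_comm, ← Finset.card_univ]
    exact Finset.card_filter_add_card_filter_not _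
  set δ : ℝ := (2 * k + 1) / 2 ^ r with hδ
  have hδ0 : 0 ≤ δ := by positivity
  have hnδ : n * δ ≤ 1 / 2 := flip_error
  have hprod : (2 ^ r) ^ n * ((alpha k ^ n)⁻¹ / 2) ≤
      (((Fintype.piFinset fun v => goodBits k r (h v)).card : ℕ) : ℝ) := by
    rcases Nat.eq_zero_or_pos n with hn | hn
    · subst hn
      simp
      norm_num
    have hn1 : (1 : ℝ) ≤ n := by exact_mod_cast hn
    have hδ1 : δ ≤ 1 / 2 := by nlinarith
    have hbern : 1 / 2 ≤ (1 - δ) ^ n := by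
      have := one_add_mul_le_pow (show (-2 : ℝ) ≤ -δ by linarith) n
      rw [← sub_eq_add_neg] at this
      linarith
    rw [Fintype.card_piFinset]
    push_cast
    calc (2 ^ r) ^ n * ((alpha k ^ n)⁻¹ / 2)
        ≤ (2 ^ r) ^ n * ((∏ v, valueProb k (h v)) * (1 - δ) ^ n) := by
          refine mul_le_mul_of_nonneg_left ?_ (by positivity)
          rw [div_eq_mul_one_div]
          exact mul_le_mul hh hbern (by norm_num)
            (Finset.prod_nonneg fun v _ => valueProb_nonneg _ _)
      _ = ∏ v : Fin n, (2 ^ r * valueProb k (h v) * (1 - δ)) := by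
          rw [Finset.prod_mul_distrib, Finset.prod_mul_distrib, Finset.prod_const,
            Finset.prod_const, Finset.card_univ, Fintype.card_fin, mul_assoc]
      _ ≤ ∏ v : Fin n, ((goodBits k r (h v)).card : ℝ) := by
          refine Finset.prod_le_prod (fun v _ => ?_) fun v _ => card_goodBits_real hk r (h v)
          have := valueProb_nonneg k (h v)
          have : 0 ≤ 1 - δ := by linarith
          positivity
  have hle : (((Fintype.piFinset fun v => goodBits k r (h v)).card : ℕ) : ℝ) ≤
      ((Finset.univ.filter fun Φ : Block k n => HasListHom k G (blockLists Φ)).card : ℝ) := by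
    exact_mod_cast Finset.card_le_card hsub
  have hsum' : ((badBlocks k G).card : ℝ) +
      ((Finset.univ.filter fun Φ : Block k n => HasListHom k G (blockLists Φ)).card : ℝ) =
        Fintype.card (Block k n) := by exact_mod_cast hsum
  rw [mul_sub, mul_one, hcard]
  rw [hcard] at hsum'
  linarith

theorem rate_eq {k : ℕ} (hk : 1 ≤ k) :
    (rateNum k : ℝ) / rateDen k = alpha k ^ (2 * k + 1) := by
  have hk' : (0 : ℝ) < k := by exact_mod_cast hk
  rw [alpha_pow_eq hk, rateNum, rateDen, div_pow]
  push_cast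
  rw [pow_succ]
  field_simp

theorem rateDen_pos {k : ℕ} (hk : 1 ≤ k) : 0 < rateDen k := by
  unfold rateDen
  positivity

theorem le_trialCount {k : ℕ} (hk : 1 ≤ k) (n : ℕ) : 4 * alpha k ^ n ≤ (trialCount k n : ℝ) := by
  set m := n / (2 * k + 1) + 1 with hm
  have hQ : (0 : ℝ) < (rateDen k : ℝ) ^ m := by
    have : (0 : ℝ) < rateDen k := by exact_mod_cast rateDen_pos hk
    positivity
  have h1 : alpha k ^ n ≤ (rateNum k : ℝ) ^ m / (rateDen k : ℝ) ^ m := by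
    rw [← div_pow, rate_eq hk, ← pow_mul]
    refine pow_le_pow_right₀ (one_le_alpha hk) ?_
    exact (Nat.lt_mul_div_succ n (by omega)).le
  have h2 : (rateNum k : ℝ) ^ m / (rateDen k : ℝ) ^ m ≤
      ((rateNum k ^ m / rateDen k ^ m : ℕ) : ℝ) + 1 := by
    rw [div_le_iff₀ hQ]
    have : rateNum k ^ m < rateDen k ^ m * (rateNum k ^ m / rateDen k ^ m + 1) :=
      Nat.lt_mul_div_succ _ (pow_pos (rateDen_pos hk) _)
    have h3 : (rateNum k : ℝ) ^ m <
        (rateDen k : ℝ) ^ m * (((rateNum k ^ m / rateDen k ^ m : ℕ) : ℝ) + 1) := by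
      exact_mod_cast this
    linarith
  unfold trialCount
  rw [← hm]
  push_cast at h2 ⊢
  linarith

theorem trialCount_le {k : ℕ} (hk : 1 ≤ k) (n : ℕ) :
    (trialCount k n : ℝ) ≤ 4 * (rateNum k + 1) * alpha k ^ n := by
  set m := n / (2 * k + 1) with hm
  have hα := one_le_alpha hk
  have hα' : 1 ≤ alpha k ^ n := one_le_pow₀ hα
  have h1 : ((rateNum k ^ (m + 1) / rateDen k ^ (m + 1) : ℕ) : ℝ) ≤
      rateNum k * alpha k ^ n := by
    calc ((rateNum k ^ (m + 1) / rateDen k ^ (m + 1) : ℕ) : ℝ)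
        ≤ (rateNum k : ℝ) ^ (m + 1) / (rateDen k : ℝ) ^ (m + 1) := by
          exact_mod_cast Nat.cast_div_le
      _ = (rateNum k / rateDen k) * alpha k ^ ((2 * k + 1) * m) := by
          rw [← div_pow, pow_succ', rate_eq hk, ← pow_mul]
      _ ≤ rateNum k * alpha k ^ n := by
          refine mul_le_mul (div_le_self (Nat.cast_nonneg _) ?_)
            (pow_le_pow_right₀ hα (Nat.mul_div_le _ _)) (by positivity) (Nat.cast_nonneg _)
          exact_mod_cast rateDen_pos hk
  unfold trialCount
  push_cast at h1 ⊢
  nlinarith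

theorem failure_le {k : ℕ} (hk : 1 ≤ k) (n : ℕ) :
    (1 - (alpha k ^ n)⁻¹ / 2) ^ trialCount k n ≤ (1 / 3 : ℝ) := by
  have hα : 1 ≤ alpha k ^ n := one_le_pow₀ (one_le_alpha hk)
  have hα0 : 0 < alpha k ^ n := by linarith
  have hinv : (alpha k ^ n)⁻¹ ≤ 1 := inv_le_one_of_one_le₀ hα
  calc (1 - (alpha k ^ n)⁻¹ / 2) ^ trialCount k n
      ≤ Real.exp (-((alpha k ^ n)⁻¹ / 2)) ^ trialCount k n :=
        pow_le_pow_left₀ (by linarith) (Real.one_sub_le_exp_neg _) _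
    _ = Real.exp (-((alpha k ^ n)⁻¹ / 2 * trialCount k n)) := by
        rw [← Real.exp_nat_mul]; ring_nf
    _ ≤ Real.exp (-2) := by
        refine Real.exp_le_exp.2 (neg_le_neg ?_)
        calc (2 : ℝ) = (alpha k ^ n)⁻¹ / 2 * (4 * alpha k ^ n) := by field_simp; norm_num
          _ ≤ _ := mul_le_mul_of_nonneg_left (le_trialCount hk n) (by positivity)
    _ ≤ 1 / 3 := by
        rw [Real.exp_neg, ← one_div]
        refine one_div_le_one_div_of_le (by norm_num) ?_
        have := Real.add_one_le_exp (2 : ℝ)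
        linarith

end OddCycle

/-! ### The input -/

namespace RAM

theorem graphInput_apply {n : ℕ} (G : SimpleGraph (Fin n)) (c : ℕ × ℕ)
    [∀ i j : Fin n, Decidable (G.Adj i j ∧ (1, (i : ℕ) * n + j) = c)] :
    graphInput G c = (if (0, 0) = c then n else 0) +
      ∑ i : Fin n, ∑ j : Fin n, if G.Adj i j ∧ (1, (i : ℕ) * n + j) = c then 1 else 0 := by
  classical
  unfold graphInput
  rw [Finsupp.add_apply, Finsupp.single_apply, Finsupp.finsetSum_apply]
  congr 1
  refine Finset.sum_congr rfl fun i _ => ?_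
  rw [Finsupp.finsetSum_apply]
  refine Finset.sum_congr rfl fun j _ => ?_
  by_cases h : G.Adj i j
  · simp [h, Finsupp.single_apply]
  · simp [h]

theorem graphInput_zero {n : ℕ} (G : SimpleGraph (Fin n)) : graphInput G (0, 0) = n := by
  classical
  rw [graphInput_apply]
  simp

theorem graphInput_answer {n : ℕ} (G : SimpleGraph (Fin n)) : graphInput G (2, 0) = 0 := by
  classical
  rw [graphInput_apply]
  simp

theorem graphInput_adj {n : ℕ} (G : SimpleGraph (Fin n)) (u v : Fin n) :
    graphInput G (1, (u : ℕ) * n + v) ≠ 0 ↔ G.Adj u v := by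
  classical
  rw [graphInput_apply]
  simp only [Prod.mk.injEq, zero_ne_one, false_and, if_false, zero_add, true_and, ne_eq,
    Finset.sum_eq_zero_iff, Finset.mem_univ, true_implies, ite_eq_right_iff, one_ne_zero,
    imp_false, not_forall, not_not]
  constructor
  · rintro ⟨i, j, h, e⟩
    have h1 := congrArg (· % n) e
    have h2 := congrArg (· / n) e
    have hn : 0 < n := by have := u.2; omega
    simp only [Nat.mul_add_mod', Nat.mod_eq_of_lt j.2, Nat.mod_eq_of_lt v.2] at h1
    simp only [mul_comm _ n, Nat.mul_add_div hn, Nat.div_eq_of_lt j.2, Nat.div_eq_of_lt v.2,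
      add_zero] at h2
    rwa [Fin.ext h1, Fin.ext h2] at h
  · intro h
    exact ⟨u, v, h, rfl⟩

theorem graphInput_bounded {n A B : ℕ} (G : SimpleGraph (Fin n)) (hA : 0 < A) (hA' : n * n ≤ A)
    (hB : n + n * n ≤ B) : Bounded A B (graphInput G) where
  address a i h := by
    classical
    rw [graphInput_apply] at h
    by_cases h0 : (0, 0) = (a, i)
    · cases h0
      exact ⟨by omega, hA⟩
    · rw [if_neg h0, zero_add] at h
      obtain ⟨u, -, hu⟩ := Finset.exists_ne_zero_of_sum_ne_zero h
      obtain ⟨v, -, hv⟩ := Finset.exists_ne_zero_of_sum_ne_zero hu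
      have hv' : G.Adj u v ∧ (1, (u : ℕ) * n + v) = (a, i) := by
        by_contra hcon
        exact hv (if_neg hcon)
      obtain ⟨rfl, rfl⟩ := Prod.mk_inj.1 hv'.2
      refine ⟨by omega, lt_of_lt_of_le ?_ hA'⟩
      have := OddCycle.add_mul_lt v.2 u.2
      rwa [mul_comm, add_comm]
  size c := by
    classical
    refine (size_le_self _).trans (le_trans ?_ hB)
    rw [graphInput_apply]
    refine add_le_add (by split_ifs <;> omega) ?_
    calc ∑ i : Fin n, ∑ j : Fin n, (if G.Adj i j ∧ (1, (i : ℕ) * n + j) = c then 1 else 0)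
        ≤ ∑ _i : Fin n, ∑ _j : Fin n, 1 :=
          Finset.sum_le_sum fun i _ => Finset.sum_le_sum fun j _ => by split_ifs <;> omega
      _ = n * n := by simp

theorem Exec.mono {S S' : ℕ} (hS : S ≤ S') {p : Prog} {σ τ : Store} {w : List Bool} {t : ℕ}
    (h : Exec S p σ w t τ) : Exec S' p σ w t τ := by
  induction h with
  | skip σ h => exact .skip σ (h.trans hS)
  | write a i e σ h => exact .write a i e σ (h.trans hS)
  | flip a b σ h => exact .flip a b σ (h.trans hS)
  | seq p q _ _ _ _ _ _ _ _ _ ih₁ ih₂ => exact .seq p q _ _ _ _ _ _ _ ih₁ ih₂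
  | cond_true e p q _ _ _ _ he h _ ih => exact .cond_true e p q _ _ _ _ he (h.trans hS) ih
  | cond_false e p q _ _ _ _ he h _ ih => exact .cond_false e p q _ _ _ _ he (h.trans hS) ih
  | loop_done e p _ he h => exact .loop_done e p _ he (h.trans hS)
  | loop_step e p _ _ _ _ _ _ _ he h _ _ ih₁ ih₂ =>
    exact .loop_step e p _ _ _ _ _ _ _ he (h.trans hS) ih₁ ih₂

end RAM

/-! ### Polynomial bounds -/

/-- Bounded by a polynomial. -/
def PolyBounded (f : ℕ → ℕ) : Prop := ∃ c, ∀ n, f n ≤ c * (n + 1) ^ c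

namespace PolyBounded

theorem mul_pow_mono {c c' : ℕ} (h : c ≤ c') (n : ℕ) : c * (n + 1) ^ c ≤ c' * (n + 1) ^ c' :=
  Nat.mul_le_mul h (Nat.pow_le_pow_right (by omega) h)

theorem const (a : ℕ) : PolyBounded fun _ => a :=
  ⟨a, fun n => Nat.le_mul_of_pos_right _ (by positivity)⟩

theorem id : PolyBounded fun n => n := ⟨1, fun n => by simp⟩

theorem add {f g : ℕ → ℕ} (hf : PolyBounded f) (hg : PolyBounded g) :
    PolyBounded fun n => f n + g n := by
  obtain ⟨c, hc⟩ := hf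
  obtain ⟨e, he⟩ := hg
  refine ⟨c + e, fun n => ?_⟩
  calc f n + g n ≤ c * (n + 1) ^ c + e * (n + 1) ^ e := add_le_add (hc n) (he n)
    _ ≤ c * (n + 1) ^ (c + e) + e * (n + 1) ^ (c + e) := by
        gcongr <;> omega
    _ = _ := by ring

theorem mul {f g : ℕ → ℕ} (hf : PolyBounded f) (hg : PolyBounded g) :
    PolyBounded fun n => f n * g n := by
  obtain ⟨c, hc⟩ := hf
  obtain ⟨e, he⟩ := hg
  refine ⟨c * e + (c + e), fun n => ?_⟩
  calc f n * g n ≤ (c * (n + 1) ^ c) * (e * (n + 1) ^ e) := Nat.mul_le_mul (hc n) (he n)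
    _ = (c * e) * (n + 1) ^ (c + e) := by ring
    _ ≤ _ := Nat.mul_le_mul (Nat.le_add_right _ _)
        (Nat.pow_le_pow_right (by omega) (Nat.le_add_left _ _))

end PolyBounded

namespace OddCycle

open RAM

/-- The program. -/
def mainProg (k : ℕ) : Prog := .seq (setupProg k) (trialsProg k)

/-- A bound for the addresses. -/
def addrBound (k n : ℕ) : ℕ := pairCount n (2 * k + 1) + n + 1

/-- A bound for the bit lengths. -/
def bitBound (k n : ℕ) : ℕ :=
  pcTime n (2 * k + 1) + n * flipCount k n + pairCount n (2 * k + 1) + (n + n * n) + (2 * k + 1) +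
    (rateNum k + rateDen k) * (n + 1) + 10

theorem size_pow_le (p j : ℕ) : Nat.size (p ^ j) ≤ p * j + 1 := by
  rw [Nat.size_le]
  calc p ^ j ≤ (2 ^ p) ^ j := Nat.pow_le_pow_left Nat.lt_two_pow_self.le _
    _ = 2 ^ (p * j) := (pow_mul _ _ _).symm
    _ < 2 ^ (p * j + 1) := Nat.pow_lt_pow_right (by norm_num) (by omega)

theorem size_pow_le_bitBound {k n j p : ℕ} (hp : p ≤ rateNum k + rateDen k)
    (hj : j ≤ n / (2 * k + 1) + 1) : Nat.size (p ^ j) + 9 ≤ bitBound k n := by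
  have h1 := size_pow_le p j
  have h2 : p * j ≤ (rateNum k + rateDen k) * (n + 1) :=
    Nat.mul_le_mul hp (hj.trans (by have := Nat.div_le_self n (2 * k + 1); omega))
  unfold bitBound
  omega

theorem size_trialCount_le (k n : ℕ) : Nat.size (trialCount k n) ≤ bitBound k n := by
  have h1 := size_pow_le_bitBound (k := k) (n := n) (p := rateNum k) (by omega) le_rfl
  have h2 := size_mul_le 4
    (rateNum k ^ (n / (2 * k + 1) + 1) / rateDen k ^ (n / (2 * k + 1) + 1) + 1)
  have h3 := size_add_le
    (rateNum k ^ (n / (2 * k + 1) + 1) / rateDen k ^ (n / (2 * k + 1) + 1)) 1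
  have h4 := Nat.size_le_size (Nat.div_le_self (rateNum k ^ (n / (2 * k + 1) + 1))
    (rateDen k ^ (n / (2 * k + 1) + 1)))
  have h5 := size_le_self 4
  have h6 := size_le_self 1
  unfold trialCount
  omega

theorem fits (k n : ℕ) : Fits k n (addrBound k n) (bitBound k n) where
  pos := by unfold addrBound; omega
  vertex := by unfold addrBound; omega
  pair := by unfold addrBound; omega
  one_le := by unfold bitBound; omega
  base := by unfold bitBound; omega
  flips := by unfold bitBound; omega
  pair' := by unfold bitBound; omega
  time := by unfold bitBound; omega

open Classical in
theorem runs_mainProg {k n : ℕ} (hk : 1 ≤ k) (G : SimpleGraph (Fin n)) (ω : ℕ → Bool) :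
    ∃ τ, Runs (addrBound k n) (bitBound k n) (mainProg k).weight (mainProg k) (graphInput G)
        ((List.range (trialCount k n * (n * flipCount k n))).map ω)
        ((n / (2 * k + 1) + 1) * 4 + 5 + (trialCount k n * (trialSteps k n + 1) + 1)) τ ∧
      τ (2, 0) = if ∃ i < trialCount k n, HasListHom k G
        (fun v => drawnList k n (fun j => ω (i * (n * flipCount k n) + j)) v) then 1 else 0 := by
  have hf := fits k n
  have hb : Bounded (addrBound k n) (bitBound k n) (graphInput G) := by
    refine graphInput_bounded G hf.pos ?_ (by unfold bitBound; omega)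
    have : n * n ≤ pairCount n (2 * k + 1) := by
      unfold pairCount
      calc n * n = 1 * (1 * (n * n)) := by ring
        _ ≤ _ := by gcongr <;> omega
    unfold addrBound
    omega
  obtain ⟨σ, hr, hbσ, ha, h4⟩ := runs_setupProg (W := (mainProg k).weight) hf
    (by simp only [mainProg, Prog.weight]; omega) hb (graphInput_zero G)
    (by
      have := Nat.div_le_self n (2 * k + 1)
      unfold bitBound
      omega)
    (fun j hj => by
      have := size_pow_le_bitBound (p := rateNum k) (by omega) hj
      omega)
    (fun j hj => by
      have := size_pow_le_bitBound (p := rateDen k) (by omega) hj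
      omega)
    (size_trialCount_le k n)
  obtain ⟨τ, hr', h2⟩ := runs_trialsProg (W := (mainProg k).weight) hk hf
    (by simp only [mainProg, Prog.weight]; omega) (G := G) hbσ
    ((ha 0 0 (by simp)).trans (graphInput_zero G))
    (fun u v => by rw [ha 1 _ (by simp)]; exact graphInput_adj G u v)
    ((ha 2 0 (by simp)).trans (graphInput_answer G)) h4 ω
  exact ⟨τ, hr.seq hr', h2⟩

/-! #### Soundness -/

theorem exists_range_map_append {a m : ℕ} (h : a ≤ m) (ω : ℕ → Bool) :
    ∃ u, (List.range a).map ω ++ u = (List.range m).map ω := by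
  obtain ⟨b, rfl⟩ := Nat.exists_eq_add_of_le h
  exact ⟨_, by rw [List.range_add, List.map_append]⟩

theorem not_accepts {k n : ℕ} (hk : 1 ≤ k) {G : SimpleGraph (Fin n)}
    (hG : ¬ Nonempty (G →g cycle k)) (w : List Bool) :
    ¬ Accepts (mainProg k) (graphInput G) w := by
  rintro ⟨S, t, τ, h, h1⟩
  set ω : ℕ → Bool := fun i => w.getD i false with hω
  obtain ⟨τ', ⟨t', -, h'⟩, h2⟩ := runs_mainProg hk G ω
  have hw : w = (List.range w.length).map ω := by
    refine List.ext_getElem (by simp) fun i hi _ => ?_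
    simp [hω, hi]
  rw [hw] at h
  obtain ⟨u, hu⟩ := exists_range_map_append
    (le_max_left w.length (trialCount k n * (n * flipCount k n))) ω
  obtain ⟨u', hu'⟩ := exists_range_map_append
    (le_max_right w.length (trialCount k n * (n * flipCount k n))) ω
  obtain ⟨-, rfl⟩ := h.deterministic h' (hu.trans hu'.symm)
  rw [h2, if_neg] at h1
  · exact zero_ne_one h1
  · rintro ⟨i, -, g, -⟩
    exact hG ⟨g⟩

theorem acceptProb_eq_zero {k n : ℕ} (hk : 1 ≤ k) {G : SimpleGraph (Fin n)}
    (hG : ¬ Nonempty (G →g cycle k)) : acceptProb (mainProg k) (graphInput G) = 0 := by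
  unfold acceptProb
  rw [ENNReal.tsum_eq_zero]
  rintro ⟨w, hw⟩
  exact absurd hw (not_accepts hk hG w)

/-! #### Completeness -/

/-- The sequence of coin flips given by the flips of all trials. -/
def stream {k n N : ℕ} (F : Fin N → Block k n) (t : ℕ) : Bool :=
  if h : t / (n * flipCount k n) < N ∧ t % (n * flipCount k n) / flipCount k n < n ∧
      t % (n * flipCount k n) % flipCount k n < flipCount k n
  then F ⟨_, h.1⟩ ⟨_, h.2.1⟩ ⟨_, h.2.2⟩ else false

theorem stream_apply {k n N : ℕ} (F : Fin N → Block k n) (i : Fin N) (v : Fin n)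
    (b : Fin (flipCount k n)) :
    stream F (i * (n * flipCount k n) + (v * flipCount k n + b)) = F i v b := by
  have hr : 0 < flipCount k n := by unfold flipCount; omega
  have hm : (v : ℕ) * flipCount k n + b < n * flipCount k n := by
    have := add_mul_lt b.2 v.2
    rwa [mul_comm, add_comm, mul_comm n]
  have e1 : ((i : ℕ) * (n * flipCount k n) + (v * flipCount k n + b)) / (n * flipCount k n) = i := by
    rw [mul_comm (i : ℕ), Nat.mul_add_div (by omega), Nat.div_eq_of_lt hm, add_zero]
  have e2 : ((i : ℕ) * (n * flipCount k n) + (v * flipCount k n + b)) % (n * flipCount k n) =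
      v * flipCount k n + b := by
    rw [Nat.mul_add_mod', Nat.mod_eq_of_lt hm]
  have e3 : ((v : ℕ) * flipCount k n + b) / flipCount k n = v := by
    rw [mul_comm (v : ℕ), Nat.mul_add_div hr, Nat.div_eq_of_lt b.2, add_zero]
  have e4 : ((v : ℕ) * flipCount k n + b) % flipCount k n = b := by
    rw [Nat.mul_add_mod', Nat.mod_eq_of_lt b.2]
  unfold stream
  simp only [e1, e2, e3, e4]
  rw [dif_pos ⟨i.2, v.2, b.2⟩]

theorem drawnList_stream {k n N : ℕ} (F : Fin N → Block k n) (i : Fin N) :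
    (fun v : Fin n => drawnList k n (fun j => stream F (i * (n * flipCount k n) + j)) v) =
      blockLists (F i) := by
  funext v
  unfold drawnList blockLists
  congr 1
  refine residue_congr fun b hb => ?_
  refine (stream_apply F i v ⟨b, hb⟩).trans ?_
  simp [extendBits, hb]

theorem stream_list_injective {k n N : ℕ} {F F' : Fin N → Block k n}
    (h : (List.range (N * (n * flipCount k n))).map (stream F) =
      (List.range (N * (n * flipCount k n))).map (stream F')) : F = F' := by
  funext i v b
  rw [← stream_apply F i v b, ← stream_apply F' i v b]
  refine List.map_inj_left.1 h _ (List.mem_range.2 ?_)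
  have h1 := add_mul_lt b.2 v.2
  have h2 := add_mul_lt h1 i.2
  calc (i : ℕ) * (n * flipCount k n) + (v * flipCount k n + b)
      = b + flipCount k n * v + flipCount k n * n * i := by ring
    _ < _ := h2
    _ = _ := by ring

theorem two_thirds_le_acceptProb {k n : ℕ} (hk : 1 ≤ k) {G : SimpleGraph (Fin n)}
    (hG : Nonempty (G →g cycle k)) :
    2 / 3 ≤ acceptProb (mainProg k) (graphInput G) := by
  classical
  set N := trialCount k n with hN
  set m := N * (n * flipCount k n) with hm
  set good : Finset (Fin N → Block k n) :=
    (Fintype.piFinset fun _ => badBlocks k G)ᶜ with hgood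
  have hacc : ∀ F ∈ good, Accepts (mainProg k) (graphInput G) ((List.range m).map (stream F)) := by
    intro F hF
    obtain ⟨τ, ⟨t, -, h⟩, h2⟩ := runs_mainProg hk G (stream F)
    refine ⟨_, t, τ, h, ?_⟩
    rw [h2, if_pos]
    rw [hgood, Finset.mem_compl, Fintype.mem_piFinset] at hF
    push Not at hF
    obtain ⟨i, hi⟩ := hF
    refine ⟨i, i.2, ?_⟩
    rw [drawnList_stream F i]
    by_contra hcon
    exact hi (Finset.mem_filter.2 ⟨Finset.mem_univ _, hcon⟩)
  have hcardB : (Fintype.card (Fin N → Block k n) : ℝ) = 2 ^ m := by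
    simp only [Block, Fintype.card_pi, Finset.prod_const, Finset.card_univ, Fintype.card_fin,
      Fintype.card_bool]
    push_cast
    rw [← pow_mul, ← pow_mul, hm]
    ring_nf
  have hcard : (2 / 3 : ℝ) * 2 ^ m ≤ good.card := by
    have h1 : (good.card : ℝ) = 2 ^ m - ((badBlocks k G).card : ℝ) ^ N := by
      rw [hgood, Finset.card_compl, Nat.cast_sub (Finset.card_le_univ _), hcardB,
        Fintype.card_piFinset_const]
      push_cast
      rfl
    have h2 : ((badBlocks k G).card : ℝ) ^ N ≤ 2 ^ m * (1 / 3) := by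
      calc ((badBlocks k G).card : ℝ) ^ N
          ≤ ((Fintype.card (Block k n) : ℝ) * (1 - (alpha k ^ n)⁻¹ / 2)) ^ N :=
            pow_le_pow_left₀ (Nat.cast_nonneg _) (card_badBlocks_le hk hG) _
        _ = 2 ^ m * (1 - (alpha k ^ n)⁻¹ / 2) ^ N := by
            rw [mul_pow, ← hcardB]
            simp
        _ ≤ 2 ^ m * (1 / 3) := mul_le_mul_of_nonneg_left (failure_le hk n) (by positivity)
    rw [h1]
    linarith
  have hinj : Function.Injective (fun F : good =>
      (⟨(List.range m).map (stream F.1), hacc F.1 F.2⟩ :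
        {w : List Bool // Accepts (mainProg k) (graphInput G) w})) := by
    intro F F' h
    exact Subtype.ext (stream_list_injective (Subtype.ext_iff.1 h))
  have hsum : (good.card : ℝ≥0∞) * (2⁻¹ : ℝ≥0∞) ^ m ≤ acceptProb (mainProg k) (graphInput G) := by
    refine le_trans (le_of_eq ?_) (ENNReal.tsum_comp_le_tsum_of_injective hinj
      (fun w => (2⁻¹ : ℝ≥0∞) ^ w.1.length))
    simp
  refine le_trans ?_ hsum
  rw [← ENNReal.inv_pow, ← div_eq_mul_inv, ENNReal.le_div_iff_mul_le (by simp) (by simp)]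
  have h1 : (2 / 3 : ℝ≥0∞) * 2 ^ m = ENNReal.ofReal (2 / 3 * 2 ^ m) := by
    rw [ENNReal.ofReal_mul (by norm_num), ENNReal.ofReal_div_of_pos (by norm_num),
      ENNReal.ofReal_pow (by norm_num)]
    simp
  rw [h1]
  refine (ENNReal.ofReal_le_ofReal hcard).trans ?_
  simp

/-! #### Resources -/

theorem polyBounded_pairCount (k : ℕ) : PolyBounded fun n => pairCount n (2 * k + 1) :=
  (PolyBounded.const _).mul ((PolyBounded.const _).mul (PolyBounded.id.mul PolyBounded.id))

theorem polyBounded_pcTime (k : ℕ) : PolyBounded fun n => pcTime n (2 * k + 1) :=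
  ((polyBounded_pairCount k).add (.const 1)).mul ((polyBounded_pairCount k).mul .id)

theorem polyBounded_flips (k : ℕ) : PolyBounded fun n => n * flipCount k n :=
  PolyBounded.id.mul (PolyBounded.id.add (.const _))

theorem polyBounded_addrBound (k : ℕ) : PolyBounded (addrBound k) :=
  ((polyBounded_pairCount k).add .id).add (.const 1)

theorem polyBounded_bitBound (k : ℕ) : PolyBounded (bitBound k) :=
  ((((((polyBounded_pcTime k).add (polyBounded_flips k)).add (polyBounded_pairCount k)).add
    (PolyBounded.id.add (PolyBounded.id.mul .id))).add (.const _)).add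
    ((PolyBounded.const _).mul (PolyBounded.id.add (.const 1)))).add (.const _)

theorem polyBounded_trialSteps (k : ℕ) : PolyBounded (trialSteps k) :=
  ((((polyBounded_flips k).mul (.const 4)).add ((polyBounded_pairCount k).mul (.const 3))).add
    ((polyBounded_pcTime k).mul (.const 3))).add (.const 8)

/-- The polynomial factor of the running time. -/
def timeFactor (k n : ℕ) : ℕ :=
  ((n + 1) * 4 + 6 + 4 * (rateNum k + 1) * (trialSteps k n + 1)) *
    ((mainProg k).weight * bitBound k n)

theorem polyBounded_timeFactor (k : ℕ) : PolyBounded (timeFactor k) :=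
  ((((PolyBounded.id.add (.const 1)).mul (.const 4)).add (.const 6)).add
    ((PolyBounded.const _).mul ((polyBounded_trialSteps k).add (.const 1)))).mul
    ((PolyBounded.const _).mul (polyBounded_bitBound k))

theorem polyBounded_space (k : ℕ) : PolyBounded fun n =>
    spaceBound (addrBound k n) (bitBound k n) + (mainProg k).weight * bitBound k n :=
  (((PolyBounded.const 10).mul (polyBounded_addrBound k)).mul
    (((PolyBounded.const 1).add (polyBounded_addrBound k)).add (polyBounded_bitBound k))).add
    ((PolyBounded.const _).mul (polyBounded_bitBound k))

theorem steps_le {k : ℕ} (hk : 1 ≤ k) (n : ℕ) :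
    ((((n / (2 * k + 1) + 1) * 4 + 5 + (trialCount k n * (trialSteps k n + 1) + 1)) *
      ((mainProg k).weight * bitBound k n) : ℕ) : ℝ) ≤ alpha k ^ n * timeFactor k n := by
  have hα : 1 ≤ alpha k ^ n := one_le_pow₀ (one_le_alpha hk)
  have hN := trialCount_le hk n
  unfold timeFactor
  push_cast
  rw [← mul_assoc (alpha k ^ n)]
  refine mul_le_mul_of_nonneg_right ?_ (by positivity)
  have hdiv : ((n / (2 * k + 1) : ℕ) : ℝ) ≤ n := by exact_mod_cast Nat.div_le_self _ _
  have h1 : (trialCount k n : ℝ) * (trialSteps k n + 1) ≤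
      4 * (rateNum k + 1) * alpha k ^ n * (trialSteps k n + 1) :=
    mul_le_mul_of_nonneg_right hN (by positivity)
  have h2 : ((n : ℝ) + 1) * 4 + 6 ≤ alpha k ^ n * ((n + 1) * 4 + 6) :=
    le_mul_of_one_le_left (by positivity) hα
  linarith

theorem haltsWithin_mainProg {k : ℕ} (hk : 1 ≤ k) : ∃ c : ℕ, ∀ (n : ℕ) (G : SimpleGraph (Fin n)),
    HaltsWithin (mainProg k) (graphInput G) ((c : ℝ) * alpha k ^ n * ((n : ℝ) + 1) ^ c)
      (c * (n + 1) ^ c) := by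
  obtain ⟨c₁, h₁⟩ := polyBounded_timeFactor k
  obtain ⟨c₂, h₂⟩ := polyBounded_space k
  refine ⟨max c₁ c₂, fun n G ω => ?_⟩
  obtain ⟨τ, ⟨t, ht, h⟩, -⟩ := runs_mainProg hk G ω
  refine ⟨_, t, τ, h.mono ((h₂ n).trans (PolyBounded.mul_pow_mono (le_max_right _ _) n)), ?_⟩
  have hα : 0 < alpha k ^ n := pow_pos (alpha_pos hk) n
  have hpoly : (timeFactor k n : ℝ) ≤ (max c₁ c₂ : ℕ) * ((n : ℝ) + 1) ^ max c₁ c₂ := by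
    exact_mod_cast (h₁ n).trans (PolyBounded.mul_pow_mono (le_max_left _ _) n)
  calc (t : ℝ) ≤ _ := Nat.cast_le.2 ht
    _ ≤ alpha k ^ n * timeFactor k n := steps_le hk n
    _ ≤ alpha k ^ n * ((max c₁ c₂ : ℕ) * ((n : ℝ) + 1) ^ max c₁ c₂) :=
        mul_le_mul_of_nonneg_left hpoly hα.le
    _ = _ := by ring

end OddCycle

end

theorem theorem2 (k : ℕ) (hk : 1 ≤ k) :
    -- a randomized algorithm with one-sided error, its running time and its space
    (∃ (P : RAM.Prog) (c : ℕ), ∀ (n : ℕ) (G : SimpleGraph (Fin n)),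
      RAM.HaltsWithin P (RAM.graphInput G)
        ((c : ℝ) * OddCycle.alpha k ^ n * ((n : ℝ) + 1) ^ c) (c * (n + 1) ^ c) ∧
      (Nonempty (G →g OddCycle.cycle k) → 2 / 3 ≤ RAM.acceptProb P (RAM.graphInput G)) ∧
      (¬ Nonempty (G →g OddCycle.cycle k) → RAM.acceptProb P (RAM.graphInput G) = 0)) ∧
    -- lists drawn from the three sets: a majority polymorphism
    (∃ f : Fin (2 * k + 1) → Fin (2 * k + 1) → Fin (2 * k + 1) → Fin (2 * k + 1),
      IsMajority f ∧ ∀ a b : Fin 3,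
        IsPolymorphism f (OddCycle.edgeRel k (OddCycle.listSet k a) (OddCycle.listSet k b))) ∧
    -- the linear program solves every instance with such lists
    (∀ (n : ℕ) (G : SimpleGraph (Fin n)) (c : Fin n → Fin 3),
      (OddCycle.listHomVCSP k G fun v => OddCycle.listSet k (c v)).saOpt 2 3 =
        (OddCycle.listHomVCSP k G fun v => OddCycle.listSet k (c v)).opt ∧
      ((OddCycle.listHomVCSP k G fun v => OddCycle.listSet k (c v)).saOpt 2 3 = 0 ↔
        ∃ g : G →g OddCycle.cycle k, ∀ v, g v ∈ OddCycle.listSet k (c v))) ∧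
    -- a sample succeeds with probability at least `α_k ^ (-n)` if there is a homomorphism
    (∀ (n : ℕ) (G : SimpleGraph (Fin n)), Nonempty (G →g OddCycle.cycle k) →
      (OddCycle.alpha k ^ n)⁻¹ ≤ OddCycle.sampleSuccess k G) := by
  obtain ⟨c, hc⟩ := OddCycle.haltsWithin_mainProg hk
  refine ⟨⟨OddCycle.mainProg k, c, fun n G => ⟨hc n G, OddCycle.two_thirds_le_acceptProb hk,
    OddCycle.acceptProb_eq_zero hk⟩⟩, ⟨OddCycle.majority k, OddCycle.isMajority_majority k,
    OddCycle.isPolymorphism_majority hk⟩, fun n G c => ⟨?_, OddCycle.saOpt_eq_zero_iff G c hk⟩,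
    fun n G => OddCycle.inv_alpha_pow_le_sampleSuccess hk⟩
  classical
  exact (OddCycle.saOpt_eq G c hk).trans (OddCycle.opt_eq G c hk).symm
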